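/- **Proposition.** Let $(M^3,g,k)$ be an asymptotically flat initial data set ($g$ a Riemannian metric, $k$ a symmetric 2-tensor), i.e. outside a compact set $M$ is a finite disjoint union of ends, each with coordinates $x=(x^1,x^2,x^3)$ ranging over the complement of a ball in $\mathbb R^3$, in which $g_{ij}-\delta_{ij}=O(r^{\alpha})$ and $k_{ij}=O(r^\beta)$ with $\alpha,\beta<0$, $r=|x|$, together with the corresponding decay of two derivatives of $g_{ij}$ and one derivative of $k_{ij}$. Suppose that an end is of harmonic asymptotics: there are a function $u\to 1$ and a vector field $Y\to 0$ (as $r\to\infty$), both of class $C^2$, with $$g_{ij}=u^4\delta_{ij},\qquad k_{ij}=u^2\Big(Y_{i,j}+Y_{j,i}-\tfrac12\sum_l Y_{l,l}\,\delta_{ij}\Big),$$ where $Y_{i,j}=\partial_jY_i$, and that $$u=1+\frac Ar+\frac{u^{(-2)}}{r^2}+o(r^{-2}),\qquad Y_i=\frac{B_i}{r}+\frac{Y_i^{(-2)}}{r^2}+o(r^{-2}),$$ with constants $A,B_i$ and $C^2$ functions $u^{(-2)},Y_i^{(-2)}$ on $S^2$, where, as usual, the expansions may be differentiated twice term by term (the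 first and second partial derivatives of the remainders are $o(r^{-3})$ and $o(r^{-4})$). Let $\Sigma_r=\{|x|=r\}$, identified with the unit sphere $S^2$ by $\tilde X\mapsto r\tilde X$, let $\tilde\sigma$ be the round metric of $S^2$, let $\tilde X^i$ be its coordinate functions, and let $\partial_a$ denote differentiation on $S^2$. Let $\sigma$ be the induced metric of $\Sigma_r$, let $H$ be its mean curvature vector in a spacetime in which $M$ has induced metric $g$ and second fundamental form $k(v,w)=\langle\nabla_v n,w\rangle$ ($n$ the future unit normal), and let $\alpha_H(\cdot)=\langle\nabla_{(\cdot)}\frac{J}{|H|},\frac{H}{|H|}\rangle$ be its connection one-form in the mean curvature gauge, $J$ being the reflection of $H$ through the incoming light cone of the normal bundle; these depend only on $(g,k)$. Then, as $r\to\infty$, uniformly on $S^2$, $$\sigma_{ab}=r^2\tilde\sigma_{ab}+4Ar\,\tilde\sigma_{ab}+(4u^{(-2)}+6A^2)\tilde\sigma_{ab}+o(1),$$ $$|H|=\frac2r-\frac{8A}{r^{2}}+\frac1{r^{3}}\Big[-12u^{(-2)}+18A^2-\tfrac14\Big(\sum_kB_k\tilde X^k\Big)^2\Big]+o(r^{-3}).$$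 If moreover $(g,k)$ satisfies on this end the vacuum constraint equations $R(g)+(\mathrm{tr}_gk)^2-|k|_g^2=0$ and $\mathrm{div}_g(k-(\mathrm{tr}_gk)g)=0$, then there are constants $d_{ij}$ with $$Y_i^{(-2)}=\sum_jd_{ij}\tilde X^j+A\Big(-\tfrac52B_i+\tfrac12\Big(\sum_kB_k\tilde X^k\Big)\tilde X^i\Big),$$ and $$(\alpha_H)_a=\frac32\,\frac{1}{r}\,\partial_a\Big(\sum_kB_k\tilde X^k\Big)-\frac1{r^{2}}\Big[6A\sum_kB_k\,\partial_a\tilde X^k-\frac52\sum_{i,j}d_{ij}(\partial_a\tilde X^i)\tilde X^j+\frac12\sum_{i,j}d_{ij}\tilde X^i\,\partial_a\tilde X^j\Big]+o(r^{-2}).$$ -/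

import Mathlib

open scoped Manifold ContDiff Topology
open Asymptotics Filter Bornology

noncomputable section

namespace HarmonicAsymptotics

/-- Euclidean three-space, the model of the asymptotically flat coordinates. -/
abbrev E3 : Type := EuclideanSpace ℝ (Fin 3)

/-- The round unit sphere `S²`. -/
abbrev S2 : Type := Metric.sphere (0 : E3) 1

instance finrank_E3 : Fact (Module.finrank ℝ E3 = 2 + 1) := ⟨by simp⟩

/-- The coordinate vector `∂ᵢ`. -/
def basisVec (i : Fin 3) : E3 := EuclideanSpace.single i 1

/-- The partial derivative `∂ᵢ f`. -/
def pd (i : Fin 3) (f : E3 → ℝ) (x : E3) : ℝ := fderiv ℝ f x (basisVec i)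

/-- Components of a symmetric 2-tensor in a coordinate system. -/
abbrev Tensor2 : Type := E3 → Matrix (Fin 3) (Fin 3) ℝ

/-! ### Riemannian geometry in coordinates and the vacuum constraint equations -/

section Coordinates

variable (g k : Tensor2)

/-- `g^{ij}`. -/
def gInv (x : E3) : Matrix (Fin 3) (Fin 3) ℝ := (g x)⁻¹

/-- The Christoffel symbols `Γ^l_{ij}`. -/
def christoffel (l i j : Fin 3) (x : E3) : ℝ :=
  (1 / 2) * ∑ m, gInv g x l m *
    (pd i (fun y => g y m j) x + pd j (fun y => g y m i) x - pd m (fun y => g y i j) x)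

/-- The Ricci tensor
`R_{ij} = ∂_l Γ^l_{ij} - ∂_j Γ^l_{il} + Γ^l_{lm} Γ^m_{ij} - Γ^l_{jm} Γ^m_{il}`. -/
def ricci (i j : Fin 3) (x : E3) : ℝ :=
  ∑ l, (pd l (christoffel g l i j) x - pd j (christoffel g l i l) x +
    ∑ m, (christoffel g l l m x * christoffel g m i j x
      - christoffel g l j m x * christoffel g m i l x))

/-- The scalar curvature `R(g)`. -/
def scalarCurvature (x : E3) : ℝ := ∑ i, ∑ j, gInv g x i j * ricci g i j x

/-- `tr_g T`. -/
def trace (T : Tensor2) (x : E3) : ℝ := ∑ i, ∑ j, gInv g x i j * T x i j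

/-- `|T|_g²`. -/
def normSq (T : Tensor2) (x : E3) : ℝ :=
  ∑ i, ∑ j, ∑ l, ∑ m, gInv g x i l * gInv g x j m * T x i j * T x l m

/-- The covariant derivative `∇_l T_{ij}`. -/
def covDeriv (T : Tensor2) (l i j : Fin 3) (x : E3) : ℝ :=
  pd l (fun y => T y i j) x
    - ∑ m, (christoffel g m l i x * T x m j + christoffel g m l j x * T x i m)

/-- The divergence `(div_g T)_i = g^{jl} ∇_l T_{ij}`. -/
def divergence (T : Tensor2) (i : Fin 3) (x : E3) : ℝ :=
  ∑ j, ∑ l, gInv g x j l * covDeriv g T l i j x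

/-- The vacuum constraint equations
`R(g) + (tr_g k)² - |k|_g² = 0`, `div_g (k - (tr_g k) g) = 0` on the region `U`. -/
def VacuumConstraintOn (U : Set E3) : Prop :=
  ∀ x ∈ U, scalarCurvature g x + trace g k x ^ 2 - normSq g k x = 0 ∧
    ∀ i, divergence g (fun y => k y - trace g k y • g y) i x = 0

end Coordinates

/-! ### The geometry of coordinate spheres in the spacetime

A spacetime vector field along the initial hypersurface is `V^i ∂_i + f n`, where `n` is the future
unit timelike normal; it is represented by the pair `(V, f)`. The Levi-Civita connection of any
spacetime in which the hypersurface has induced metric `g` and second fundamental form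
`k(v, w) = ⟨∇_v n, w⟩` acts on such fields, in directions tangent to the hypersurface, by the
formulas of Gauss and Weingarten. -/

/-- Spacetime vectors at a point of the hypersurface: `(V, f)` stands for `V^i ∂_i + f n`. -/
abbrev STVec : Type := (Fin 3 → ℝ) × ℝ

section Spheres

variable (g k : Tensor2)

/-- The spacetime metric at points of the hypersurface. -/
def stInner (x : E3) (Z W : STVec) : ℝ :=
  (∑ i, ∑ j, g x i j * Z.1 i * W.1 j) - Z.2 * W.2

/-- The spacetime covariant derivative `∇_v (V + f n)` at `x`, for `v` tangent to the hypersurface: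
`∇_v V + k(v, V) n + (v f) n + f k(v, ·)^♯`. -/
def stCov (v : E3) (Z : E3 → STVec) (x : E3) : STVec :=
  (fun l => fderiv ℝ (fun y => (Z y).1 l) x v
      + (∑ i, ∑ j, christoffel g l i j x * v i * (Z x).1 j)
      + (Z x).2 * ∑ m, ∑ i, gInv g x l m * k x i m * v i,
    fderiv ℝ (fun y => (Z y).2) x v + ∑ i, ∑ j, k x i j * v i * (Z x).1 j)

/-- The `g`-unit normal of the coordinate spheres pointing to infinity: `grad r / |grad r|`. -/
def sphereNormal (x : E3) : Fin 3 → ℝ := fun i =>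
  (∑ j, gInv g x i j * pd j (fun y => ‖y‖) x) /
    Real.sqrt (∑ j, ∑ l, gInv g x j l * pd j (fun y => ‖y‖) x * pd l (fun y => ‖y‖) x)

/-- The spacelike unit normal `e₃` of the coordinate spheres (outward, tangent to the
hypersurface). -/
def e3 (x : E3) : STVec := (sphereNormal g x, 0)

/-- The future timelike unit normal `e₄ = n` of the hypersurface. -/
def e4 (_x : E3) : STVec := (0, 1)

/-- The trace `σ^{ab} ⟨∇_a N, ∂_b⟩` over the tangent plane of the coordinate sphere through `x`;
as a tensor on the hypersurface `σ^{ij} = g^{ij} - ν^i ν^j`. -/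
def tangentialTrace (N : E3 → STVec) (x : E3) : ℝ :=
  ∑ i, ∑ j, (gInv g x i j - sphereNormal g x i * sphereNormal g x j) *
    stInner g x (stCov g k (basisVec i) N x) (fun l => basisVec j l, 0)

/-- The mean curvature vector `H` of the coordinate sphere through `x` in the spacetime: the normal
vector with `⟨H, N⟩ = -σ^{ab} ⟨∇_a N, ∂_b⟩` for normal `N`
(it points inward on a round sphere in flat space). -/
def meanCurvatureVec (x : E3) : STVec :=
  (-tangentialTrace g k (e3 g) x) • e3 g x + tangentialTrace g k e4 x • e4 x

/-- `|H|`, for spacelike `H`. -/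
def normH (x : E3) : ℝ :=
  Real.sqrt (stInner g x (meanCurvatureVec g k x) (meanCurvatureVec g k x))

/-- `J`, the reflection of `H` through the incoming light cone in the normal bundle. This reflection
fixes the incoming null vector `e₄ - e₃` and negates the outgoing one `e₄ + e₃`, so it maps
`e₃` to `-e₄` and `e₄` to `-e₃`. -/
def reflectedH (x : E3) : STVec :=
  (-stInner g x (meanCurvatureVec g k x) (e3 g x)) • e4 x
    + stInner g x (meanCurvatureVec g k x) (e4 x) • e3 g x

/-- The connection one-form of the normal bundle in the mean curvature gauge,
`α_H(v) = ⟨∇_v (J / |H|), H / |H|⟩`, at `x` and for `v` tangent to the coordinate sphere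
through `x`. -/
def alphaH (x v : E3) : ℝ :=
  stInner g x (stCov g k v (fun y => (normH g k y)⁻¹ • reflectedH g k y) x)
    ((normH g k x)⁻¹ • meanCurvatureVec g k x)

/-- The metric induced on `Σ_r`, pulled back to `S²` by `θ ↦ r θ`, whose differential is
`v ↦ r v`. -/
def sigmaOn (r : ℝ) (θ : S2) (v w : E3) : ℝ :=
  ∑ i, ∑ j, g (r • (θ : E3)) i j * (r • v) i * (r • w) j

/-- `|H|` on `Σ_r`, as a function on `S²`. -/
def normHOn (r : ℝ) (θ : S2) : ℝ := normH g k (r • (θ : E3))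

/-- The one-form `α_H` on `Σ_r`, pulled back to `S²` by `θ ↦ r θ`. -/
def alphaHOn (r : ℝ) (θ : S2) (v : E3) : ℝ := alphaH g k (r • (θ : E3)) (r • v)

end Spheres

/-! ### Asymptotically flat initial data sets -/

/-- An initial data set `(M, g, k)`: a smooth Riemannian metric and a smooth symmetric 2-tensor on
a smooth 3-manifold. -/
structure InitialDataSet (M : Type*) [TopologicalSpace M] [ChartedSpace E3 M]
    [IsManifold (𝓡 3) ∞ M] where
  /-- the metric -/
  g : Bundle.ContMDiffRiemannianMetric (𝓡 3) ∞ E3 (fun p : M => TangentSpace (𝓡 3) p)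
  /-- the second fundamental form -/
  k : ∀ p : M, TangentSpace (𝓡 3) p →L[ℝ] TangentSpace (𝓡 3) p →L[ℝ] ℝ
  k_symm : ∀ p v w, k p v w = k p w v
  k_smooth : ContMDiff (𝓡 3) ((𝓡 3).prod 𝓘(ℝ, E3 →L[ℝ] E3 →L[ℝ] ℝ)) ∞
    (fun p => Bundle.TotalSpace.mk' (E3 →L[ℝ] E3 →L[ℝ] ℝ)
      (E := fun p : M => TangentSpace (𝓡 3) p →L[ℝ] TangentSpace (𝓡 3) p →L[ℝ] ℝ) p (k p))

section Manifold

variable {M : Type*} [TopologicalSpace M] [ChartedSpace E3 M] [IsManifold (𝓡 3) ∞ M]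

/-- The coordinate vector field `∂ᵢ` of a chart, at the point with coordinates `x`. -/
def coordVec (φ : OpenPartialHomeomorph M E3) (x : E3) (i : Fin 3) :
    TangentSpace (𝓡 3) (φ.symm x) :=
  mfderiv (𝓡 3) (𝓡 3) φ.symm x (basisVec i)

/-- The components `g_{ij}` in a chart. -/
def InitialDataSet.gComp (D : InitialDataSet M) (φ : OpenPartialHomeomorph M E3) : Tensor2 :=
  fun x => Matrix.of fun i j => D.g.inner (φ.symm x) (coordVec φ x i) (coordVec φ x j)

/-- The components `k_{ij}` in a chart. -/
def InitialDataSet.kComp (D : InitialDataSet M) (φ : OpenPartialHomeomorph M E3) : Tensor2 :=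
  fun x => Matrix.of fun i j => D.k (φ.symm x) (coordVec φ x i) (coordVec φ x j)

/-- An asymptotically flat structure: outside of a compact set, `M` is a disjoint union of finitely
many ends, each with a coordinate system onto the complement of a ball, in which
`g_{ij} - δ_{ij} = O(r^α)`, `k_{ij} = O(r^β)`, with the corresponding decay of two derivatives
of `g` and one derivative of `k`. -/
structure AsymptoticallyFlat (D : InitialDataSet M) where
  /-- the compact core -/
  core : Set M
  isCompact_core : IsCompact core
  /-- the number of ends -/
  numEnds : ℕ
  /-- the radii of the removed balls -/
  radius : Fin numEnds → ℝ
  radius_pos : ∀ e, 0 < radius e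
  /-- the asymptotically flat coordinates -/
  chart : Fin numEnds → OpenPartialHomeomorph M E3
  chart_mem : ∀ e, chart e ∈ IsManifold.maximalAtlas (𝓡 3) ∞ M
  chart_target : ∀ e, (chart e).target = {x | radius e < ‖x‖}
  disjoint_ends : Pairwise fun e e' => Disjoint (chart e).source (chart e').source
  iUnion_ends : ⋃ e, (chart e).source = coreᶜ
  /-- the decay exponent of `g - δ` -/
  α : ℝ
  α_neg : α < 0
  /-- the decay exponent of `k` -/
  β : ℝ
  β_neg : β < 0
  g_decay : ∀ e i j, (fun x => D.gComp (chart e) x i j - (1 : Matrix (Fin 3) (Fin 3) ℝ) i j)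
    =O[cobounded E3] fun x => ‖x‖ ^ α
  dg_decay : ∀ e i j l, pd l (fun x => D.gComp (chart e) x i j)
    =O[cobounded E3] fun x => ‖x‖ ^ (α - 1)
  ddg_decay : ∀ e i j l m, pd m (pd l (fun x => D.gComp (chart e) x i j))
    =O[cobounded E3] fun x => ‖x‖ ^ (α - 2)
  k_decay : ∀ e i j, (fun x => D.kComp (chart e) x i j) =O[cobounded E3] fun x => ‖x‖ ^ β
  dk_decay : ∀ e i j l, pd l (fun x => D.kComp (chart e) x i j)
    =O[cobounded E3] fun x => ‖x‖ ^ (β - 1)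

variable {D : InitialDataSet M}

/-- The coordinate region of an end. -/
def AsymptoticallyFlat.region (a : AsymptoticallyFlat D) (e : Fin a.numEnds) : Set E3 :=
  {x | a.radius e < ‖x‖}

/-- The components of `g` in the coordinates of an end. -/
def AsymptoticallyFlat.gEnd (a : AsymptoticallyFlat D) (e : Fin a.numEnds) : Tensor2 :=
  D.gComp (a.chart e)

/-- The components of `k` in the coordinates of an end. -/
def AsymptoticallyFlat.kEnd (a : AsymptoticallyFlat D) (e : Fin a.numEnds) : Tensor2 :=
  D.kComp (a.chart e)

/-- The end `e` is of harmonic asymptotics with conformal factor `u` and vector field `Y`: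
`g_{ij} = u⁴ δ_{ij}`, `k_{ij} = u² (Y_{i,j} + Y_{j,i} - (1/2) Y_{k,k} δ_{ij})`,
`u → 1` and `Y → 0` at infinity. -/
structure AsymptoticallyFlat.IsHarmonic (a : AsymptoticallyFlat D) (e : Fin a.numEnds)
    (u : E3 → ℝ) (Y : Fin 3 → E3 → ℝ) : Prop where
  contDiffOn_u : ContDiffOn ℝ 2 u (a.region e)
  contDiffOn_Y : ∀ i, ContDiffOn ℝ 2 (Y i) (a.region e)
  g_eq : ∀ x ∈ a.region e, ∀ i j,
    a.gEnd e x i j = u x ^ 4 * (1 : Matrix (Fin 3) (Fin 3) ℝ) i j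
  k_eq : ∀ x ∈ a.region e, ∀ i j,
    a.kEnd e x i j = u x ^ 2 * (pd j (Y i) x + pd i (Y j) x
      - (∑ l, pd l (Y l) x) / 2 * (1 : Matrix (Fin 3) (Fin 3) ℝ) i j)
  tendsto_u : Tendsto u (cobounded E3) (𝓝 1)
  tendsto_Y : ∀ i, Tendsto (Y i) (cobounded E3) (𝓝 0)

end Manifold

/-! ### Expansions at infinity -/

/-- The direction `x / |x|` (with an arbitrary value at `x = 0`). -/
def direction (x : E3) : S2 :=
  if h : x = 0 then ⟨basisVec 0, by simp [basisVec]⟩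
  else ⟨‖x‖⁻¹ • x, by simp [norm_smul, h]⟩

/-- The remainder in `f = c₀ + c₁ / r + f₂ / r² + remainder`, where `f₂` is a function on `S²`. -/
def expansionRemainder (f : E3 → ℝ) (c₀ c₁ : ℝ) (f₂ : S2 → ℝ) (x : E3) : ℝ :=
  f x - (c₀ + c₁ / ‖x‖ + f₂ (direction x) / ‖x‖ ^ 2)

/-- The expansion `f = c₀ + c₁ / r + f₂ / r² + o(r⁻²)` at infinity, for a `C²` function `f₂` on
`S²`; it may be differentiated twice term by term, that is, the first derivatives of the remainder
are `o(r⁻³)` and the second ones are `o(r⁻⁴)`. -/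
structure HasExpansion (f : E3 → ℝ) (c₀ c₁ : ℝ) (f₂ : S2 → ℝ) : Prop where
  contMDiff : ContMDiff (𝓡 2) 𝓘(ℝ, ℝ) 2 f₂
  remainder : expansionRemainder f c₀ c₁ f₂ =o[cobounded E3] fun x => (‖x‖ ^ 2)⁻¹
  remainder_deriv : ∀ i,
    pd i (expansionRemainder f c₀ c₁ f₂) =o[cobounded E3] fun x => (‖x‖ ^ 3)⁻¹
  remainder_deriv₂ : ∀ i j,
    pd j (pd i (expansionRemainder f c₀ c₁ f₂)) =o[cobounded E3] fun x => (‖x‖ ^ 4)⁻¹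

end HarmonicAsymptotics

end

noncomputable section

namespace HarmonicAsymptotics

/-! ### Partial derivatives -/

section PartialDerivatives

variable {f h : E3 → ℝ} {x : E3} (i j : Fin 3)

/-! Write `g = u⁴ δ`, `k = u² L`, `X = x / r`, `ρ = 1 / r`. For such conformally flat data the
geometry of the coordinate spheres reduces to two scalar functions. The mean curvature of the
spheres in `g` is `u⁻² η` with `η = 2 / r + 4 ∂_r u / u`, and the trace of `k` over the spheres is
`u⁻² ϖ` with `ϖ = tr L - L(X, X)`. Hence `|H| = u⁻² √(η² - ϖ²)`. Moreover `(η, ϖ) / √(η² - ϖ²)` is a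
point `(cosh ψ, sinh ψ)` of the unit hyperbola, and `α_H(v) = dψ(v) - L(v, X)`; this is
`ConformalOn.alphaH_eq`. The expansions of the metric and of `|H|` follow by substitution. The term
in `B` of `|H|` comes from `ϖ = ⟨B, X⟩ / r² + O(r⁻³)`, because `√(η² - ϖ²)` is approximately `η - ϖ²
/ (2η)`.

In vacuum, the momentum constraint reads `Δ Y_i = -u⁻¹ (4 ∂_j u (Y_{i,j} + Y_{j,i}) - 2 ∂_i u div
Y)`. Its terms of order `r⁻⁴` prescribe the Laplacian of the homogeneous extension of `Y_i^{(-2)}`,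
which has degree `-2`. An explicit particular solution, `particularSolution`, leaves a harmonic
function of degree `-2` on punctured space. Such a function is linear on the unit sphere
(`IsHomogeneousNegTwo.exists_linear_of_harmonic`), and its coefficients are the `d_{ij}`.

This linearity is the first eigenspace of the sphere, obtained here from averages. The mean of the
function over circles of latitude about an axis `θ` satisfies the Legendre equation of degree one,
so it equals `Z(θ) cos φ`. Integrating `Z(x) ⟨θ, x⟩` over an annulus and averaging over rotations
about `θ` therefore gives a constant multiple of `Z(θ)`, with a constant independent of `θ`; but the
integral is linear in `θ`. An annulus serves instead of the sphere because Lebesgue measure and its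
invariance under isometries then suffice.

With `Y` known through order `r⁻²`, the expansion of `α_H` is a computation with two
simplifications. Everything proportional to `X` drops out on tangent vectors, and the tangential
derivatives of `η` are `O(r⁻⁴)`, too small to contribute. -/

@[simp] theorem basisVec_apply : basisVec i j = if j = i then 1 else 0 := by
  simp [basisVec, eq_comm]

theorem sum_smul_basisVec (v : E3) : v = ∑ i, v i • basisVec i := by
  ext j
  simp

theorem fderiv_eq_sum_pd (f : E3 → ℝ) (x v : E3) : fderiv ℝ f x v = ∑ i, v i * pd i f x := by
  conv_lhs => rw [sum_smul_basisVec v]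
  simp [pd]

theorem pd_congr (hfh : f =ᶠ[𝓝 x] h) : pd i f x = pd i h x := by
  simp [pd, hfh.fderiv_eq]

@[simp] theorem pd_const (c : ℝ) : pd i (fun _ => c) x = 0 := by
  simp [pd]

theorem pd_add (hf : DifferentiableAt ℝ f x) (hh : DifferentiableAt ℝ h x) :
    pd i (fun y => f y + h y) x = pd i f x + pd i h x := by
  simp [pd, fderiv_fun_add hf hh]

theorem pd_sub (hf : DifferentiableAt ℝ f x) (hh : DifferentiableAt ℝ h x) :
    pd i (fun y => f y - h y) x = pd i f x - pd i h x := by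
  simp [pd, fderiv_fun_sub hf hh]

theorem pd_mul (hf : DifferentiableAt ℝ f x) (hh : DifferentiableAt ℝ h x) :
    pd i (fun y => f y * h y) x = f x * pd i h x + h x * pd i f x := by
  simp [pd, fderiv_fun_mul hf hh]

theorem pd_const_mul (c : ℝ) (hf : DifferentiableAt ℝ f x) :
    pd i (fun y => c * f y) x = c * pd i f x := by
  rw [pd_mul i (differentiableAt_const c) hf]
  simp

theorem pd_mul_const (c : ℝ) (hf : DifferentiableAt ℝ f x) :
    pd i (fun y => f y * c) x = pd i f x * c := by
  rw [pd_mul i hf (differentiableAt_const c)]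
  simp [mul_comm]

theorem pd_pow (n : ℕ) (hf : DifferentiableAt ℝ f x) :
    pd i (fun y => f y ^ n) x = n * f x ^ (n - 1) * pd i f x := by
  simp [pd, fderiv_fun_pow n hf]

theorem pd_inv (hf : DifferentiableAt ℝ f x) (h0 : f x ≠ 0) :
    pd i (fun y => (f y)⁻¹) x = -pd i f x / f x ^ 2 := by
  have := ((hasDerivAt_inv h0).comp_hasFDerivAt x hf.hasFDerivAt).fderiv
  have h1 : fderiv ℝ (fun y => (f y)⁻¹) x = -(f x ^ 2)⁻¹ • fderiv ℝ f x := this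
  simp only [pd, h1]
  simp
  field_simp

theorem pd_div (hf : DifferentiableAt ℝ f x) (hh : DifferentiableAt ℝ h x) (h0 : h x ≠ 0) :
    pd i (fun y => f y / h y) x = (pd i f x * h x - f x * pd i h x) / h x ^ 2 := by
  simp only [div_eq_mul_inv (f _)]
  rw [pd_mul i hf (hh.fun_inv h0), pd_inv i hh h0]
  field_simp
  ring

theorem pd_sum {ι : Type*} (s : Finset ι) {F : ι → E3 → ℝ}
    (hF : ∀ a ∈ s, DifferentiableAt ℝ (F a) x) :
    pd i (fun y => ∑ a ∈ s, F a y) x = ∑ a ∈ s, pd i (F a) x := by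
  simp [pd, fderiv_fun_sum hF]

theorem differentiableAt_pd (hf : ContDiffAt ℝ 2 f x) : DifferentiableAt ℝ (pd i f) x := by
  have : ContDiffAt ℝ 1 (fderiv ℝ f) x := hf.fderiv_right (by norm_num)
  exact (this.differentiableAt (by norm_num)).clm_apply (differentiableAt_const _)

theorem contDiffAt_pd (hf : ContDiffAt ℝ 2 f x) : ContDiffAt ℝ 1 (pd i f) x := by
  have : ContDiffAt ℝ 1 (fderiv ℝ f) x := hf.fderiv_right (by norm_num)
  exact this.clm_apply contDiffAt_const

theorem pd_pd_eq_fderiv (hf : ContDiffAt ℝ 2 f x) :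
    pd i (pd j f) x = fderiv ℝ (fderiv ℝ f) x (basisVec i) (basisVec j) := by
  have h1 : ContDiffAt ℝ 1 (fderiv ℝ f) x := hf.fderiv_right (by norm_num)
  have h2 := h1.differentiableAt (by norm_num)
  unfold pd
  rw [fderiv_clm_apply h2 (differentiableAt_const _)]
  simp

theorem pd_pd_comm (hf : ContDiffAt ℝ 2 f x) : pd i (pd j f) x = pd j (pd i f) x := by
  rw [pd_pd_eq_fderiv i j hf, pd_pd_eq_fderiv j i hf]
  exact (hf.isSymmSndFDerivAt (by simp)) _ _

end PartialDerivatives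

/-! ### The inverse radius and the unit radial vector -/

/-- The inverse radius `1 / |x|`. -/
def rho (x : E3) : ℝ := ‖x‖⁻¹

/-- The components `xⁱ / |x|` of the unit radial vector. -/
def unitCoord (i : Fin 3) (x : E3) : ℝ := x i * ‖x‖⁻¹

section Radial

variable {x : E3} (i j : Fin 3)

theorem sum_sq_coord (x : E3) : ∑ i, x i ^ 2 = ‖x‖ ^ 2 := by
  simp [EuclideanSpace.norm_sq_eq]

theorem rho_pos (hx : x ≠ 0) : 0 < rho x := by
  simpa [rho] using hx

theorem sum_sq_unitCoord (hx : x ≠ 0) : ∑ i, unitCoord i x ^ 2 = 1 := by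
  have : ‖x‖ ≠ 0 := by simpa using hx
  simp only [unitCoord, mul_pow, ← Finset.sum_mul, sum_sq_coord]
  field_simp

theorem contDiffAt_rho (hx : x ≠ 0) : ContDiffAt ℝ 2 rho x :=
  (contDiffAt_norm ℝ hx).inv (by simpa using hx)

theorem contDiffAt_coord : ContDiffAt ℝ 2 (fun y : E3 => y i) x := by
  fun_prop

theorem contDiffAt_unitCoord (hx : x ≠ 0) : ContDiffAt ℝ 2 (unitCoord i) x :=
  (contDiffAt_coord i).mul (contDiffAt_rho hx)

theorem differentiableAt_rho (hx : x ≠ 0) : DifferentiableAt ℝ rho x :=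
  (contDiffAt_rho hx).differentiableAt (by norm_num)

theorem differentiableAt_unitCoord (hx : x ≠ 0) : DifferentiableAt ℝ (unitCoord i) x :=
  (contDiffAt_unitCoord i hx).differentiableAt (by norm_num)

theorem pd_coord : pd i (fun y : E3 => y j) x = if j = i then 1 else 0 := by
  have : (fun y : E3 => y j) = EuclideanSpace.proj (𝕜 := ℝ) j := rfl
  rw [pd, this, ContinuousLinearMap.fderiv]
  simp

theorem pd_norm (hx : x ≠ 0) : pd i (fun y : E3 => ‖y‖) x = unitCoord i x := by
  have hd : DifferentiableAt ℝ (fun y : E3 => ‖y‖) x :=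
    (contDiffAt_norm (n := 2) ℝ hx).differentiableAt (by norm_num)
  have h1 : pd i (fun y : E3 => ‖y‖ ^ 2) x = pd i (fun y : E3 => ∑ j, y j ^ 2) x := by
    simp only [sum_sq_coord]
  rw [pd_pow i 2 hd, pd_sum i Finset.univ (by intros; fun_prop)] at h1
  have h2 : ∀ j, pd i (fun y : E3 => y j ^ 2) x = 2 * x j * if j = i then 1 else 0 := by
    intro j
    rw [pd_pow i 2 (by fun_prop), pd_coord]
    simp
  have hn : ‖x‖ ≠ 0 := by simpa using hx
  simp only [h2] at h1
  simp at h1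
  rw [unitCoord]
  field_simp
  linarith

theorem pd_rho (hx : x ≠ 0) : pd i rho x = -unitCoord i x * rho x ^ 2 := by
  have hd : DifferentiableAt ℝ (fun y : E3 => ‖y‖) x :=
    (contDiffAt_norm (n := 2) ℝ hx).differentiableAt (by norm_num)
  have hn : ‖x‖ ≠ 0 := by simpa using hx
  unfold rho
  rw [pd_inv i hd hn, pd_norm i hx]
  field_simp

theorem pd_unitCoord (hx : x ≠ 0) : pd i (unitCoord j) x =
    ((if j = i then 1 else 0) - unitCoord j x * unitCoord i x) * rho x := by
  have h : unitCoord j = fun y : E3 => y j * rho y := rfl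
  rw [h, pd_mul i (by fun_prop) (differentiableAt_rho hx), pd_coord, pd_rho i hx]
  simp only [rho, unitCoord]
  ring

end Radial

/-! ### Conformally flat data -/

/-- On the open set `U`, which does not contain the origin, `g = u⁴ δ` and `k = u² L`. -/
structure ConformalOn (g k : Tensor2) (u : E3 → ℝ) (L : Fin 3 → Fin 3 → E3 → ℝ) (U : Set E3) :
    Prop where
  isOpen : IsOpen U
  ne_zero : ∀ x ∈ U, x ≠ 0
  contDiffAt_u : ∀ x ∈ U, ContDiffAt ℝ 2 u x
  u_pos : ∀ x ∈ U, 0 < u x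
  g_eq : ∀ x ∈ U, ∀ i j, g x i j = u x ^ 4 * (1 : Matrix (Fin 3) (Fin 3) ℝ) i j
  k_eq : ∀ x ∈ U, ∀ i j, k x i j = u x ^ 2 * L i j x
  L_symm : ∀ x ∈ U, ∀ i j, L i j x = L j i x
  differentiableAt_L : ∀ x ∈ U, ∀ i j, DifferentiableAt ℝ (L i j) x

/-- The mean curvature of the coordinate spheres in the metric `u⁴ δ` is `u⁻² η`. -/
def etaFun (u : E3 → ℝ) (x : E3) : ℝ :=
  2 * rho x + 4 * (∑ j, pd j u x * unitCoord j x) / u x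

/-- The trace of `u² L` over the coordinate spheres with respect to `u⁴ δ` is `u⁻² ϖ`. -/
def piFun (L : Fin 3 → Fin 3 → E3 → ℝ) (x : E3) : ℝ :=
  ∑ j, L j j x - ∑ a, ∑ b, L a b x * unitCoord a x * unitCoord b x

namespace ConformalOn

variable {g k : Tensor2} {u : E3 → ℝ} {L : Fin 3 → Fin 3 → E3 → ℝ} {U : Set E3}
  (H : ConformalOn g k u L U) {x : E3}

include H

theorem mem_nhds (hx : x ∈ U) : U ∈ 𝓝 x := H.isOpen.mem_nhds hx

theorem differentiableAt_u (hx : x ∈ U) : DifferentiableAt ℝ u x :=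
  (H.contDiffAt_u x hx).differentiableAt (by norm_num)

theorem gInv_eq (hx : x ∈ U) (i j : Fin 3) :
    gInv g x i j = (u x ^ 4)⁻¹ * if i = j then 1 else 0 := by
  have h1 : g x = u x ^ 4 • (1 : Matrix (Fin 3) (Fin 3) ℝ) := by
    ext i j
    simp [H.g_eq x hx]
  have hu := H.u_pos x hx
  have h2 : gInv g x = (u x ^ 4)⁻¹ • (1 : Matrix (Fin 3) (Fin 3) ℝ) := by
    rw [gInv, h1]
    apply Matrix.inv_eq_left_inv
    rw [Matrix.smul_mul, Matrix.mul_smul, smul_smul, inv_mul_cancel₀ (by positivity), one_smul,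
      Matrix.mul_one]
  simp [h2, Matrix.one_apply]

theorem pd_g (hx : x ∈ U) (i j l : Fin 3) :
    pd l (fun y => g y i j) x = 4 * u x ^ 3 * pd l u x * if i = j then 1 else 0 := by
  have h1 : (fun y => g y i j) =ᶠ[𝓝 x] fun y => u y ^ 4 * if i = j then 1 else 0 := by
    filter_upwards [H.mem_nhds hx] with y hy
    rw [H.g_eq y hy, Matrix.one_apply]
  have hd := H.differentiableAt_u hx
  rw [pd_congr l h1, pd_mul_const l _ (by fun_prop), pd_pow l 4 hd]
  norm_num

theorem christoffel_eq (hx : x ∈ U) (l i j : Fin 3) :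
    christoffel g l i j x = 2 / u x * ((if l = j then pd i u x else 0)
      + (if l = i then pd j u x else 0) - if i = j then pd l u x else 0) := by
  have hu := (H.u_pos x hx).ne'
  simp only [christoffel, H.gInv_eq hx, H.pd_g hx, Fin.sum_univ_three]
  fin_cases l <;> fin_cases i <;> fin_cases j <;> simp <;> field_simp <;> ring

theorem sphereNormal_eq (hx : x ∈ U) (i : Fin 3) :
    sphereNormal g x i = (u x ^ 2)⁻¹ * unitCoord i x := by
  have hu := H.u_pos x hx
  have h0 := H.ne_zero x hx
  have h1 : ∑ j, ∑ l, gInv g x j l * pd j (fun y => ‖y‖) x * pd l (fun y => ‖y‖) x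
      = ((u x ^ 2)⁻¹) ^ 2 := by
    simp only [H.gInv_eq hx, pd_norm _ h0]
    have := sum_sq_unitCoord h0
    simp only [Fin.sum_univ_three] at this ⊢
    simp
    linear_combination (u x ^ 4)⁻¹ * this
  rw [sphereNormal, h1, Real.sqrt_sq (by positivity)]
  simp only [H.gInv_eq hx, pd_norm _ h0]
  simp
  field_simp

theorem sphereNormal_eventuallyEq (hx : x ∈ U) (i : Fin 3) :
    (fun y => sphereNormal g y i) =ᶠ[𝓝 x] fun y => (u y ^ 2)⁻¹ * unitCoord i y := by
  filter_upwards [H.mem_nhds hx] with y hy using H.sphereNormal_eq hy i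

theorem differentiableAt_sphereNormal (hx : x ∈ U) (i : Fin 3) :
    DifferentiableAt ℝ (fun y => sphereNormal g y i) x := by
  refine DifferentiableAt.congr_of_eventuallyEq ?_ (H.sphereNormal_eventuallyEq hx i)
  exact (((H.differentiableAt_u hx).pow 2).inv (pow_ne_zero _ (H.u_pos x hx).ne')).mul
    (differentiableAt_unitCoord i (H.ne_zero x hx))

theorem pd_sphereNormal (hx : x ∈ U) (i j : Fin 3) :
    pd j (fun y => sphereNormal g y i) x = -2 * pd j u x / u x ^ 3 * unitCoord i x
      + (u x ^ 2)⁻¹ * (((if i = j then 1 else 0) - unitCoord i x * unitCoord j x) * rho x) := by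
  have hu := (H.u_pos x hx).ne'
  have h0 := H.ne_zero x hx
  have hd := H.differentiableAt_u hx
  have hd2 : DifferentiableAt ℝ (fun y => u y ^ 2) x := hd.pow 2
  rw [pd_congr j (H.sphereNormal_eventuallyEq hx i),
    pd_mul j (hd2.fun_inv (pow_ne_zero _ hu)) (differentiableAt_unitCoord i h0),
    pd_inv j hd2 (pow_ne_zero _ hu), pd_pow j 2 hd, pd_unitCoord j i h0]
  field_simp
  ring

theorem tangentialTrace_e3 (hx : x ∈ U) :
    tangentialTrace g k (e3 g) x = (u x ^ 2)⁻¹ * etaFun u x := by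
  have hu := (H.u_pos x hx).ne'
  have hX := sum_sq_unitCoord (H.ne_zero x hx)
  have h1 : ∀ i l, (stCov g k (basisVec i) (e3 g) x).1 l
      = pd i (fun y => sphereNormal g y l) x
        + ∑ j, christoffel g l i j x * sphereNormal g x j := by
    intro i l
    simp [stCov, e3, pd]
  simp only [tangentialTrace, stInner, h1, H.pd_sphereNormal hx, H.christoffel_eq hx,
    H.gInv_eq hx, H.sphereNormal_eq hx, H.g_eq x hx, Matrix.one_apply, etaFun]
  simp only [Fin.sum_univ_three] at hX ⊢
  -- With the analytic quantities replaced by free variables, the claim is a polynomial identity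
  -- modulo `|X|² = 1`.
  generalize unitCoord 0 x = a at *
  generalize unitCoord 1 x = b at *
  generalize unitCoord 2 x = c at *
  generalize pd 0 u x = p at *
  generalize pd 1 u x = q at *
  generalize pd 2 u x = r at *
  generalize u x = w at *
  generalize rho x = s at *
  simp
  field_simp
  linear_combination w * s * (a ^ 2 + b ^ 2 + c ^ 2 - 1) * hX

theorem tangentialTrace_e4 (hx : x ∈ U) :
    tangentialTrace g k e4 x = (u x ^ 2)⁻¹ * piFun L x := by
  have hu := (H.u_pos x hx).ne'
  have h1 : ∀ i l, (stCov g k (basisVec i) e4 x).1 l = ∑ m, gInv g x l m * k x i m := by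
    intro i l
    simp [stCov, e4]
  simp only [tangentialTrace, stInner, h1, H.gInv_eq hx, H.sphereNormal_eq hx, H.g_eq x hx,
    Matrix.one_apply, H.k_eq x hx, piFun, Fin.sum_univ_three]
  simp
  field_simp
  ring

end ConformalOn

/-- The algebra behind the formula for `α_H`: `J / |H| = (-s ν, c)` and `H / |H| = (-c ν, s)`, where
`D₁`, `D₂` are the derivatives of `s`, `c`, `G` is the covariant derivative of `ν`, and `K` is `k(v,
·)`. The derivative of a unit vector field is orthogonal to it, so `G` does not contribute. -/
theorem connection_contraction {q D₁ D₂ c s : ℝ} {ν G K : Fin 3 → ℝ} (hq : q ≠ 0)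
    (hunit : q * ∑ l, ν l ^ 2 = 1) (hcompat : ∑ l, ν l * G l = 0) :
    q * ∑ l, (-D₁ * ν l - s * G l + c * (q⁻¹ * K l)) * (-c * ν l) - (D₂ - s * ∑ l, K l * ν l) * s
      = D₁ * c - D₂ * s - (c ^ 2 - s ^ 2) * ∑ l, K l * ν l := by
  simp only [Fin.sum_univ_three] at *
  field_simp
  linear_combination D₁ * c * hunit + s * c * q * hcompat

/-! ### The mean curvature vector and its connection one-form for conformally flat data -/

namespace ConformalOn

variable {g k : Tensor2} {u : E3 → ℝ} {L : Fin 3 → Fin 3 → E3 → ℝ} {U : Set E3}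
  (H : ConformalOn g k u L U) {x : E3}

include H

theorem differentiableAt_etaFun (hx : x ∈ U) : DifferentiableAt ℝ (etaFun u) x := by
  have h0 := H.ne_zero x hx
  have h1 : DifferentiableAt ℝ (fun y => ∑ j, pd j u y * unitCoord j y) x :=
    DifferentiableAt.fun_sum fun j _ =>
      (differentiableAt_pd j (H.contDiffAt_u x hx)).mul (differentiableAt_unitCoord j h0)
  have h2 : DifferentiableAt ℝ (fun y => (u y)⁻¹) x :=
    (H.differentiableAt_u hx).fun_inv (H.u_pos x hx).ne'
  exact ((differentiableAt_rho h0).const_mul 2).add ((h1.const_mul 4).mul h2)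

theorem differentiableAt_piFun (hx : x ∈ U) : DifferentiableAt ℝ (piFun L) x := by
  have h0 := H.ne_zero x hx
  refine DifferentiableAt.sub
    (DifferentiableAt.fun_sum fun j _ => H.differentiableAt_L x hx j j) ?_
  exact DifferentiableAt.fun_sum fun a _ => DifferentiableAt.fun_sum fun b _ =>
    ((H.differentiableAt_L x hx a b).mul (differentiableAt_unitCoord a h0)).mul
      (differentiableAt_unitCoord b h0)

theorem sum_sq_sphereNormal (hx : x ∈ U) : u x ^ 4 * ∑ l, sphereNormal g x l ^ 2 = 1 := by
  have hu := (H.u_pos x hx).ne'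
  have hX := sum_sq_unitCoord (H.ne_zero x hx)
  simp only [H.sphereNormal_eq hx, mul_pow, ← Finset.mul_sum, hX]
  field_simp

/-- This is the derivative of `⟨ν, ν⟩ = 1`, by compatibility of the connection with the metric. -/
theorem sphereNormal_compat (hx : x ∈ U) (v : E3) :
    ∑ l, sphereNormal g x l * (fderiv ℝ (fun y => sphereNormal g y l) x v
      + ∑ i, ∑ j, christoffel g l i j x * v i * sphereNormal g x j) = 0 := by
  have hu := (H.u_pos x hx).ne'
  have hX := sum_sq_unitCoord (H.ne_zero x hx)
  simp only [fderiv_eq_sum_pd, H.pd_sphereNormal hx, H.christoffel_eq hx, H.sphereNormal_eq hx]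
  simp only [Fin.sum_univ_three] at hX ⊢
  generalize unitCoord 0 x = a at *
  generalize unitCoord 1 x = b at *
  generalize unitCoord 2 x = c at *
  generalize pd 0 u x = p at *
  generalize pd 1 u x = q at *
  generalize pd 2 u x = r at *
  generalize u x = w at *
  generalize rho x = s at *
  simp
  field_simp
  linear_combination -(w * s * (a * v 0 + b * v 1 + c * v 2)) * hX

theorem meanCurvatureVec_eq (hx : x ∈ U) : meanCurvatureVec g k x =
    (fun l => -((u x ^ 2)⁻¹ * etaFun u x) * sphereNormal g x l, (u x ^ 2)⁻¹ * piFun L x) := by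
  rw [meanCurvatureVec, H.tangentialTrace_e3 hx, H.tangentialTrace_e4 hx]
  ext <;> simp [e3, e4]

theorem stInner_eq (hx : x ∈ U) (Z W : STVec) :
    stInner g x Z W = u x ^ 4 * ∑ l, Z.1 l * W.1 l - Z.2 * W.2 := by
  simp only [stInner, H.g_eq x hx, Matrix.one_apply, Fin.sum_univ_three]
  simp
  ring

theorem normH_eq (hx : x ∈ U) : normH g k x =
    Real.sqrt (((u x ^ 2)⁻¹ * etaFun u x) ^ 2 - ((u x ^ 2)⁻¹ * piFun L x) ^ 2) := by
  have h1 := H.sum_sq_sphereNormal hx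
  rw [normH, H.stInner_eq hx, H.meanCurvatureVec_eq hx]
  congr 1
  simp only [Fin.sum_univ_three] at h1 ⊢
  linear_combination ((u x ^ 2)⁻¹ * etaFun u x) ^ 2 * h1

theorem reflectedH_eq (hx : x ∈ U) : reflectedH g k x =
    (fun l => -((u x ^ 2)⁻¹ * piFun L x) * sphereNormal g x l, (u x ^ 2)⁻¹ * etaFun u x) := by
  have h1 := H.sum_sq_sphereNormal hx
  rw [reflectedH, H.stInner_eq hx, H.stInner_eq hx, H.meanCurvatureVec_eq hx]
  simp only [Fin.sum_univ_three] at h1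
  ext
  · simp [e3, e4]
  · simp [e3, e4, Fin.sum_univ_three]
    linear_combination (u x ^ 2)⁻¹ * etaFun u x * h1

/-- The quotient is the derivative of the hyperbolic angle `artanh (ϖ / η)`, and the last sum is
`k(v, ν)`. The conformal factor disappears: the angle depends only on the ratio `ϖ / η`, and the
factor `u²` of `k` cancels the `u⁻²` of the unit normal. -/
theorem alphaH_eq (hx : x ∈ U) (hpos : 0 < etaFun u x ^ 2 - piFun L x ^ 2) (v : E3) :
    alphaH g k x v =
      (etaFun u x * fderiv ℝ (piFun L) x v - piFun L x * fderiv ℝ (etaFun u) x v)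
          / (etaFun u x ^ 2 - piFun L x ^ 2)
        - ∑ i, ∑ j, L i j x * v i * unitCoord j x := by
  have hu := H.u_pos x hx
  have hdu := H.differentiableAt_u hx
  set w : E3 → ℝ := fun y => (u y ^ 2)⁻¹ with hw
  have hdw : DifferentiableAt ℝ w x := (hdu.pow 2).fun_inv (pow_ne_zero _ hu.ne')
  have hwx : 0 < w x := by positivity
  have hdη := H.differentiableAt_etaFun hx
  have hdπ := H.differentiableAt_piFun hx
  set n : E3 → ℝ := fun y => (Real.sqrt ((w y * etaFun u y) ^ 2 - (w y * piFun L y) ^ 2))⁻¹ with hn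
  have hT : 0 < (w x * etaFun u x) ^ 2 - (w x * piFun L x) ^ 2 := by
    have : (w x * etaFun u x) ^ 2 - (w x * piFun L x) ^ 2
      = w x ^ 2 * (etaFun u x ^ 2 - piFun L x ^ 2) := by ring
    rw [this]
    positivity
  have hdn : DifferentiableAt ℝ n x :=
    ((((hdw.mul hdη).pow 2).sub ((hdw.mul hdπ).pow 2)).sqrt hT.ne').fun_inv
      (Real.sqrt_ne_zero'.2 hT)
  have hn2 : n x ^ 2 * (w x ^ 2 * (etaFun u x ^ 2 - piFun L x ^ 2)) = 1 := by
    simp only [hn, inv_pow, Real.sq_sqrt hT.le]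
    have h1 : w x ^ 2 * (etaFun u x ^ 2 - piFun L x ^ 2)
        = (w x * etaFun u x) ^ 2 - (w x * piFun L x) ^ 2 := by ring
    rw [h1, inv_mul_cancel₀ hT.ne']
  have hV : ∀ y ∈ U, (normH g k y)⁻¹ • reflectedH g k y =
      (fun l => -(n y * (w y * piFun L y)) * sphereNormal g y l, n y * (w y * etaFun u y)) := by
    intro y hy
    rw [H.normH_eq hy, H.reflectedH_eq hy]
    ext <;> simp [hn, hw, mul_assoc]
  have hV1 : ∀ l, (fun y => ((normH g k y)⁻¹ • reflectedH g k y).1 l) =ᶠ[𝓝 x]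
      fun y => -(n y * (w y * piFun L y)) * sphereNormal g y l := by
    intro l
    filter_upwards [H.mem_nhds hx] with y hy
    rw [hV y hy]
  have hV2 : (fun y => ((normH g k y)⁻¹ • reflectedH g k y).2) =ᶠ[𝓝 x]
      fun y => n y * (w y * etaFun u y) := by
    filter_upwards [H.mem_nhds hx] with y hy
    rw [hV y hy]
  have hf1 : ∀ l, fderiv ℝ (fun y => ((normH g k y)⁻¹ • reflectedH g k y).1 l) x v
      = -(fderiv ℝ (fun y => n y * (w y * piFun L y)) x v) * sphereNormal g x l
        - n x * (w x * piFun L x) * fderiv ℝ (fun y => sphereNormal g y l) x v := by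
    intro l
    rw [(hV1 l).fderiv_eq, fderiv_fun_mul (by fun_prop) (H.differentiableAt_sphereNormal hx l),
      fderiv_fun_neg]
    simp
    ring
  have hf2 : fderiv ℝ (fun y => ((normH g k y)⁻¹ • reflectedH g k y).2) x v
      = fderiv ℝ (fun y => n y * (w y * etaFun u y)) x v := by
    rw [hV2.fderiv_eq]
  -- The common factor `n w` is split off because its derivative enters `hD1` and `hD2` with
  -- coefficients `ϖ` and `η`, and these contributions cancel in the antisymmetric combination of
  -- `connection_contraction`.
  have hD1 : fderiv ℝ (fun y => n y * (w y * piFun L y)) x v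
      = n x * w x * fderiv ℝ (piFun L) x v + piFun L x * fderiv ℝ (fun y => n y * w y) x v := by
    have : (fun y => n y * (w y * piFun L y)) = fun y => (n y * w y) * piFun L y := by
      funext y; ring
    rw [this, fderiv_fun_mul (by fun_prop) hdπ]
    simp
  have hD2 : fderiv ℝ (fun y => n y * (w y * etaFun u y)) x v
      = n x * w x * fderiv ℝ (etaFun u) x v + etaFun u x * fderiv ℝ (fun y => n y * w y) x v := by
    have : (fun y => n y * (w y * etaFun u y)) = fun y => (n y * w y) * etaFun u y := by
      funext y; ring
    rw [this, fderiv_fun_mul (by fun_prop) hdη]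
    simp
  have hunit := H.sum_sq_sphereNormal hx
  have hcompat := H.sphereNormal_compat hx v
  have hL : ∑ i, ∑ j, L i j x * v i * unitCoord j x
      = ∑ i, ∑ j, k x i j * v i * sphereNormal g x j := by
    simp only [H.k_eq x hx, H.sphereNormal_eq hx]
    refine Finset.sum_congr rfl fun i _ => Finset.sum_congr rfl fun j _ => ?_
    field_simp
  have hc1 : ∀ l, (stCov g k v (fun y => (normH g k y)⁻¹ • reflectedH g k y) x).1 l
      = -(fderiv ℝ (fun y => n y * (w y * piFun L y)) x v) * sphereNormal g x l
        - n x * (w x * piFun L x) * (fderiv ℝ (fun y => sphereNormal g y l) x v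
          + ∑ i, ∑ j, christoffel g l i j x * v i * sphereNormal g x j)
        + n x * (w x * etaFun u x) * ((u x ^ 4)⁻¹ * ∑ i, k x i l * v i) := by
    intro l
    simp only [stCov, hf1, hV x hx, H.gInv_eq hx]
    have h1 : ∑ i, ∑ j, christoffel g l i j x * v i
          * (-(n x * (w x * piFun L x)) * sphereNormal g x j)
        = -(n x * (w x * piFun L x))
          * ∑ i, ∑ j, christoffel g l i j x * v i * sphereNormal g x j := by
      simp only [Finset.mul_sum]
      refine Finset.sum_congr rfl fun i _ => Finset.sum_congr rfl fun j _ => ?_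
      ring
    have h2 : ∑ m, ∑ i, ((u x ^ 4)⁻¹ * if l = m then 1 else 0) * k x i m * v i
        = (u x ^ 4)⁻¹ * ∑ i, k x i l * v i := by
      rw [Finset.sum_comm]
      simp [Finset.mul_sum, mul_assoc]
    rw [h1, h2]
    ring
  have hc2 : (stCov g k v (fun y => (normH g k y)⁻¹ • reflectedH g k y) x).2
      = fderiv ℝ (fun y => n y * (w y * etaFun u y)) x v
        - n x * (w x * piFun L x) * ∑ i, ∑ j, k x i j * v i * sphereNormal g x j := by
    simp only [stCov, hf2, hV x hx, Finset.mul_sum, sub_eq_add_neg, ← Finset.sum_neg_distrib]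
    congr 1
    refine Finset.sum_congr rfl fun i _ => Finset.sum_congr rfl fun j _ => ?_
    ring
  have hmean : (normH g k x)⁻¹ • meanCurvatureVec g k x =
      (fun l => -(n x * (w x * etaFun u x)) * sphereNormal g x l, n x * (w x * piFun L x)) := by
    rw [H.normH_eq hx, H.meanCurvatureVec_eq hx]
    ext <;> simp [hn, hw, mul_assoc]
  have hK : ∑ i, ∑ j, k x i j * v i * sphereNormal g x j
      = ∑ l, (∑ i, k x i l * v i) * sphereNormal g x l := by
    rw [Finset.sum_comm]
    simp only [Finset.sum_mul]
  rw [hL, alphaH, H.stInner_eq hx, hmean, hc2, hD2]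
  simp only [hc1, hD1]
  rw [hK]
  have hwu : w x = (u x ^ 2)⁻¹ := rfl
  have hne : etaFun u x ^ 2 - piFun L x ^ 2 ≠ 0 := hpos.ne'
  have hfrac : (etaFun u x * fderiv ℝ (piFun L) x v - piFun L x * fderiv ℝ (etaFun u) x v)
      / (etaFun u x ^ 2 - piFun L x ^ 2) = n x ^ 2 * w x ^ 2 *
      (etaFun u x * fderiv ℝ (piFun L) x v - piFun L x * fderiv ℝ (etaFun u) x v) := by
    rw [div_eq_iff hne]
    linear_combination -(etaFun u x * fderiv ℝ (piFun L) x v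
      - piFun L x * fderiv ℝ (etaFun u) x v) * hn2
  rw [hfrac]
  rw [connection_contraction (pow_ne_zero 4 hu.ne') hunit hcompat]
  linear_combination -(∑ l, (∑ i, k x i l * v i) * sphereNormal g x l) * hn2

end ConformalOn

/-! ### The momentum constraint for conformally flat data -/

/-- The tensor `L - (tr L) δ`. -/
def traceReversed (L : Fin 3 → Fin 3 → E3 → ℝ) (i j : Fin 3) (x : E3) : ℝ :=
  L i j x - if i = j then ∑ l, L l l x else 0

namespace ConformalOn

variable {g k : Tensor2} {u : E3 → ℝ} {L : Fin 3 → Fin 3 → E3 → ℝ} {U : Set E3}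
  (H : ConformalOn g k u L U) {x : E3}

include H

theorem differentiableAt_traceReversed (hx : x ∈ U) (i j : Fin 3) :
    DifferentiableAt ℝ (traceReversed L i j) x := by
  have h1 := H.differentiableAt_L x hx
  refine (h1 i j).sub ?_
  split_ifs
  · exact DifferentiableAt.fun_sum fun l _ => h1 l l
  · exact differentiableAt_const _

theorem trace_eq (hx : x ∈ U) : trace g k x = (u x ^ 2)⁻¹ * ∑ l, L l l x := by
  have hu := (H.u_pos x hx).ne'
  simp only [trace, H.gInv_eq hx, H.k_eq x hx, mul_ite, mul_one, mul_zero, ite_mul, zero_mul,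
    Finset.sum_ite_eq, Finset.mem_univ, if_true, Finset.mul_sum]
  refine Finset.sum_congr rfl fun i _ => ?_
  field_simp

theorem momentum_eq (hx : x ∈ U) (i j : Fin 3) :
    (k x - trace g k x • g x) i j = u x ^ 2 * traceReversed L i j x := by
  have hu := (H.u_pos x hx).ne'
  rw [Matrix.sub_apply, Matrix.smul_apply, smul_eq_mul, H.trace_eq hx, H.g_eq x hx, H.k_eq x hx,
    traceReversed, Matrix.one_apply]
  split_ifs
  · field_simp
  · ring

/-- Half of the coefficient `4` comes from differentiating the weight `u²`, half from the contracted
Christoffel symbol `Γ^m_{jj}`. In the other Christoffel term the symmetry of the tensor cancels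
everything except the trace. -/
theorem divergence_momentum_eq (hx : x ∈ U) (i : Fin 3) :
    divergence g (fun y => k y - trace g k y • g y) i x = (u x ^ 2)⁻¹ *
      (∑ j, pd j (traceReversed L i j) x + 4 / u x * ∑ j, pd j u x * traceReversed L i j x
        - 2 / u x * pd i u x * ∑ j, traceReversed L j j x) := by
  have hu := (H.u_pos x hx).ne'
  have hd := H.differentiableAt_u hx
  have h1 : ∀ i j l, pd l (fun y => (k y - trace g k y • g y) i j) x
      = u x ^ 2 * pd l (traceReversed L i j) x
        + traceReversed L i j x * (2 * u x * pd l u x) := by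
    intro i j l
    have h2 : (fun y => (k y - trace g k y • g y) i j) =ᶠ[𝓝 x]
        fun y => u y ^ 2 * traceReversed L i j y := by
      filter_upwards [H.mem_nhds hx] with y hy using H.momentum_eq hy i j
    rw [pd_congr l h2, pd_mul l (hd.fun_pow 2) (H.differentiableAt_traceReversed hx i j),
      pd_pow l 2 hd]
    norm_num
  have hs : ∀ i j, traceReversed L i j x = traceReversed L j i x := by
    intro i j
    simp only [traceReversed, H.L_symm x hx i j, eq_comm]
  simp only [divergence, covDeriv, h1, H.momentum_eq hx, H.christoffel_eq hx, H.gInv_eq hx]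
  have h01 := hs 1 0
  have h02 := hs 2 0
  have h12 := hs 2 1
  generalize traceReversed L = P at *
  simp only [Fin.sum_univ_three]
  fin_cases i <;> simp [h01, h02, h12] <;> field_simp <;> ring

end ConformalOn

/-! ### Harmonic functions of degree `-2` on punctured space -/

theorem hasDerivAt_intervalIntegral_of_continuous {f f' : ℝ → ℝ → ℝ}
    (hf : Continuous (Function.uncurry f)) (hf' : Continuous (Function.uncurry f'))
    (h : ∀ s t, HasDerivAt (fun s => f s t) (f' s t) s) (a b s : ℝ) :
    HasDerivAt (fun s => ∫ t in a..b, f s t) (∫ t in a..b, f' s t) s := by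
  obtain ⟨C, hC⟩ := ((isCompact_Icc (a := s - 1) (b := s + 1)).prod
    (isCompact_uIcc (a := a) (b := b))).exists_bound_of_continuousOn hf'.continuousOn
  have hc : ∀ s, Continuous (f s) := fun s => hf.comp (Continuous.prodMk_right s)
  have hc' : ∀ s, Continuous (f' s) := fun s => hf'.comp (Continuous.prodMk_right s)
  refine (intervalIntegral.hasDerivAt_integral_of_dominated_loc_of_deriv_le
    (bound := fun _ => C) (Icc_mem_nhds (by linarith : s - 1 < s) (by linarith : s < s + 1))
    (Eventually.of_forall fun s => (hc s).aestronglyMeasurable) ((hc s).intervalIntegrable a b)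
    (hc' s).aestronglyMeasurable ?_ intervalIntegrable_const ?_).2
  · exact Eventually.of_forall fun t ht s' hs' => hC (s', t) ⟨hs', Set.uIoc_subset_uIcc ht⟩
  · exact Eventually.of_forall fun t _ s' _ => h s' t

/-- The solutions of the Legendre equation of degree one which are regular at the poles. -/
theorem eq_mul_cos_of_legendre {m m₁ m₂ : ℝ → ℝ} (h₁ : ∀ s, HasDerivAt m (m₁ s) s)
    (h₂ : ∀ s, HasDerivAt m₁ (m₂ s) s)
    (hode : ∀ s, Real.sin s ^ 2 * m₂ s + Real.sin s * Real.cos s * m₁ s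
      + 2 * Real.sin s ^ 2 * m s = 0) {s : ℝ} (hs : s ∈ Set.Icc 0 Real.pi) :
    m s = m 0 * Real.cos s := by
  have hpi := Real.pi_pos
  have hm1 : Continuous m₁ := continuous_iff_continuousAt.2 fun s => (h₂ s).continuousAt
  have hm : Continuous m := continuous_iff_continuousAt.2 fun s => (h₁ s).continuousAt
  -- This function is `sin` times the Wronskian of `cos` and `m`. By the equation its derivative
  -- vanishes on `(0, π)`, as in Abel's identity, and it is zero at the pole `s = 0`; so the
  -- Wronskian itself vanishes on the open interval.
  have hK : ∀ s, HasDerivAt (fun s => Real.sin s * Real.cos s * m₁ s + Real.sin s ^ 2 * m s)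
      ((Real.cos s * Real.cos s + Real.sin s * -Real.sin s) * m₁ s
        + Real.sin s * Real.cos s * m₂ s
        + ((2 : ℕ) * Real.sin s ^ (2 - 1) * Real.cos s * m s + Real.sin s ^ 2 * m₁ s)) s := by
    intro s
    exact ((((Real.hasDerivAt_sin s).mul (Real.hasDerivAt_cos s)).mul (h₂ s)).add
      (((Real.hasDerivAt_sin s).pow 2).mul (h₁ s)))
  have hfirst : ∀ s ∈ Set.Ioo 0 Real.pi, Real.cos s * m₁ s + Real.sin s * m s = 0 := by
    intro s hs
    obtain ⟨c, hc, hc'⟩ := exists_hasDerivAt_eq_slope _ _ hs.1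
      (fun c _ => (hK c).continuousAt.continuousWithinAt) (fun c _ => hK c)
    have hsc : 0 < Real.sin c := Real.sin_pos_of_pos_of_lt_pi hc.1 (hc.2.trans hs.2)
    have hss : 0 < Real.sin s := Real.sin_pos_of_pos_of_lt_pi hs.1 hs.2
    have h0 : (Real.cos c * Real.cos c + Real.sin c * -Real.sin c) * m₁ c
        + Real.sin c * Real.cos c * m₂ c
        + ((2 : ℕ) * Real.sin c ^ (2 - 1) * Real.cos c * m c + Real.sin c ^ 2 * m₁ c) = 0 := by
      have := hode c
      refine (mul_eq_zero.1 (?_ : Real.sin c * _ = 0)).resolve_left hsc.ne'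
      push_cast
      linear_combination Real.cos c * this
    rw [h0, eq_comm, div_eq_zero_iff] at hc'
    have h3 := hc'.resolve_right (by linarith [hs.1])
    simp only [Real.sin_zero] at h3
    refine (mul_eq_zero.1 (?_ : Real.sin s * _ = 0)).resolve_left hss.ne'
    linear_combination h3
  have hquot : ∀ s, Real.cos s ≠ 0 → HasDerivAt (fun s => m s / Real.cos s)
      ((m₁ s * Real.cos s - m s * -Real.sin s) / Real.cos s ^ 2) s :=
    fun s h => (h₁ s).div (Real.hasDerivAt_cos s) h
  -- A vanishing Wronskian makes `m / cos` constant, but only on an interval without zeros of `cos`;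
  -- the two hemispheres have to be treated separately.
  have hconst : ∀ a b, a < b → 0 ≤ a → b ≤ Real.pi → (∀ s ∈ Set.Icc a b, Real.cos s ≠ 0) →
      m a / Real.cos a = m b / Real.cos b := by
    intro a b hab ha hb hcos
    obtain ⟨c, hc, hc'⟩ := exists_hasDerivAt_eq_slope _ _ hab
      (fun c hc => (hquot c (hcos c hc)).continuousAt.continuousWithinAt)
      (fun c hc => hquot c (hcos c (Set.Ioo_subset_Icc_self hc)))
    have h0 := hfirst c ⟨ha.trans_lt hc.1, hc.2.trans_le hb⟩
    have h1 : m₁ c * Real.cos c - m c * -Real.sin c = 0 := by linear_combination h0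
    rw [h1, zero_div, eq_comm, div_eq_zero_iff] at hc'
    linarith [hc'.resolve_right (by linarith)]
  have hlow : ∀ s, 0 ≤ s → s < Real.pi / 2 → m s = m 0 * Real.cos s := by
    intro s h0 h2
    rcases h0.eq_or_lt with rfl | h0
    · simp
    have hc : ∀ c ∈ Set.Icc 0 s, 0 < Real.cos c := fun c hc =>
      Real.cos_pos_of_mem_Ioo ⟨by linarith [hc.1], by linarith [hc.2]⟩
    have := hconst 0 s h0 le_rfl (by linarith) fun c h => (hc c h).ne'
    rw [Real.cos_zero, div_one, eq_div_iff (hc s ⟨h0.le, le_rfl⟩).ne'] at this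
    exact this.symm
  have hhigh : ∀ s, Real.pi / 2 < s → s ≤ Real.pi → m s = -m Real.pi * Real.cos s := by
    intro s h0 h2
    rcases h2.eq_or_lt with rfl | h2
    · simp
    have hc : ∀ c ∈ Set.Icc s Real.pi, Real.cos c < 0 := fun c hc =>
      Real.cos_neg_of_pi_div_two_lt_of_lt (by linarith [hc.1]) (by linarith [hc.2])
    have := hconst s Real.pi h2 (by linarith) le_rfl fun c h => (hc c h).ne
    rw [Real.cos_pi, div_eq_iff (hc s ⟨le_rfl, h2.le⟩).ne] at this
    rw [this]
    ring
  have hmid : m (Real.pi / 2) = 0 := by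
    have := hfirst (Real.pi / 2) ⟨by linarith, by linarith⟩
    simpa using this
  -- The constants of the two hemispheres are matched at the equator through the derivative `m₁`,
  -- which is continuous there; `m` itself vanishes at the equator and gives no information.
  have hleft : m₁ (Real.pi / 2) + m 0 * Real.sin (Real.pi / 2) = 0 := by
    have hc : Continuous fun s => m₁ s + m 0 * Real.sin s := by fun_prop
    refine tendsto_nhds_unique (hc.continuousAt.tendsto.mono_left
      (nhdsWithin_le_nhds (s := Set.Iio (Real.pi / 2)))) (tendsto_const_nhds.congr' ?_)
    filter_upwards [Ioo_mem_nhdsLT (by linarith : 0 < Real.pi / 2)] with s hs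
    have h3 := hfirst s ⟨hs.1, by linarith [hs.2]⟩
    have hcs := Real.cos_pos_of_mem_Ioo ⟨by linarith [hs.1], hs.2⟩
    rw [hlow s hs.1.le hs.2] at h3
    refine ((mul_eq_zero.1 (?_ : Real.cos s * _ = 0)).resolve_left hcs.ne').symm
    linear_combination h3
  have hright : m₁ (Real.pi / 2) + -m Real.pi * Real.sin (Real.pi / 2) = 0 := by
    have hc : Continuous fun s => m₁ s + -m Real.pi * Real.sin s := by fun_prop
    refine tendsto_nhds_unique (hc.continuousAt.tendsto.mono_left
      (nhdsWithin_le_nhds (s := Set.Ioi (Real.pi / 2)))) (tendsto_const_nhds.congr' ?_)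
    filter_upwards [Ioo_mem_nhdsGT (by linarith : Real.pi / 2 < Real.pi)] with s hs
    have h3 := hfirst s ⟨by linarith [hs.1], hs.2⟩
    have hcs := Real.cos_neg_of_pi_div_two_lt_of_lt hs.1 (by linarith [hs.2])
    rw [hhigh s hs.1 hs.2.le] at h3
    refine ((mul_eq_zero.1 (?_ : Real.cos s * _ = 0)).resolve_left hcs.ne).symm
    linear_combination h3
  have hopp : -m Real.pi = m 0 := by
    simp only [Real.sin_pi_div_two] at hleft hright
    linarith
  rcases lt_trichotomy s (Real.pi / 2) with h | rfl | h
  · exact hlow s hs.1 h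
  · simp [hmid]
  · rw [hhigh s h hs.2, hopp]

/-- `Z` is of class `C²` and homogeneous of degree `-2` on the complement of the origin. -/
structure IsHomogeneousNegTwo (Z : E3 → ℝ) : Prop where
  contDiffAt : ∀ x ≠ 0, ContDiffAt ℝ 2 Z x
  smul : ∀ c : ℝ, 0 < c → ∀ x ≠ 0, Z (c • x) = (c ^ 2)⁻¹ * Z x

namespace IsHomogeneousNegTwo

variable {Z : E3 → ℝ} (hZ : IsHomogeneousNegTwo Z) {x : E3}

include hZ

theorem differentiableAt (hx : x ≠ 0) : DifferentiableAt ℝ Z x :=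
  (hZ.contDiffAt x hx).differentiableAt (by norm_num)

theorem hasFDerivAt_fderiv (hx : x ≠ 0) :
    HasFDerivAt (fderiv ℝ Z) (fderiv ℝ (fderiv ℝ Z) x) x :=
  (((hZ.contDiffAt x hx).fderiv_right (m := 1) (by norm_num)).differentiableAt
    (by norm_num)).hasFDerivAt

theorem euler (hx : x ≠ 0) : fderiv ℝ Z x x = -2 * Z x := by
  have h1 : HasDerivAt (fun c : ℝ => c • x) x 1 := by
    simpa using (hasDerivAt_id (1 : ℝ)).smul_const x
  have h2 : HasDerivAt (fun c : ℝ => Z (c • x)) (fderiv ℝ Z x x) 1 := by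
    have h3 : HasFDerivAt Z (fderiv ℝ Z x) ((1 : ℝ) • x) := by
      rw [one_smul]; exact (hZ.differentiableAt hx).hasFDerivAt
    exact h3.comp_hasDerivAt 1 h1
  have h4 : HasDerivAt (fun c : ℝ => (c ^ 2)⁻¹ * Z x) (-2 * Z x) 1 := by
    have := (((hasDerivAt_id (1 : ℝ)).pow 2).inv (by simp)).mul_const (Z x)
    simpa using this
  refine h2.unique (h4.congr_of_eventuallyEq ?_)
  filter_upwards [lt_mem_nhds (zero_lt_one (α := ℝ))] with c hc using hZ.smul c hc x hx

theorem euler_fderiv (hx : x ≠ 0) (w : E3) :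
    fderiv ℝ (fderiv ℝ Z) x w x = -3 * fderiv ℝ Z x w := by
  have h1 := ((hZ.hasFDerivAt_fderiv hx).clm_apply (hasFDerivAt_id x))
  have h2 : HasFDerivAt (fun y => -2 * Z y) ((-2 : ℝ) • fderiv ℝ Z x) x :=
    (hZ.differentiableAt hx).hasFDerivAt.const_mul (-2)
  have h3 := h2.congr_of_eventuallyEq (f₁ := fun y => fderiv ℝ Z y (id y)) (by
    filter_upwards [isOpen_ne.mem_nhds hx] with y hy using hZ.euler hy)
  have h4 := congrArg (fun T => T w) (h1.unique h3)
  simp at h4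
  linarith

end IsHomogeneousNegTwo

/-! ### Spherical coordinates in an orthonormal frame -/

section Frame

variable (b : OrthonormalBasis (Fin 3) ℝ E3)

theorem norm_sq_frame (p q r : ℝ) :
    ‖p • b 0 + q • b 1 + r • b 2‖ ^ 2 = p ^ 2 + q ^ 2 + r ^ 2 := by
  rw [← b.repr.norm_map, EuclideanSpace.norm_sq_eq]
  simp [Fin.sum_univ_three]

/-- The unit vector with polar angle `φ` and azimuth `t` in an orthonormal frame. -/
def polarVec (φ t : ℝ) : E3 :=
  Real.cos φ • b 0 + (Real.sin φ * Real.cos t) • b 1 + (Real.sin φ * Real.sin t) • b 2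

/-- The polar derivative of `polarVec`. -/
def polarVec' (φ t : ℝ) : E3 :=
  -Real.sin φ • b 0 + (Real.cos φ * Real.cos t) • b 1 + (Real.cos φ * Real.sin t) • b 2

/-- The unit vector in the azimuthal direction. -/
def azimuthVec (t : ℝ) : E3 := -Real.sin t • b 1 + Real.cos t • b 2

/-- The unit vector of the equatorial plane with azimuth `t`. -/
def equatorVec (t : ℝ) : E3 := Real.cos t • b 1 + Real.sin t • b 2

theorem norm_polarVec (φ t : ℝ) : ‖polarVec b φ t‖ = 1 := by
  have h := norm_sq_frame b (Real.cos φ) (Real.sin φ * Real.cos t) (Real.sin φ * Real.sin t)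
  have h2 : ‖polarVec b φ t‖ ^ 2 = 1 := by
    rw [polarVec, h]
    linear_combination Real.sin_sq_add_cos_sq φ + Real.sin φ ^ 2 * Real.sin_sq_add_cos_sq t
  nlinarith [norm_nonneg (polarVec b φ t)]

theorem polarVec_ne_zero (φ t : ℝ) : polarVec b φ t ≠ 0 := by
  rw [← norm_ne_zero_iff, norm_polarVec]
  exact one_ne_zero

theorem hasDerivAt_polarVec (φ t : ℝ) :
    HasDerivAt (fun φ => polarVec b φ t) (polarVec' b φ t) φ := by
  exact (((Real.hasDerivAt_cos φ).smul_const (b 0)).add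
    (((Real.hasDerivAt_sin φ).mul_const (Real.cos t)).smul_const (b 1))).add
    (((Real.hasDerivAt_sin φ).mul_const (Real.sin t)).smul_const (b 2))

theorem hasDerivAt_polarVec' (φ t : ℝ) :
    HasDerivAt (fun φ => polarVec' b φ t) (-polarVec b φ t) φ := by
  have h := ((((Real.hasDerivAt_sin φ).neg).smul_const (b 0)).add
    (((Real.hasDerivAt_cos φ).mul_const (Real.cos t)).smul_const (b 1))).add
    (((Real.hasDerivAt_cos φ).mul_const (Real.sin t)).smul_const (b 2))
  convert! h using 1
  rw [polarVec]
  module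

theorem hasDerivAt_polarVec_azimuth (φ t : ℝ) :
    HasDerivAt (fun t => polarVec b φ t) (Real.sin φ • azimuthVec b t) t := by
  have h := ((hasDerivAt_const t (Real.cos φ • b 0)).add
    (((Real.hasDerivAt_cos t).const_mul (Real.sin φ)).smul_const (b 1))).add
    (((Real.hasDerivAt_sin t).const_mul (Real.sin φ)).smul_const (b 2))
  convert! h using 1
  rw [azimuthVec]
  module

theorem hasDerivAt_azimuthVec (t : ℝ) :
    HasDerivAt (azimuthVec b) (-equatorVec b t) t := by
  have h := (((Real.hasDerivAt_sin t).neg).smul_const (b 1)).add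
    ((Real.hasDerivAt_cos t).smul_const (b 2))
  convert! h using 1
  rw [equatorVec]
  module

theorem continuous_polarVec : Continuous fun p : ℝ × ℝ => polarVec b p.1 p.2 := by
  unfold polarVec
  fun_prop

theorem continuous_polarVec' : Continuous fun p : ℝ × ℝ => polarVec' b p.1 p.2 := by
  unfold polarVec'
  fun_prop

theorem equatorVec_eq (φ t : ℝ) : equatorVec b t
    = Real.sin φ • polarVec b φ t + Real.cos φ • polarVec' b φ t := by
  have h := Real.sin_sq_add_cos_sq φ
  unfold equatorVec polarVec polarVec'
  match_scalars
  · linear_combination -Real.cos t * h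
  · linear_combination -Real.sin t * h
  · ring

/-- The three vectors are orthonormal, so both sides are the trace of `T`. -/
theorem trace_polar_frame (T : E3 →L[ℝ] E3 →L[ℝ] ℝ) (φ t : ℝ) :
    T (polarVec b φ t) (polarVec b φ t) + T (polarVec' b φ t) (polarVec' b φ t)
      + T (azimuthVec b t) (azimuthVec b t) = ∑ i, T (b i) (b i) := by
  have h := Real.sin_sq_add_cos_sq φ
  have h' := Real.sin_sq_add_cos_sq t
  simp only [polarVec, polarVec', azimuthVec, map_add, map_smul, add_apply,
    smul_apply, smul_eq_mul, Fin.sum_univ_three]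
  linear_combination (T (b 0) (b 0) + T (b 1) (b 1) * Real.cos t ^ 2
    + T (b 2) (b 2) * Real.sin t ^ 2
    + (T (b 1) (b 2) + T (b 2) (b 1)) * Real.cos t * Real.sin t) * h
    + (T (b 1) (b 1) + T (b 2) (b 2)) * h'

end Frame

theorem sum_pd_pd_eq_sum_basis {Z : E3 → ℝ} {x : E3} (hZ : ContDiffAt ℝ 2 Z x)
    (b : OrthonormalBasis (Fin 3) ℝ E3) :
    ∑ i, pd i (pd i Z) x = ∑ i, fderiv ℝ (fderiv ℝ Z) x (b i) (b i) := by
  have h := congrFun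
    ((InnerProductSpace.laplacian_eq_iteratedFDeriv_orthonormalBasis Z b).symm.trans (InnerProductSpace.laplacian_eq_iteratedFDeriv_orthonormalBasis Z
      (EuclideanSpace.basisFun (Fin 3) ℝ))) x
  simp only [iteratedFDeriv_two_apply] at h
  simp only [pd_pd_eq_fderiv _ _ hZ]
  simpa [basisVec] using h.symm

theorem continuous_comp_polarVec (b : OrthonormalBasis (Fin 3) ℝ E3) {F : Type*}
    [TopologicalSpace F] {f : E3 → F}
    (hf : ∀ x ≠ 0, ContinuousAt f x) :
    Continuous fun p : ℝ × ℝ => f (polarVec b p.1 p.2) :=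
  continuous_iff_continuousAt.2 fun p =>
    (hf _ (polarVec_ne_zero b p.1 p.2)).comp (f := fun p : ℝ × ℝ => polarVec b p.1 p.2)
      (continuous_polarVec b).continuousAt

namespace IsHomogeneousNegTwo

variable {Z : E3 → ℝ} (hZ : IsHomogeneousNegTwo Z) (b : OrthonormalBasis (Fin 3) ℝ E3)

include hZ

theorem continuousAt (x : E3) (hx : x ≠ 0) : ContinuousAt Z x :=
  (hZ.contDiffAt x hx).continuousAt

theorem continuousAt_fderiv (x : E3) (hx : x ≠ 0) : ContinuousAt (fderiv ℝ Z) x :=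
  (hZ.hasFDerivAt_fderiv hx).continuousAt

theorem continuousAt_fderiv_fderiv (x : E3) (hx : x ≠ 0) :
    ContinuousAt (fderiv ℝ (fderiv ℝ Z)) x :=
  (((hZ.contDiffAt x hx).fderiv_right (m := 1) (by norm_num)).fderiv_right (m := 0)
    (by norm_num)).continuousAt

theorem hasDerivAt_polar (φ t : ℝ) : HasDerivAt (fun φ => Z (polarVec b φ t))
    (fderiv ℝ Z (polarVec b φ t) (polarVec' b φ t)) φ :=
  (hZ.differentiableAt (polarVec_ne_zero b φ t)).hasFDerivAt.comp_hasDerivAt φ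
    (hasDerivAt_polarVec b φ t)

theorem hasDerivAt_polar_polar (φ t : ℝ) :
    HasDerivAt (fun φ => fderiv ℝ Z (polarVec b φ t) (polarVec' b φ t))
      (fderiv ℝ (fderiv ℝ Z) (polarVec b φ t) (polarVec' b φ t) (polarVec' b φ t)
        + 2 * Z (polarVec b φ t)) φ := by
  have hne := polarVec_ne_zero b φ t
  have h1 := (hZ.hasFDerivAt_fderiv hne).comp_hasDerivAt φ (hasDerivAt_polarVec b φ t)
  have h2 := h1.clm_apply (hasDerivAt_polarVec' b φ t)
  convert! h2 using 1
  simp [hZ.euler hne]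

theorem hasDerivAt_azimuth_azimuth (φ t : ℝ) :
    HasDerivAt (fun t => fderiv ℝ Z (polarVec b φ t) (Real.sin φ • azimuthVec b t))
      (fderiv ℝ (fderiv ℝ Z) (polarVec b φ t) (Real.sin φ • azimuthVec b t)
          (Real.sin φ • azimuthVec b t)
        - Real.sin φ * fderiv ℝ Z (polarVec b φ t) (equatorVec b t)) t := by
  have hne := polarVec_ne_zero b φ t
  have h1 := (hZ.hasFDerivAt_fderiv hne).comp_hasDerivAt t (hasDerivAt_polarVec_azimuth b φ t)
  have h2 := h1.clm_apply ((hasDerivAt_azimuthVec b t).const_smul (Real.sin φ))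
  convert! h2 using 1
  simp
  ring

/-- The mean of a harmonic function, homogeneous of degree `-2`, over a circle of latitude. -/
theorem circle_integral_eq (hharm : ∀ x ≠ 0, ∑ i, pd i (pd i Z) x = 0) {φ : ℝ}
    (hφ : φ ∈ Set.Icc 0 Real.pi) :
    ∫ t in 0..2 * Real.pi, Z (polarVec b φ t) = 2 * Real.pi * Z (b 0) * Real.cos φ := by
  have hc0 := continuous_comp_polarVec b hZ.continuousAt
  have hc1 := (continuous_comp_polarVec b hZ.continuousAt_fderiv).clm_apply
    (continuous_polarVec' b)
  have hc2 := ((continuous_comp_polarVec b hZ.continuousAt_fderiv_fderiv).clm_apply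
    (continuous_polarVec' b)).clm_apply (continuous_polarVec' b)
  have hc2' := hc2.fun_add (hc0.const_mul 2)
  have key := eq_mul_cos_of_legendre
    (hasDerivAt_intervalIntegral_of_continuous
      (f := fun φ t => Z (polarVec b φ t))
      (f' := fun φ t => fderiv ℝ Z (polarVec b φ t) (polarVec' b φ t)) hc0 hc1
      (hZ.hasDerivAt_polar b) 0 (2 * Real.pi))
    (hasDerivAt_intervalIntegral_of_continuous
      (f := fun φ t => fderiv ℝ Z (polarVec b φ t) (polarVec' b φ t))
      (f' := fun φ t => fderiv ℝ (fderiv ℝ Z) (polarVec b φ t) (polarVec' b φ t)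
        (polarVec' b φ t) + 2 * Z (polarVec b φ t)) hc1 hc2'
      (hZ.hasDerivAt_polar_polar b) 0 (2 * Real.pi)) ?_ hφ
  -- At `φ = 0` the circle of latitude degenerates to the pole `b 0`, which identifies the initial
  -- value.
  · rw [key]
    simp [polarVec]
  · intro s
    -- Harmonicity, written in the polar frame, trades the second azimuthal derivative for polar
    -- ones; the Euler relations express the radial terms by `Z` itself. The result is minus the
    -- integrand of the Legendre equation.
    have hpt : ∀ t, fderiv ℝ (fderiv ℝ Z) (polarVec b s t) (Real.sin s • azimuthVec b t)
          (Real.sin s • azimuthVec b t)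
        - Real.sin s * fderiv ℝ Z (polarVec b s t) (equatorVec b t)
        = -(Real.sin s ^ 2 * (fderiv ℝ (fderiv ℝ Z) (polarVec b s t) (polarVec' b s t)
              (polarVec' b s t) + 2 * Z (polarVec b s t))
          + Real.sin s * Real.cos s * fderiv ℝ Z (polarVec b s t) (polarVec' b s t)
          + 2 * Real.sin s ^ 2 * Z (polarVec b s t)) := by
      intro t
      have hne := polarVec_ne_zero b s t
      have htr := trace_polar_frame b (fderiv ℝ (fderiv ℝ Z) (polarVec b s t)) s t
      rw [← sum_pd_pd_eq_sum_basis (hZ.contDiffAt _ hne), hharm _ hne, hZ.euler_fderiv hne,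
        hZ.euler hne] at htr
      rw [equatorVec_eq b s t]
      simp only [map_smul, map_add, smul_apply, smul_eq_mul, hZ.euler hne]
      linear_combination Real.sin s ^ 2 * htr
    have hint : ∀ {F : ℝ × ℝ → ℝ}, Continuous F → IntervalIntegrable (fun t => F (s, t))
        MeasureTheory.volume 0 (2 * Real.pi) :=
      fun h => (h.comp (Continuous.prodMk_right s)).intervalIntegrable _ _
    have hi0 := hint (hc0.const_mul (2 * Real.sin s ^ 2))
    have hi1 := hint (hc1.const_mul (Real.sin s * Real.cos s))
    have hi2 := hint (hc2'.const_mul (Real.sin s ^ 2))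
    dsimp only at hi0 hi1 hi2
    -- The azimuthal derivative integrates to zero over the closed circle, which is the Legendre
    -- equation for the mean.
    have hFTC := intervalIntegral.integral_eq_sub_of_hasDerivAt (a := 0) (b := 2 * Real.pi)
      (fun t _ => hZ.hasDerivAt_azimuth_azimuth b s t) (by
        simp only [hpt]
        exact ((hi2.add hi1).add hi0).neg)
    have hper : polarVec b s (2 * Real.pi) = polarVec b s 0 := by simp [polarVec]
    have hper' : azimuthVec b (2 * Real.pi) = azimuthVec b 0 := by simp [azimuthVec]
    rw [hper, hper', sub_self] at hFTC
    simp only [hpt] at hFTC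
    rw [intervalIntegral.integral_neg, intervalIntegral.integral_add (hi2.add hi1) hi0,
      intervalIntegral.integral_add hi2 hi1] at hFTC
    simp only [intervalIntegral.integral_const_mul] at hFTC
    linarith

end IsHomogeneousNegTwo

/-! ### Rotations about an axis -/

section Rotation

variable (b : OrthonormalBasis (Fin 3) ℝ E3)

theorem exists_orthonormalBasis_of_norm_eq_one {θ : E3} (hθ : ‖θ‖ = 1) :
    ∃ b : OrthonormalBasis (Fin 3) ℝ E3, b 0 = θ := by
  have h : Orthonormal ℝ (({0} : Set (Fin 3)).domRestrict fun _ => θ) := by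
    refine ⟨fun _ => hθ, fun i j hij => (hij (Subsingleton.elim i j)).elim⟩
  obtain ⟨b, hb⟩ := h.exists_orthonormalBasis_extension_of_card_eq (by simp)
  exact ⟨b, hb 0 rfl⟩

theorem eq_frame (x : E3) :
    x = (inner ℝ (b 0) x) • b 0 + (inner ℝ (b 1) x) • b 1 + (inner ℝ (b 2) x) • b 2 := by
  conv_lhs => rw [← b.sum_repr' x, Fin.sum_univ_three]

/-- The rotation by the angle `t` about the first vector of an orthonormal frame. -/
def rotation (t : ℝ) (x : E3) : E3 :=
  (inner ℝ (b 0) x) • b 0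
    + (Real.cos t * inner ℝ (b 1) x - Real.sin t * inner ℝ (b 2) x) • b 1
    + (Real.sin t * inner ℝ (b 1) x + Real.cos t * inner ℝ (b 2) x) • b 2

theorem norm_rotation (t : ℝ) (x : E3) : ‖rotation b t x‖ = ‖x‖ := by
  have h : ‖rotation b t x‖ ^ 2 = ‖x‖ ^ 2 := by
    rw [rotation, norm_sq_frame]
    conv_rhs => rw [eq_frame b x, norm_sq_frame]
    linear_combination (inner ℝ (b 1) x ^ 2 + inner ℝ (b 2) x ^ 2) * Real.sin_sq_add_cos_sq t
  exact (sq_eq_sq₀ (norm_nonneg _) (norm_nonneg _)).1 h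

/-- `rotation` as a linear isometry equivalence. -/
def rotationEquiv (t : ℝ) : E3 ≃ₗᵢ[ℝ] E3 :=
  LinearIsometry.toLinearIsometryEquiv
    { toFun := rotation b t
      map_add' := fun x y => by
        simp only [rotation, inner_add_right]
        module
      map_smul' := fun c x => by
        simp only [rotation, inner_smul_right, RingHom.id_apply]
        module
      norm_map' := norm_rotation b t } rfl

@[simp] theorem rotationEquiv_apply (t : ℝ) (x : E3) : rotationEquiv b t x = rotation b t x := rfl

theorem continuous_rotation : Continuous fun p : ℝ × E3 => rotation b p.1 p.2 := by
  unfold rotation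
  fun_prop

theorem inner_frame (i : Fin 3) (p q r : ℝ) :
    inner ℝ (b i) (p • b 0 + q • b 1 + r • b 2) = ![p, q, r] i := by
  simp only [inner_add_right, inner_smul_right, b.inner_eq_ite]
  fin_cases i <;> simp

theorem inner_rotation (t : ℝ) (x : E3) : inner ℝ (b 0) (rotation b t x) = inner ℝ (b 0) x := by
  rw [rotation, inner_frame]
  rfl

theorem rotation_smul_polarVec (c φ s t : ℝ) :
    rotation b t (c • polarVec b φ s) = c • polarVec b φ (s + t) := by
  have h : ∀ i, inner ℝ (b i) (c • polarVec b φ s) = c * ![Real.cos φ,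
      Real.sin φ * Real.cos s, Real.sin φ * Real.sin s] i := by
    intro i
    rw [inner_smul_right, polarVec, inner_frame]
  rw [rotation, h, h, h, polarVec, Real.cos_add, Real.sin_add]
  simp
  module

theorem exists_eq_smul_polarVec {x : E3} (hx : x ≠ 0) :
    ∃ φ ∈ Set.Icc 0 Real.pi, ∃ s, x = ‖x‖ • polarVec b φ s := by
  have hn : 0 < ‖x‖ := norm_pos_iff.2 hx
  have hsq : ‖x‖ ^ 2 = inner ℝ (b 0) x ^ 2 + inner ℝ (b 1) x ^ 2 + inner ℝ (b 2) x ^ 2 := by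
    conv_lhs => rw [eq_frame b x, norm_sq_frame]
  set p := inner ℝ (b 0) x
  set q := inner ℝ (b 1) x
  set r := inner ℝ (b 2) x
  have hp : (p / ‖x‖) ^ 2 ≤ 1 := by
    rw [div_pow, div_le_one (by positivity)]
    nlinarith [sq_nonneg q, sq_nonneg r]
  have hp' := abs_le.1 ((sq_le_one_iff_abs_le_one _).1 hp)
  set z : ℂ := ⟨q / ‖x‖, r / ‖x‖⟩
  have hz : ‖z‖ = Real.sin (Real.arccos (p / ‖x‖)) := by
    rw [Real.sin_arccos, Complex.norm_def, Complex.normSq_mk]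
    congr 1
    field_simp
    linarith
  refine ⟨Real.arccos (p / ‖x‖), ⟨Real.arccos_nonneg _, Real.arccos_le_pi _⟩, z.arg, ?_⟩
  rw [polarVec, Real.cos_arccos hp'.1 hp'.2, ← hz, Complex.norm_mul_cos_arg,
    Complex.norm_mul_sin_arg]
  conv_lhs => rw [eq_frame b x]
  have hc : ∀ a, ‖x‖ * (a / ‖x‖) = a := fun a => by field_simp
  simp only [smul_add, smul_smul, z, hc, p, q, r]

end Rotation

/-! ### Integrals over an annulus -/

/-- A closed annulus. -/
def annulus : Set E3 := Metric.closedBall 0 2 \ Metric.ball 0 1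

theorem isCompact_annulus : IsCompact annulus :=
  (isCompact_closedBall 0 2).diff Metric.isOpen_ball

theorem ne_zero_of_mem_annulus {x : E3} (hx : x ∈ annulus) : x ≠ 0 := by
  rintro rfl
  simp [annulus] at hx

theorem integral_annulus_comp_isometry (R : E3 ≃ₗᵢ[ℝ] E3) (f : E3 → ℝ) :
    ∫ x in annulus, f (R x) = ∫ x in annulus, f x := by
  have h : R ⁻¹' annulus = annulus := by
    ext x
    simp [annulus]
  have := R.measurePreserving.setIntegral_preimage_emb
    R.toHomeomorph.measurableEmbedding f annulus
  rwa [h] at this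

/-- A reflection exchanges any two unit vectors and preserves the annulus. The normalizing constant
is thus the same for every axis, without which the final formula would not be linear in `θ`. -/
theorem integral_annulus_weight_eq {θ η : E3} (hθ : ‖θ‖ = 1) (hη : ‖η‖ = 1) :
    ∫ x in annulus, (‖x‖ ^ 3)⁻¹ * inner ℝ θ x ^ 2
      = ∫ x in annulus, (‖x‖ ^ 3)⁻¹ * inner ℝ η x ^ 2 := by
  set R := (ℝ ∙ (η - θ))ᗮ.reflection
  have hR : R η = θ := Submodule.reflection_sub (by rw [hθ, hη])
  rw [← integral_annulus_comp_isometry R]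
  simp only [← hR, LinearIsometryEquiv.inner_map_map, LinearIsometryEquiv.norm_map]

theorem continuousOn_annulus_weight (θ : E3) :
    ContinuousOn (fun x : E3 => (‖x‖ ^ 3)⁻¹ * inner ℝ θ x ^ 2) annulus := by
  refine ContinuousOn.mul (ContinuousOn.inv₀ (by fun_prop) fun x hx => ?_) (by fun_prop)
  exact pow_ne_zero 3 (norm_ne_zero_iff.2 (ne_zero_of_mem_annulus hx))

theorem integral_annulus_weight_pos {θ : E3} (hθ : ‖θ‖ = 1) :
    0 < ∫ x in annulus, (‖x‖ ^ 3)⁻¹ * inner ℝ θ x ^ 2 := by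
  rw [MeasureTheory.setIntegral_pos_iff_support_of_nonneg_ae
    (Eventually.of_forall fun x => by positivity)
    ((continuousOn_annulus_weight θ).integrableOn_compact isCompact_annulus)]
  -- The ball of radius `1 / 4` about `(3 / 2) θ` lies in the annulus, and `⟨θ, x⟩` is positive on
  -- it.
  refine (Metric.measure_ball_pos MeasureTheory.volume ((3 / 2 : ℝ) • θ)
    (by norm_num : (0 : ℝ) < 1 / 4)).trans_le (MeasureTheory.measure_mono fun x hx => ?_)
  rw [Metric.mem_ball, dist_eq_norm] at hx
  have hn : ‖(3 / 2 : ℝ) • θ‖ = 3 / 2 := by rw [norm_smul, hθ]; norm_num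
  have h1 : ‖x‖ ≤ 2 := by
    have := norm_sub_norm_le x ((3 / 2 : ℝ) • θ)
    linarith
  have h2 : 1 ≤ ‖x‖ := by
    have := norm_sub_norm_le ((3 / 2 : ℝ) • θ) x
    rw [norm_sub_rev] at this
    linarith
  have h3 : 0 < inner ℝ θ x := by
    have h4 : inner ℝ θ x = 3 / 2 + inner ℝ θ (x - (3 / 2 : ℝ) • θ) := by
      rw [inner_sub_right, inner_smul_right, real_inner_self_eq_norm_sq, hθ]
      ring
    have h5 := abs_le.1 (abs_real_inner_le_norm θ (x - (3 / 2 : ℝ) • θ))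
    rw [hθ] at h5
    linarith [h5.1]
  refine ⟨?_, ?_⟩
  · rw [Function.mem_support]
    positivity
  · simp [annulus, h1, h2]

namespace IsHomogeneousNegTwo

variable {Z : E3 → ℝ} (hZ : IsHomogeneousNegTwo Z)

include hZ

/-- The orbit of `x` under rotations about `b 0` is a circle of latitude at radius `‖x‖`.
Homogeneity contributes `‖x‖⁻²`, and the third inverse power comes from `cos φ = ⟨b 0, x⟩ / ‖x‖`. -/
theorem integral_rotation (hharm : ∀ x ≠ 0, ∑ i, pd i (pd i Z) x = 0)
    (b : OrthonormalBasis (Fin 3) ℝ E3) {x : E3} (hx : x ≠ 0) :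
    ∫ t in 0..2 * Real.pi, Z (rotation b t x)
      = 2 * Real.pi * Z (b 0) * ((‖x‖ ^ 3)⁻¹ * inner ℝ (b 0) x) := by
  obtain ⟨φ, hφ, s, hs⟩ := exists_eq_smul_polarVec b hx
  have hn : 0 < ‖x‖ := norm_pos_iff.2 hx
  have hin : inner ℝ (b 0) x = ‖x‖ * Real.cos φ := by
    rw [hs, inner_smul_right, polarVec, inner_frame, norm_smul, ← polarVec, norm_polarVec]
    simp
  have h1 : ∀ t, Z (rotation b t x) = (‖x‖ ^ 2)⁻¹ * Z (polarVec b φ (s + t)) := by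
    intro t
    conv_lhs => rw [hs, rotation_smul_polarVec, hZ.smul _ hn _ (polarVec_ne_zero b _ _)]
  have hper : Function.Periodic (fun t => Z (polarVec b φ t)) (2 * Real.pi) := by
    intro t
    simp [polarVec]
  have h2 := hper.intervalIntegral_add_eq s 0
  simp only [h1, intervalIntegral.integral_const_mul]
  rw [intervalIntegral.integral_comp_add_left (fun t => Z (polarVec b φ t)) s, add_zero, h2,
    zero_add, hZ.circle_integral_eq b hharm hφ, hin]
  field_simp

/-- A harmonic function on punctured space which is homogeneous of degree `-2` restricts to a
linear function on the unit sphere. -/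
theorem exists_linear_of_harmonic (hharm : ∀ x ≠ 0, ∑ i, pd i (pd i Z) x = 0) :
    ∃ c : Fin 3 → ℝ, ∀ θ : E3, ‖θ‖ = 1 → Z θ = ∑ i, c i * θ i := by
  have h0 : ‖basisVec 0‖ = 1 := by simp [basisVec]
  set w := ∫ x in annulus, (‖x‖ ^ 3)⁻¹ * inner ℝ (basisVec 0) x ^ 2 with hw
  have hwpos : 0 < w := integral_annulus_weight_pos h0
  have hcont : ContinuousOn Z annulus := fun x hx =>
    (hZ.continuousAt x (ne_zero_of_mem_annulus hx)).continuousWithinAt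
  -- The coefficients are normalized first moments of `Z` over the annulus; what remains is the
  -- reproducing property `∫ Z(x) ⟨θ, x⟩ = w Z(θ)`.
  refine ⟨fun i => w⁻¹ * ∫ x in annulus, Z x * x i, fun θ hθ => ?_⟩
  obtain ⟨b, rfl⟩ := exists_orthonormalBasis_of_norm_eq_one hθ
  have hmoment : ∑ i, (∫ x in annulus, Z x * x i) * b 0 i
      = ∫ x in annulus, Z x * inner ℝ (b 0) x := by
    simp only [← MeasureTheory.integral_mul_const]
    rw [← MeasureTheory.integral_finsetSum]
    · congr 1
      ext x
      simp only [PiLp.inner_apply, Finset.mul_sum]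
      refine Finset.sum_congr rfl fun i _ => ?_
      simp
      ring
    · intro i _
      exact (((hcont.mul (by fun_prop)).mul continuousOn_const).integrableOn_compact
        isCompact_annulus)
  have hrot : ∀ t, ∫ x in annulus, Z (rotation b t x) * inner ℝ (b 0) x
      = ∫ x in annulus, Z x * inner ℝ (b 0) x := by
    intro t
    have h := integral_annulus_comp_isometry (rotationEquiv b t)
      fun x => Z x * inner ℝ (b 0) x
    simpa only [rotationEquiv_apply, inner_rotation] using h
  have hint : MeasureTheory.Integrable
      (Function.uncurry fun (t : ℝ) (x : E3) => Z (rotation b t x) * inner ℝ (b 0) x)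
      ((MeasureTheory.volume.restrict (Set.uIoc 0 (2 * Real.pi))).prod
        (MeasureTheory.volume.restrict annulus)) := by
    rw [MeasureTheory.Measure.prod_restrict, ← MeasureTheory.Measure.volume_eq_prod]
    have hc : ContinuousOn
        (Function.uncurry fun (t : ℝ) (x : E3) => Z (rotation b t x) * inner ℝ (b 0) x)
        (Set.uIcc 0 (2 * Real.pi) ×ˢ annulus) := by
      rintro ⟨t, x⟩ ⟨-, hx⟩
      have hne : rotation b t x ≠ 0 := by
        rw [← norm_ne_zero_iff, norm_rotation, norm_ne_zero_iff]
        exact ne_zero_of_mem_annulus hx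
      refine ContinuousAt.continuousWithinAt (ContinuousAt.mul ?_ (by fun_prop))
      exact ContinuousAt.comp (f := fun p : ℝ × E3 => rotation b p.1 p.2) (x := (t, x))
        (hZ.continuousAt _ hne) (continuous_rotation b).continuousAt
    exact MeasureTheory.IntegrableOn.mono_set
      (hc.integrableOn_compact (isCompact_uIcc.prod isCompact_annulus))
      (Set.prod_mono Set.uIoc_subset_uIcc le_rfl)
  -- By `hrot` the integral over the annulus is the same for every rotation angle. Averaging over
  -- the angle and exchanging the integrals replaces `Z` by its mean over circles of latitude.
  have hswap := MeasureTheory.intervalIntegral_integral_swap hint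
  simp only [hrot, intervalIntegral.integral_const, intervalIntegral.integral_mul_const] at hswap
  have hinner : ∫ x in annulus, (∫ t in 0..2 * Real.pi, Z (rotation b t x)) * inner ℝ (b 0) x
      = 2 * Real.pi * Z (b 0) * w := by
    rw [hw, ← integral_annulus_weight_eq hθ h0, ← MeasureTheory.integral_const_mul]
    refine MeasureTheory.setIntegral_congr_fun isCompact_annulus.measurableSet fun x hx => ?_
    simp only [hZ.integral_rotation hharm b (ne_zero_of_mem_annulus hx)]
    ring
  rw [hinner] at hswap
  simp only [mul_assoc, ← Finset.mul_sum]
  rw [hmoment]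
  have hpi := Real.pi_pos
  simp only [sub_zero, smul_eq_mul] at hswap
  have h2 : ∫ x in annulus, Z x * inner ℝ (b 0) x = Z (b 0) * w := by
    have h3 : (2 * Real.pi) ≠ 0 := by positivity
    apply mul_left_cancel₀ h3
    linarith
  rw [h2]
  field_simp

end IsHomogeneousNegTwo

/-! ### Asymptotic calculus -/

/-- Boundedness near infinity. -/
@[fun_prop]
def BddAtInfinity (f : E3 → ℝ) : Prop := f =O[cobounded E3] fun _ => (1 : ℝ)

/-- Convergence to zero at infinity. -/
def VanishesAtInfinity (f : E3 → ℝ) : Prop := Tendsto f (cobounded E3) (𝓝 0)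

section Calculus

variable {f h : E3 → ℝ}

@[fun_prop]
theorem BddAtInfinity.const (c : ℝ) : BddAtInfinity fun _ => c := isBigO_const_const c one_ne_zero _

@[fun_prop]
theorem BddAtInfinity.add (hf : BddAtInfinity f) (hh : BddAtInfinity h) :
    BddAtInfinity fun x => f x + h x := IsBigO.add hf hh

@[fun_prop]
theorem BddAtInfinity.sub (hf : BddAtInfinity f) (hh : BddAtInfinity h) :
    BddAtInfinity fun x => f x - h x := IsBigO.sub hf hh

@[fun_prop]
theorem BddAtInfinity.neg (hf : BddAtInfinity f) : BddAtInfinity fun x => -f x :=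
  IsBigO.neg_left hf

@[fun_prop]
theorem BddAtInfinity.mul (hf : BddAtInfinity f) (hh : BddAtInfinity h) :
    BddAtInfinity fun x => f x * h x := by
  simpa [BddAtInfinity] using IsBigO.mul hf hh

@[fun_prop]
theorem BddAtInfinity.pow (hf : BddAtInfinity f) (n : ℕ) : BddAtInfinity fun x => f x ^ n := by
  simpa [BddAtInfinity] using IsBigO.pow hf n

@[fun_prop]
theorem BddAtInfinity.sum {ι : Type*} {s : Finset ι} {F : ι → E3 → ℝ}
    (hF : ∀ a, BddAtInfinity (F a)) : BddAtInfinity fun x => ∑ a ∈ s, F a x :=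
  IsBigO.fun_sum fun a _ => hF a

theorem BddAtInfinity.congr' (hf : BddAtInfinity f) (hfh : f =ᶠ[cobounded E3] h) :
    BddAtInfinity h := IsBigO.congr' hf hfh EventuallyEq.rfl

theorem VanishesAtInfinity.bdd (hf : VanishesAtInfinity f) : BddAtInfinity f :=
  hf.isBigO_one ℝ

theorem VanishesAtInfinity.add (hf : VanishesAtInfinity f) (hh : VanishesAtInfinity h) :
    VanishesAtInfinity fun x => f x + h x := by
  simpa [VanishesAtInfinity] using Tendsto.add hf hh

theorem VanishesAtInfinity.mul_bdd (hf : VanishesAtInfinity f) (hh : BddAtInfinity h) :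
    VanishesAtInfinity fun x => f x * h x := by
  have h1 : f =o[cobounded E3] fun _ => (1 : ℝ) := (isLittleO_one_iff ℝ).2 hf
  have h2 := h1.mul_isBigO hh
  simp only [mul_one] at h2
  exact (isLittleO_one_iff ℝ).1 h2

theorem VanishesAtInfinity.sum {ι : Type*} {s : Finset ι} {F : ι → E3 → ℝ}
    (hF : ∀ a, VanishesAtInfinity (F a)) : VanishesAtInfinity fun x => ∑ a ∈ s, F a x := by
  have := tendsto_finsetSum s fun a _ => hF a
  simpa [VanishesAtInfinity] using this

theorem VanishesAtInfinity.congr' (hf : VanishesAtInfinity f) (hfh : f =ᶠ[cobounded E3] h) :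
    VanishesAtInfinity h := Tendsto.congr' hfh hf

theorem eventually_norm_gt (R : ℝ) : ∀ᶠ x in cobounded E3, R < ‖x‖ :=
  tendsto_norm_cobounded_atTop.eventually_gt_atTop R

theorem eventually_ne_zero : ∀ᶠ x in cobounded E3, x ≠ 0 := by
  filter_upwards [eventually_norm_gt 0] with x hx using norm_pos_iff.1 hx

theorem vanishesAtInfinity_rho : VanishesAtInfinity rho :=
  tendsto_inv_atTop_zero.comp tendsto_norm_cobounded_atTop

@[fun_prop]
theorem bddAtInfinity_rho : BddAtInfinity rho := vanishesAtInfinity_rho.bdd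

@[fun_prop]
theorem bddAtInfinity_unitCoord (i : Fin 3) : BddAtInfinity (unitCoord i) := by
  refine IsBigO.of_bound 1 ?_
  filter_upwards [eventually_ne_zero] with x hx
  have h := sum_sq_unitCoord hx
  have h1 : unitCoord i x ^ 2 ≤ 1 := by
    rw [← h]
    exact Finset.single_le_sum (f := fun i => unitCoord i x ^ 2)
      (fun _ _ => sq_nonneg _) (Finset.mem_univ i)
  simpa using (sq_le_one_iff_abs_le_one _).1 h1

/-- Landau symbols are traded for explicit factors, so that expansions become exact identities which
algebra can verify. -/
theorem exists_factor_of_isBigO {n : ℕ} (hf : f =O[cobounded E3] fun x => rho x ^ n) :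
    ∃ q : E3 → ℝ, BddAtInfinity q ∧ ∀ x ≠ 0, f x = rho x ^ n * q x := by
  refine ⟨fun x => f x / rho x ^ n, ?_, fun x hx => ?_⟩
  · have h := IsBigO.mul hf (isBigO_refl (fun x => (rho x ^ n)⁻¹) _)
    refine h.congr' (Eventually.of_forall fun x => (div_eq_mul_inv _ _).symm) ?_
    filter_upwards [eventually_ne_zero] with x hx
    exact mul_inv_cancel₀ (pow_ne_zero n (rho_pos hx).ne')
  · have := (rho_pos hx).ne'
    field_simp

theorem exists_factor_of_isLittleO {n : ℕ} (hf : f =o[cobounded E3] fun x => rho x ^ n) :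
    ∃ q : E3 → ℝ, VanishesAtInfinity q ∧ ∀ x ≠ 0, f x = rho x ^ n * q x := by
  refine ⟨fun x => f x / rho x ^ n, ?_, fun x hx => ?_⟩
  · exact hf.tendsto_div_nhds_zero
  · have := (rho_pos hx).ne'
    field_simp

end Calculus

/-! ### Homogeneous extension of functions on the sphere -/

/-- The extension of a function on the sphere which is homogeneous of degree `-2`. -/
def extension (f : S2 → ℝ) (x : E3) : ℝ := f (direction x) / ‖x‖ ^ 2

theorem coe_direction {x : E3} (hx : x ≠ 0) : (direction x : E3) = ‖x‖⁻¹ • x := by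
  simp [direction, hx]

theorem direction_smul {c : ℝ} (hc : 0 < c) {x : E3} (hx : x ≠ 0) :
    direction (c • x) = direction x := by
  apply Subtype.ext
  have hn : ‖x‖ ≠ 0 := norm_ne_zero_iff.2 hx
  rw [coe_direction hx, coe_direction (smul_ne_zero hc.ne' hx), norm_smul, smul_smul,
    Real.norm_of_nonneg hc.le]
  congr 1
  field_simp

theorem direction_coe (θ : S2) : direction (θ : E3) = θ := by
  apply Subtype.ext
  have h : ‖(θ : E3)‖ = 1 := by simp
  rw [coe_direction (norm_ne_zero_iff.1 (by rw [h]; exact one_ne_zero)), h]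
  simp

/-- Regularity of `f` is given in the manifold sense. Radial projection is smooth from punctured
space, as an open submanifold, to the sphere, and composing with it yields ordinary
differentiability. -/
theorem contDiffAt_comp_direction {f : S2 → ℝ} (hf : ContMDiff (𝓡 2) 𝓘(ℝ, ℝ) 2 f) {x : E3}
    (hx : x ≠ 0) : ContDiffAt ℝ 2 (fun y => f (direction y)) x := by
  let V : TopologicalSpace.Opens E3 := ⟨{y | y ≠ 0}, isOpen_ne⟩
  have h1 : ContMDiff 𝓘(ℝ, E3) 𝓘(ℝ, E3) 2 (fun y : V => ‖(y : E3)‖⁻¹ • (y : E3)) := by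
    intro y
    refine (contMDiffAt_subtype_iff (f := fun y : E3 => ‖y‖⁻¹ • y)).2 ?_
    exact ((contDiffAt_rho y.2).smul contDiffAt_id).contMDiffAt
  have h2 : ∀ y : V, ‖(y : E3)‖⁻¹ • (y : E3) ∈ Metric.sphere (0 : E3) 1 := by
    intro y
    have : ‖(y : E3)‖ ≠ 0 := norm_ne_zero_iff.2 y.2
    simp [norm_smul, this]
  have h3 : ContMDiff 𝓘(ℝ, E3) 𝓘(ℝ, ℝ) 2 (fun y : V => f (direction (y : E3))) := by
    have h4 := hf.comp (h1.codRestrict_sphere (n := 2) h2)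
    convert! h4 using 1
    ext y
    simp only [Function.comp]
    congr 1
    apply Subtype.ext
    rw [coe_direction y.2]
    rfl
  exact ((contMDiffAt_subtype_iff (U := V) (x := ⟨x, hx⟩)
    (f := fun y : E3 => f (direction y))).1 (h3 _)).contDiffAt

theorem isHomogeneousNegTwo_extension {f : S2 → ℝ} (hf : ContMDiff (𝓡 2) 𝓘(ℝ, ℝ) 2 f) :
    IsHomogeneousNegTwo (extension f) where
  contDiffAt x hx := (contDiffAt_comp_direction hf hx).div
    ((contDiffAt_norm ℝ hx).pow 2) (pow_ne_zero 2 (norm_ne_zero_iff.2 hx))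
  smul c hc x hx := by
    rw [extension, extension, direction_smul hc hx, norm_smul, Real.norm_of_nonneg hc.le]
    field_simp

theorem pd_smul_of_homogeneous {f : E3 → ℝ} {a c : ℝ} (hc : 0 < c)
    (h : ∀ x ≠ 0, f (c • x) = a * f x) (hd : ∀ x ≠ 0, DifferentiableAt ℝ f x) (i : Fin 3)
    {x : E3} (hx : x ≠ 0) : pd i f (c • x) = c⁻¹ * a * pd i f x := by
  have h1 : pd i (fun y => f (c • y)) x = a * pd i f x := by
    rw [pd_congr i (h := fun y => a * f y) (by
      filter_upwards [isOpen_ne.mem_nhds hx] with y hy using h y hy), pd_const_mul i a (hd x hx)]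
  have h2 : pd i (fun y => f (c • y)) x = c * pd i f (c • x) := by
    have h3 := (hd _ (smul_ne_zero hc.ne' hx)).hasFDerivAt.comp x
      ((hasFDerivAt_id x).const_smul c)
    have h4 : fderiv ℝ (fun y => f (c • y)) x
      = (fderiv ℝ f (c • x)).comp (c • ContinuousLinearMap.id ℝ E3) := h3.fderiv
    simp [pd, h4]
  rw [mul_assoc, ← h1, h2, inv_mul_cancel_left₀ hc.ne']

/-- A continuous function is bounded on the compact unit sphere, and scaling carries the bound
outwards. -/
theorem isBigO_of_homogeneous {f : E3 → ℝ} {n : ℕ} (hf : ∀ x ≠ 0, ContinuousAt f x)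
    (h : ∀ c : ℝ, 0 < c → ∀ x ≠ 0, f (c • x) = (c ^ n)⁻¹ * f x) :
    f =O[cobounded E3] fun x => rho x ^ n := by
  have hne : ∀ x ∈ Metric.sphere (0 : E3) 1, x ≠ 0 := by
    rintro x hx rfl
    simp at hx
  obtain ⟨C, hC⟩ := (isCompact_sphere (0 : E3) 1).exists_bound_of_continuousOn
    (f := f) fun x hx => (hf x (hne x hx)).continuousWithinAt
  refine IsBigO.of_bound C ?_
  filter_upwards [eventually_ne_zero] with x hx
  have hn : 0 < ‖x‖ := norm_pos_iff.2 hx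
  have h1 : x = ‖x‖ • (‖x‖⁻¹ • x) := by rw [smul_smul, mul_inv_cancel₀ hn.ne', one_smul]
  have h2 : ‖x‖⁻¹ • x ∈ Metric.sphere (0 : E3) 1 := by simp [norm_smul, hn.ne']
  have h3 := h ‖x‖ hn _ (hne _ h2)
  rw [← h1] at h3
  rw [h3, norm_mul, rho, inv_pow, mul_comm]
  gcongr
  exact hC _ h2

namespace IsHomogeneousNegTwo

variable {Z : E3 → ℝ} (hZ : IsHomogeneousNegTwo Z) (i j : Fin 3)

include hZ

theorem pd_smul {c : ℝ} (hc : 0 < c) {x : E3} (hx : x ≠ 0) :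
    pd i Z (c • x) = (c ^ 3)⁻¹ * pd i Z x := by
  rw [pd_smul_of_homogeneous hc (fun x hx => hZ.smul c hc x hx)
    (fun x hx => hZ.differentiableAt hx) i hx]
  field_simp

theorem pd_pd_smul {c : ℝ} (hc : 0 < c) {x : E3} (hx : x ≠ 0) :
    pd j (pd i Z) (c • x) = (c ^ 4)⁻¹ * pd j (pd i Z) x := by
  rw [pd_smul_of_homogeneous hc (fun x hx => hZ.pd_smul i hc hx)
    (fun x hx => differentiableAt_pd i (hZ.contDiffAt x hx)) j hx]
  field_simp

theorem isBigO_pd : pd i Z =O[cobounded E3] fun x => rho x ^ 3 :=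
  isBigO_of_homogeneous (fun x hx => (contDiffAt_pd i (hZ.contDiffAt x hx)).continuousAt)
    fun _ hc _ hx => hZ.pd_smul i hc hx

theorem isBigO_pd_pd : pd j (pd i Z) =O[cobounded E3] fun x => rho x ^ 4 := by
  refine isBigO_of_homogeneous (fun x hx => ?_) fun _ hc _ hx => hZ.pd_pd_smul i j hc hx
  have h1 : ContDiffAt ℝ 0 (fderiv ℝ (pd i Z)) x :=
    (contDiffAt_pd i (hZ.contDiffAt x hx)).fderiv_right (by norm_num)
  exact (h1.clm_apply contDiffAt_const).continuousAt

theorem isBigO_self : Z =O[cobounded E3] fun x => rho x ^ 2 :=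
  isBigO_of_homogeneous hZ.continuousAt hZ.smul

theorem sum_unitCoord_mul_pd {x : E3} (hx : x ≠ 0) :
    ∑ i, unitCoord i x * pd i Z x = -2 * Z x * rho x := by
  have h := hZ.euler hx
  rw [fderiv_eq_sum_pd] at h
  have h2 : ∀ i, unitCoord i x * pd i Z x = x i * pd i Z x * rho x := by
    intro i
    rw [unitCoord, rho]
    ring
  simp only [h2, ← Finset.sum_mul, h]

end IsHomogeneousNegTwo

/-! ### Term by term differentiation of expansions -/

/-- The sum `c₀ + c₁ / r + f₂ / r²` of the first terms of an expansion. -/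
def expansionModel (c₀ c₁ : ℝ) (f₂ : S2 → ℝ) (x : E3) : ℝ := c₀ + c₁ * rho x + extension f₂ x

section Model

variable {c₀ c₁ : ℝ} {f₂ : S2 → ℝ} {x : E3} (i j : Fin 3)

theorem contDiffAt_expansionModel (hf₂ : ContMDiff (𝓡 2) 𝓘(ℝ, ℝ) 2 f₂) (hx : x ≠ 0) :
    ContDiffAt ℝ 2 (expansionModel c₀ c₁ f₂) x :=
  (contDiffAt_const.add (contDiffAt_const.mul (contDiffAt_rho hx))).add
    ((isHomogeneousNegTwo_extension hf₂).contDiffAt x hx)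

theorem extension_eq (x : E3) : extension f₂ x = rho x ^ 2 * f₂ (direction x) := by
  simp only [extension, rho]
  ring

theorem pd_expansionModel (hf₂ : ContMDiff (𝓡 2) 𝓘(ℝ, ℝ) 2 f₂) (hx : x ≠ 0) :
    pd i (expansionModel c₀ c₁ f₂) x
      = -c₁ * unitCoord i x * rho x ^ 2 + pd i (extension f₂) x := by
  have hd := differentiableAt_rho hx
  unfold expansionModel
  rw [pd_add i (by fun_prop) ((isHomogeneousNegTwo_extension hf₂).differentiableAt hx),
    pd_add i (by fun_prop) (by fun_prop), pd_const, pd_const_mul i c₁ hd, pd_rho i hx]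
  ring

theorem pd_pd_expansionModel (hf₂ : ContMDiff (𝓡 2) 𝓘(ℝ, ℝ) 2 f₂) (hx : x ≠ 0) :
    pd j (pd i (expansionModel c₀ c₁ f₂)) x
      = c₁ * (3 * unitCoord i x * unitCoord j x - if i = j then 1 else 0) * rho x ^ 3
        + pd j (pd i (extension f₂)) x := by
  have hd := differentiableAt_rho hx
  have hd' := differentiableAt_unitCoord i hx
  have h1 : pd i (expansionModel c₀ c₁ f₂) =ᶠ[𝓝 x]
      fun y => -c₁ * unitCoord i y * rho y ^ 2 + pd i (extension f₂) y := by
    filter_upwards [isOpen_ne.mem_nhds hx] with y hy using pd_expansionModel i hf₂ hy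
  rw [pd_congr j h1, pd_add j (by fun_prop)
      (differentiableAt_pd i ((isHomogeneousNegTwo_extension hf₂).contDiffAt x hx)),
    pd_mul j (by fun_prop) (by fun_prop), pd_const_mul j _ hd', pd_pow j 2 hd, pd_rho j hx,
    pd_unitCoord j i hx]
  norm_num
  ring

end Model

theorem isOpen_norm_gt (R : ℝ) : IsOpen {x : E3 | R < ‖x‖} :=
  isOpen_lt continuous_const continuous_norm

theorem expansionRemainder_eq (f : E3 → ℝ) (c₀ c₁ : ℝ) (f₂ : S2 → ℝ) :
    expansionRemainder f c₀ c₁ f₂ = fun x => f x - expansionModel c₀ c₁ f₂ x := by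
  funext x
  simp only [expansionRemainder, expansionModel, extension, rho, div_eq_mul_inv]

/-- A function of class `C²` outside of a ball with an expansion at infinity. -/
structure IsExpandable (R : ℝ) (f : E3 → ℝ) (c₀ c₁ : ℝ) (f₂ : S2 → ℝ) : Prop where
  radius_pos : 0 < R
  contDiffOn : ContDiffOn ℝ 2 f {x | R < ‖x‖}
  hasExpansion : HasExpansion f c₀ c₁ f₂

namespace IsExpandable

variable {R : ℝ} {f : E3 → ℝ} {c₀ c₁ : ℝ} {f₂ : S2 → ℝ} (hf : IsExpandable R f c₀ c₁ f₂)

include hf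

theorem ne_zero {x : E3} (hx : R < ‖x‖) : x ≠ 0 :=
  norm_pos_iff.1 (hf.radius_pos.trans hx)

theorem contDiffAt {x : E3} (hx : R < ‖x‖) : ContDiffAt ℝ 2 f x :=
  hf.contDiffOn.contDiffAt ((isOpen_norm_gt R).mem_nhds hx)

theorem homogeneous : IsHomogeneousNegTwo (extension f₂) :=
  isHomogeneousNegTwo_extension hf.hasExpansion.contMDiff

theorem exists_eq : ∃ o : E3 → ℝ, VanishesAtInfinity o ∧
    ∀ x ≠ 0, f x = expansionModel c₀ c₁ f₂ x + rho x ^ 2 * o x := by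
  have h := hf.hasExpansion.remainder
  rw [expansionRemainder_eq] at h
  obtain ⟨o, ho, h⟩ := exists_factor_of_isLittleO (n := 2) (by simpa [rho] using h)
  exact ⟨o, ho, fun x hx => by linarith [h x hx]⟩

theorem pd_remainder (i : Fin 3) {x : E3} (hx : R < ‖x‖) :
    pd i (expansionRemainder f c₀ c₁ f₂) x = pd i f x - pd i (expansionModel c₀ c₁ f₂) x := by
  rw [expansionRemainder_eq, pd_sub i ((hf.contDiffAt hx).differentiableAt (by norm_num))
    ((contDiffAt_expansionModel hf.hasExpansion.contMDiff (hf.ne_zero hx)).differentiableAt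
      (by norm_num))]

theorem exists_pd_eq : ∃ o : Fin 3 → E3 → ℝ, (∀ i, VanishesAtInfinity (o i)) ∧
    ∀ i x, R < ‖x‖ → pd i f x = pd i (expansionModel c₀ c₁ f₂) x + rho x ^ 3 * o i x := by
  have h := fun i => exists_factor_of_isLittleO (n := 3) (f := pd i (expansionRemainder f c₀ c₁ f₂))
    (by simpa [rho] using hf.hasExpansion.remainder_deriv i)
  choose o ho h using h
  refine ⟨o, ho, fun i x hx => ?_⟩
  have h1 := h i x (hf.ne_zero hx)
  rw [hf.pd_remainder i hx] at h1
  linarith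

theorem exists_pd_pd_eq : ∃ o : Fin 3 → Fin 3 → E3 → ℝ, (∀ i j, VanishesAtInfinity (o i j)) ∧
    ∀ i j x, R < ‖x‖ → pd j (pd i f) x
      = pd j (pd i (expansionModel c₀ c₁ f₂)) x + rho x ^ 4 * o i j x := by
  have h := fun i j => exists_factor_of_isLittleO (n := 4)
    (f := pd j (pd i (expansionRemainder f c₀ c₁ f₂)))
    (by simpa [rho] using hf.hasExpansion.remainder_deriv₂ i j)
  choose o ho h using h
  refine ⟨o, ho, fun i j x hx => ?_⟩
  have h1 := h i j x (hf.ne_zero hx)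
  have h2 : pd i (expansionRemainder f c₀ c₁ f₂) =ᶠ[𝓝 x]
      fun y => pd i f y - pd i (expansionModel c₀ c₁ f₂) y := by
    filter_upwards [(isOpen_norm_gt R).mem_nhds hx] with y hy using hf.pd_remainder i hy
  rw [pd_congr j h2, pd_sub j (differentiableAt_pd i (hf.contDiffAt hx)) (differentiableAt_pd i
    (contDiffAt_expansionModel hf.hasExpansion.contMDiff (hf.ne_zero hx)))] at h1
  linarith

theorem bdd_coefficient : BddAtInfinity fun x => f₂ (direction x) := by
  obtain ⟨q, hq, h⟩ := exists_factor_of_isBigO hf.homogeneous.isBigO_self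
  refine hq.congr' ?_
  filter_upwards [eventually_ne_zero] with x hx
  have h1 := h x hx
  rw [extension_eq] at h1
  exact (mul_left_cancel₀ (pow_ne_zero 2 (rho_pos hx).ne') h1).symm

/-- The first partial derivatives up to terms of third order. -/
theorem exists_pd_eq_bdd : ∃ q : Fin 3 → E3 → ℝ, (∀ i, BddAtInfinity (q i)) ∧
    ∀ i x, R < ‖x‖ → pd i f x = -c₁ * unitCoord i x * rho x ^ 2 + rho x ^ 3 * q i x := by
  obtain ⟨o, ho, h⟩ := hf.exists_pd_eq
  choose q hq h' using fun i => exists_factor_of_isBigO (hf.homogeneous.isBigO_pd i)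
  refine ⟨fun i x => q i x + o i x, fun i => (hq i).add (ho i).bdd, fun i x hx => ?_⟩
  rw [h i x hx, pd_expansionModel i hf.hasExpansion.contMDiff (hf.ne_zero hx),
    h' i x (hf.ne_zero hx)]
  ring

/-- The second partial derivatives up to terms of fourth order. -/
theorem exists_pd_pd_eq_bdd : ∃ q : Fin 3 → Fin 3 → E3 → ℝ, (∀ i j, BddAtInfinity (q i j)) ∧
    ∀ i j x, R < ‖x‖ → pd j (pd i f) x
      = c₁ * (3 * unitCoord i x * unitCoord j x - if i = j then 1 else 0) * rho x ^ 3
        + rho x ^ 4 * q i j x := by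
  obtain ⟨o, ho, h⟩ := hf.exists_pd_pd_eq
  choose q hq h' using fun i j => exists_factor_of_isBigO (hf.homogeneous.isBigO_pd_pd i j)
  refine ⟨fun i j x => q i j x + o i j x, fun i j => (hq i j).add (ho i j).bdd,
    fun i j x hx => ?_⟩
  rw [h i j x hx, pd_pd_expansionModel i j hf.hasExpansion.contMDiff (hf.ne_zero hx),
    h' i j x (hf.ne_zero hx)]
  ring

/-- The radial derivative up to terms of higher than third order. -/
theorem exists_radial_eq : ∃ o : E3 → ℝ, VanishesAtInfinity o ∧ ∀ x, R < ‖x‖ →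
    ∑ i, pd i f x * unitCoord i x
      = -c₁ * rho x ^ 2 - 2 * f₂ (direction x) * rho x ^ 3 + rho x ^ 3 * o x := by
  obtain ⟨o, ho, h⟩ := hf.exists_pd_eq
  refine ⟨fun x => ∑ i, o i x * unitCoord i x, VanishesAtInfinity.sum fun i =>
    (ho i).mul_bdd (bddAtInfinity_unitCoord i), fun x hx => ?_⟩
  have hx0 := hf.ne_zero hx
  -- By Euler's relation the radial derivative of the second-order term involves `f₂` but none of
  -- its derivatives.
  have h1 := hf.homogeneous.sum_unitCoord_mul_pd hx0
  have h2 := sum_sq_unitCoord hx0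
  rw [extension_eq] at h1
  simp only [h _ x hx, pd_expansionModel _ hf.hasExpansion.contMDiff hx0]
  simp only [Fin.sum_univ_three] at *
  linear_combination h1 - c₁ * rho x ^ 2 * h2

end IsExpandable

/-! ### Expansions of the metric and of the mean curvature -/

/-- The tensor `Y_{i,j} + Y_{j,i} - (1/2) (div Y) δ_{ij}`. -/
def deformation (Y : Fin 3 → E3 → ℝ) (i j : Fin 3) (x : E3) : ℝ :=
  pd j (Y i) x + pd i (Y j) x
    - (∑ l, pd l (Y l) x) / 2 * (1 : Matrix (Fin 3) (Fin 3) ℝ) i j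

/-- Data of harmonic asymptotics with expansions, outside of a ball. -/
structure AsymptoticData (R : ℝ) (g k : Tensor2) (u : E3 → ℝ) (Y : Fin 3 → E3 → ℝ) (A : ℝ)
    (B : Fin 3 → ℝ) (u₂ : S2 → ℝ) (Y₂ : Fin 3 → S2 → ℝ) : Prop where
  conformal : ConformalOn g k u (deformation Y) {x | R < ‖x‖}
  expandable_u : IsExpandable R u 1 A u₂
  expandable_Y : ∀ i, IsExpandable R (Y i) 0 (B i) (Y₂ i)
  tendsto_u : Tendsto u (cobounded E3) (𝓝 1)

theorem exists_norm_gt_of_eventually {p : E3 → Prop} (h : ∀ᶠ x in cobounded E3, p x) :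
    ∃ R : ℝ, ∀ x, R < ‖x‖ → p x := by
  obtain ⟨R, -, hR⟩ := hasBasis_cobounded_norm.eventually_iff.1 h
  exact ⟨R, fun x hx => hR hx.le⟩

/-- Enlarging the ball makes `u` positive, since `u → 1`; the metric alone determines only `u⁴`. -/
theorem exists_asymptoticData {M : Type*} [TopologicalSpace M] [ChartedSpace E3 M]
    [IsManifold (𝓡 3) ∞ M] {D : InitialDataSet M} {a : AsymptoticallyFlat D} {e : Fin a.numEnds}
    {u : E3 → ℝ} {Y : Fin 3 → E3 → ℝ} (h : a.IsHarmonic e u Y) {A : ℝ} {B : Fin 3 → ℝ}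
    {u₂ : S2 → ℝ} {Y₂ : Fin 3 → S2 → ℝ} (hu : HasExpansion u 1 A u₂)
    (hY : ∀ i, HasExpansion (Y i) 0 (B i) (Y₂ i)) :
    ∃ R, a.radius e ≤ R ∧ AsymptoticData R (a.gEnd e) (a.kEnd e) u Y A B u₂ Y₂ := by
  obtain ⟨R₀, hR₀⟩ := exists_norm_gt_of_eventually (h.tendsto_u.eventually_const_lt one_pos)
  have hpos : 0 < max (a.radius e) R₀ := lt_max_of_lt_left (a.radius_pos e)
  have hsub : {x : E3 | max (a.radius e) R₀ < ‖x‖} ⊆ a.region e :=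
    fun x hx => lt_of_le_of_lt (le_max_left (a.radius e) R₀)
      (show max (a.radius e) R₀ < ‖x‖ from hx)
  have heu : IsExpandable (max (a.radius e) R₀) u 1 A u₂ := ⟨hpos, h.contDiffOn_u.mono hsub, hu⟩
  have heY : ∀ i, IsExpandable (max (a.radius e) R₀) (Y i) 0 (B i) (Y₂ i) :=
    fun i => ⟨hpos, (h.contDiffOn_Y i).mono hsub, hY i⟩
  refine ⟨max (a.radius e) R₀, le_max_left _ _, ?_, heu, heY, h.tendsto_u⟩
  exact
    { isOpen := isOpen_norm_gt _
      ne_zero := fun x hx => heu.ne_zero hx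
      contDiffAt_u := fun x hx => heu.contDiffAt hx
      u_pos := fun x hx => hR₀ x ((le_max_right _ _).trans_lt hx)
      g_eq := fun x hx => h.g_eq x (hsub hx)
      k_eq := fun x hx => h.k_eq x (hsub hx)
      L_symm := fun x _ i j => by
        simp only [deformation, Matrix.one_apply, eq_comm]
        ring
      differentiableAt_L := fun x hx i j => by
        have hd : ∀ i j, DifferentiableAt ℝ (pd i (Y j)) x :=
          fun i j => differentiableAt_pd i ((heY j).contDiffAt hx)
        unfold deformation
        fun_prop }

theorem piFun_deformation (Y : Fin 3 → E3 → ℝ) {x : E3} (hx : x ≠ 0) :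
    piFun (deformation Y) x = ∑ l, pd l (Y l) x
      - 2 * ∑ a, ∑ b, pd b (Y a) x * unitCoord a x * unitCoord b x := by
  have h := sum_sq_unitCoord hx
  simp only [piFun, deformation, Matrix.one_apply, Fin.sum_univ_three] at h ⊢
  simp
  linear_combination (pd 0 (Y 0) x + pd 1 (Y 1) x + pd 2 (Y 2) x) / 2 * h

/-- Turns an error in `|H|²` into an error in `|H|`, by factoring a difference of squares with `√m +
s ≥ d`. The case `m ≤ 0`, where `√m = 0` by convention, is covered, so no prior proof that `H` is
spacelike is needed. -/
theorem abs_sqrt_sub_le {m s d f : ℝ} (hd : 0 < d) (hs : d ≤ s) (hm : m = s ^ 2 + d * f) :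
    |√m - s| ≤ |f| := by
  have hs0 : 0 < s := hd.trans_le hs
  rcases le_or_gt 0 m with h0 | h0
  · have h1 : (√m - s) * (√m + s) = d * f := by linear_combination Real.sq_sqrt h0 + hm
    have h2 : |√m - s| * (√m + s) = d * |f| := by
      rw [← abs_of_pos (by positivity : 0 < √m + s), ← abs_mul, h1, abs_mul, abs_of_pos hd]
    have h3 : |√m - s| * d ≤ |√m - s| * (√m + s) := by
      gcongr
      linarith [Real.sqrt_nonneg m]
    nlinarith only [h2, h3, hd]
  · rw [Real.sqrt_eq_zero_of_nonpos h0.le, zero_sub, abs_neg, abs_of_pos (hd.trans_le hs)]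
    have h1 : s * d ≤ d * |f| := by nlinarith only [neg_abs_le f, hm, h0, hs, hd]
    nlinarith only [h1, hd]

namespace AsymptoticData

variable {R : ℝ} {g k : Tensor2} {u : E3 → ℝ} {Y : Fin 3 → E3 → ℝ} {A : ℝ}
  {B : Fin 3 → ℝ} {u₂ : S2 → ℝ} {Y₂ : Fin 3 → S2 → ℝ}
  (h : AsymptoticData R g k u Y A B u₂ Y₂)

include h

theorem ne_zero {x : E3} (hx : R < ‖x‖) : x ≠ 0 := h.expandable_u.ne_zero hx

theorem bdd_inv_u : BddAtInfinity fun x => (u x)⁻¹ :=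
  (h.tendsto_u.inv₀ one_ne_zero).isBigO_one ℝ

theorem exists_piFun_eq : ∃ q : E3 → ℝ, BddAtInfinity q ∧ ∀ x, R < ‖x‖ →
    piFun (deformation Y) x = rho x ^ 2 * (∑ i, B i * unitCoord i x + rho x * q x) := by
  choose q hq h' using fun i => (h.expandable_Y i).exists_pd_eq_bdd
  refine ⟨fun x => ∑ l, q l l x - 2 * ∑ a, ∑ b, q a b x * unitCoord a x * unitCoord b x,
    by fun_prop, fun x hx => ?_⟩
  have hX := sum_sq_unitCoord (h.ne_zero hx)
  rw [piFun_deformation Y (h.ne_zero hx)]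
  simp only [h' _ _ x hx]
  simp only [Fin.sum_univ_three] at *
  linear_combination 2 * rho x ^ 2 * (B 0 * unitCoord 0 x + B 1 * unitCoord 1 x
    + B 2 * unitCoord 2 x) * hX

/-- The expansion of the induced metric. -/
theorem exists_metric_eq : ∃ o : E3 → ℝ, VanishesAtInfinity o ∧ ∀ x, R < ‖x‖ →
    u x ^ 4 = 1 + 4 * A * rho x + (4 * u₂ (direction x) + 6 * A ^ 2) * rho x ^ 2
      + rho x ^ 2 * o x := by
  obtain ⟨o, ho, hu⟩ := h.expandable_u.exists_eq
  have hz := h.expandable_u.bdd_coefficient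
  have hob := ho.bdd
  set s : E3 → ℝ := fun x => u₂ (direction x) + o x
  have hs : BddAtInfinity s := hz.add hob
  refine ⟨fun x => 4 * o x + rho x * (12 * A * s x + 6 * rho x * s x ^ 2
      + 4 * (A + rho x * s x) ^ 3 + rho x * (A + rho x * s x) ^ 4), ?_, fun x hx => ?_⟩
  · refine VanishesAtInfinity.add ?_ (vanishesAtInfinity_rho.mul_bdd (by fun_prop))
    simpa only [mul_comm] using ho.mul_bdd (BddAtInfinity.const 4)
  · have h1 := hu x (h.ne_zero hx)
    rw [expansionModel, extension_eq] at h1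
    rw [h1]
    simp only [s]
    ring

/-- The expansion of the norm of the mean curvature vector. -/
theorem exists_normH_eq : ∃ o : E3 → ℝ, VanishesAtInfinity o ∧ ∀ᶠ x in cobounded E3,
    normH g k x = 2 * rho x - 8 * A * rho x ^ 2
      + (-12 * u₂ (direction x) + 18 * A ^ 2
        - (1 / 4) * (∑ i, B i * unitCoord i x) ^ 2) * rho x ^ 3 + rho x ^ 3 * o x := by
  obtain ⟨o₀, ho₀, hu⟩ := h.expandable_u.exists_eq
  obtain ⟨o₁, ho₁, hr⟩ := h.expandable_u.exists_radial_eq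
  obtain ⟨q, hq, hpi⟩ := h.exists_piFun_eq
  have hz := h.expandable_u.bdd_coefficient
  have hob₀ := ho₀.bdd
  have hob₁ := ho₁.bdd
  have hiu := h.bdd_inv_u
  set z : E3 → ℝ := fun x => u₂ (direction x)
  set b : E3 → ℝ := fun x => ∑ i, B i * unitCoord i x with hb
  have hbb : BddAtInfinity b := by fun_prop
  -- Here `u = 1 + ρ t` with `t = A + ρ s`, and `2 ρ u + 4 ∂_r u = 2 ρ (1 - A ρ + e ρ²)`. The
  -- predicted value of `|H|` is `2 ρ T` with `T = 1 - 4 A ρ + c ρ²`, so `c` is half the coefficient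
  -- of `ρ³`. The functions `w₁`, `w₂`, `w₃`, `w₄` are the bounded remainders of `(u ϖ)² / (4 ρ⁴)`,
  -- `u⁶`, `T²` and `u⁶ T²`: the first after its leading term, the others after order `ρ²`.
  set s : E3 → ℝ := fun x => z x + o₀ x with hs
  set t : E3 → ℝ := fun x => A + rho x * s x with ht
  set e : E3 → ℝ := fun x => -3 * z x + o₀ x + 2 * o₁ x with he
  set c : E3 → ℝ := fun x => -6 * z x + 9 * A ^ 2 - b x ^ 2 / 8 with hc
  have hsb : BddAtInfinity s := by fun_prop
  have htb : BddAtInfinity t := by fun_prop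
  have heb : BddAtInfinity e := by fun_prop
  have hcb : BddAtInfinity c := by simp only [hc, div_eq_mul_inv]; fun_prop
  set w₁ : E3 → ℝ := fun x => (1 / 4) * ((2 * t x + rho x * t x ^ 2) * (b x + rho x * q x) ^ 2
    + 2 * b x * q x + rho x * q x ^ 2) with hw₁
  set w₂ : E3 → ℝ := fun x => 15 * (2 * A * s x + rho x * s x ^ 2) + 20 * t x ^ 3
    + 15 * rho x * t x ^ 4 + 6 * rho x ^ 2 * t x ^ 5 + rho x ^ 3 * t x ^ 6 with hw₂
  set w₃ : E3 → ℝ := fun x => -8 * A * c x + c x ^ 2 * rho x with hw₃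
  set w₄ : E3 → ℝ := fun x => 6 * A * (2 * c x + 16 * A ^ 2)
    + (6 * s x + 15 * A ^ 2) * (-8 * A)
    + rho x * (6 * s x + 15 * A ^ 2) * (2 * c x + 16 * A ^ 2)
    + w₂ x * (1 - 4 * A * rho x + c x * rho x ^ 2) ^ 2
    + w₃ x * (1 + 6 * A * rho x + (6 * s x + 15 * A ^ 2) * rho x ^ 2) with hw₄
  have hb₁ : BddAtInfinity w₁ := by fun_prop
  have hb₂ : BddAtInfinity w₂ := by fun_prop
  have hb₃ : BddAtInfinity w₃ := by fun_prop
  have hb₄ : BddAtInfinity w₄ := by fun_prop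
  -- This `c` makes the terms of relative order `ρ²` in `u⁶ (|H|² - (2 ρ T)²)` cancel, up to the
  -- vanishing quantity `4 (o₁ - o₀)`.
  set E : E3 → ℝ := fun x => (o₁ x - o₀ x) * 4
    + rho x * (-2 * A * e x + rho x * e x ^ 2 - w₁ x - w₄ x) with hE
  have hEv : VanishesAtInfinity E := by
    refine VanishesAtInfinity.add ?_ (vanishesAtInfinity_rho.mul_bdd (by fun_prop))
    refine VanishesAtInfinity.mul_bdd ?_ (BddAtInfinity.const 4)
    simpa [VanishesAtInfinity] using Tendsto.sub ho₁ ho₀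
  have hbound : VanishesAtInfinity fun x => E x * (4 * (u x)⁻¹ ^ 6) :=
    hEv.mul_bdd (by fun_prop)
  -- The bound `T > 1 / 2` gives `ρ ≤ 2 ρ T`, the lower bound required by `abs_sqrt_sub_le` with `d
  -- = ρ`.
  have hT : ∀ᶠ x in cobounded E3, 1 / 2 < 1 - 4 * A * rho x + c x * rho x ^ 2 := by
    have h1 : VanishesAtInfinity fun x => rho x * (-4 * A + c x * rho x) :=
      vanishesAtInfinity_rho.mul_bdd (by fun_prop)
    filter_upwards [Tendsto.eventually_const_lt (by norm_num : (-1 / 2 : ℝ) < 0) h1] with x hx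
    linarith
  -- The witness is the normalized error itself, so the expansion holds by definition and the
  -- content is that this error vanishes at infinity.
  refine ⟨fun x => (normH g k x - 2 * rho x * (1 - 4 * A * rho x + c x * rho x ^ 2))
    / rho x ^ 3, ?_, ?_⟩
  · refine squeeze_zero_norm' ?_ (tendsto_norm_zero.comp hbound)
    filter_upwards [hT, eventually_norm_gt R] with x hTx hx
    have hx0 := h.ne_zero hx
    have hρ := rho_pos hx0
    have hux := h.conformal.u_pos x hx
    have hu1 := hu x hx0
    have hr1 := hr x hx
    have hpi1 := hpi x hx
    rw [expansionModel, extension_eq] at hu1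
    have hN := h.conformal.normH_eq hx
    set N := normH g k x with hNdef
    set T := 1 - 4 * A * rho x + c x * rho x ^ 2 with hTdef
    have hmain : ((u x ^ 2)⁻¹ * etaFun u x) ^ 2 - ((u x ^ 2)⁻¹ * piFun (deformation Y) x) ^ 2
        = (2 * rho x * T) ^ 2 + rho x ^ 4 * (E x * (4 * (u x)⁻¹ ^ 6)) := by
      have h1 : (2 * rho x * u x + 4 * ∑ j, pd j u x * unitCoord j x) ^ 2
          - (u x * piFun (deformation Y) x) ^ 2
          = u x ^ 6 * (2 * rho x * T) ^ 2 + 4 * rho x ^ 4 * E x := by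
        rw [hr1, hpi1, hu1]
        simp only [hE, hTdef, hw₄, hw₃, hw₂, hw₁, ht, he, hs, hc]
        ring
      rw [etaFun]
      have h2 := hux.ne'
      field_simp
      linear_combination h1
    have hle := abs_sqrt_sub_le (s := 2 * rho x * T) hρ (by nlinarith only [hTx, hρ])
      (f := rho x ^ 3 * (E x * (4 * (u x)⁻¹ ^ 6))) (hmain.trans (by ring))
    rw [← hN, abs_mul, abs_of_pos (by positivity : 0 < rho x ^ 3)] at hle
    rw [Real.norm_eq_abs, abs_div, abs_of_pos (by positivity : 0 < rho x ^ 3),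
      div_le_iff₀ (by positivity)]
    exact hle.trans_eq (mul_comm _ _)
  · filter_upwards [eventually_ne_zero] with x hx
    have := (rho_pos hx).ne'
    simp only [hc]
    field_simp
    ring

end AsymptoticData

/-! ### The momentum constraint -/

/-- The function `⟨B, x / |x|⟩`. -/
def radialPart (B : Fin 3 → ℝ) (x : E3) : ℝ := ∑ i, B i * unitCoord i x

section RadialPart

variable {B : Fin 3 → ℝ} {x : E3} (i j : Fin 3)

theorem contDiffAt_radialPart (hx : x ≠ 0) : ContDiffAt ℝ 2 (radialPart B) x :=
  ContDiffAt.sum fun i _ => contDiffAt_const.mul (contDiffAt_unitCoord i hx)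

theorem differentiableAt_radialPart (hx : x ≠ 0) : DifferentiableAt ℝ (radialPart B) x :=
  (contDiffAt_radialPart hx).differentiableAt (by norm_num)

theorem pd_radialPart (hx : x ≠ 0) :
    pd j (radialPart B) x = (B j - radialPart B x * unitCoord j x) * rho x := by
  have hd := fun i => differentiableAt_unitCoord i hx
  unfold radialPart
  rw [pd_sum j _ (by fun_prop)]
  simp only [pd_const_mul j _ (hd _), pd_unitCoord _ _ hx, Fin.sum_univ_three]
  fin_cases j <;> simp <;> ring

theorem unitCoord_smul {c : ℝ} (hc : 0 < c) : unitCoord i (c • x) = unitCoord i x := by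
  rcases eq_or_ne x 0 with rfl | hx
  · simp
  have hn : ‖x‖ ≠ 0 := norm_ne_zero_iff.2 hx
  simp only [unitCoord, norm_smul, Real.norm_of_nonneg hc.le]
  simp
  field_simp

theorem rho_smul {c : ℝ} (hc : 0 < c) : rho (c • x) = c⁻¹ * rho x := by
  simp [rho, norm_smul, abs_of_pos hc, mul_comm]

theorem radialPart_smul {c : ℝ} (hc : 0 < c) : radialPart B (c • x) = radialPart B x := by
  simp only [radialPart, unitCoord_smul _ hc]

end RadialPart

/-- A particular solution of the equation satisfied by the term of order `-2` in `Y`. -/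
def particularSolution (A : ℝ) (B : Fin 3 → ℝ) (i : Fin 3) (x : E3) : ℝ :=
  A * (-(5 / 2) * B i + (1 / 2) * (radialPart B x * unitCoord i x)) * rho x ^ 2

section ParticularSolution

variable {A : ℝ} {B : Fin 3 → ℝ} {x : E3} (i j : Fin 3)

theorem contDiffAt_particularSolution (hx : x ≠ 0) :
    ContDiffAt ℝ 2 (particularSolution A B i) x := by
  have h1 := contDiffAt_radialPart (B := B) hx
  have h2 := contDiffAt_unitCoord i hx
  have h3 := contDiffAt_rho hx
  unfold particularSolution
  fun_prop

theorem pd_particularSolution (hx : x ≠ 0) : pd j (particularSolution A B i) x =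
    A * (5 * B i * unitCoord j x - 2 * radialPart B x * unitCoord i x * unitCoord j x
      + (1 / 2) * B j * unitCoord i x + (1 / 2) * radialPart B x * if i = j then 1 else 0)
      * rho x ^ 3 := by
  have h1 := differentiableAt_radialPart (B := B) hx
  have h2 := differentiableAt_unitCoord i hx
  have h3 := differentiableAt_rho hx
  unfold particularSolution
  rw [pd_mul j (by fun_prop) (by fun_prop), pd_const_mul j _ (by fun_prop),
    pd_add j (by fun_prop) (by fun_prop), pd_const, pd_const_mul j _ (by fun_prop),
    pd_mul j h1 h2, pd_pow j 2 h3, pd_rho j hx, pd_radialPart j hx, pd_unitCoord j i hx]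
  split_ifs <;> norm_num <;> ring

/-- On functions `r⁻² f` with `f` depending only on direction, the Laplacian is `r⁻⁴ (2 f + Δ_{S²}
f)`. It sends `B_i` to `2 B_i` and `⟨B, X⟩ X_i` to `2 B_i - 4 ⟨B, X⟩ X_i`; matching the required
right side forces the coefficients `1 / 2` and `-5 / 2`. -/
theorem laplacian_particularSolution (hx : x ≠ 0) :
    ∑ j, pd j (pd j (particularSolution A B i)) x
      = -(4 * A * B i + 2 * A * radialPart B x * unitCoord i x) * rho x ^ 4 := by
  have h1 := differentiableAt_radialPart (B := B) hx
  have h2 := fun i => differentiableAt_unitCoord i hx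
  have h3 := differentiableAt_rho hx
  have hX := sum_sq_unitCoord hx
  have hb : radialPart B x = ∑ j, B j * unitCoord j x := rfl
  have h4 : ∀ j, pd j (pd j (particularSolution A B i)) x =
      pd j (fun y => A * (5 * B i * unitCoord j y
        - 2 * radialPart B y * unitCoord i y * unitCoord j y
        + (1 / 2) * B j * unitCoord i y + (1 / 2) * radialPart B y * if i = j then 1 else 0)
      * rho y ^ 3) x := by
    intro j
    refine pd_congr j ?_
    filter_upwards [isOpen_ne.mem_nhds hx] with y hy using pd_particularSolution i j hy
  have h5 : ∀ j, pd j (pd j (particularSolution A B i)) x =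
      A * ((5 * B i * ((1 - unitCoord j x * unitCoord j x) * rho x)
        - (2 * radialPart B x * unitCoord i x * ((1 - unitCoord j x * unitCoord j x) * rho x)
          + unitCoord j x * (2 * radialPart B x * (((if i = j then 1 else 0)
            - unitCoord i x * unitCoord j x) * rho x)
          + unitCoord i x * (2 * ((B j - radialPart B x * unitCoord j x) * rho x))))
        + (1 / 2) * B j * (((if i = j then 1 else 0) - unitCoord i x * unitCoord j x) * rho x)
        + (1 / 2) * ((B j - radialPart B x * unitCoord j x) * rho x) * if i = j then 1 else 0)
        * rho x ^ 3
      + (5 * B i * unitCoord j x - 2 * radialPart B x * unitCoord i x * unitCoord j x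
        + (1 / 2) * B j * unitCoord i x + (1 / 2) * radialPart B x * if i = j then 1 else 0)
        * (-3 * unitCoord j x * rho x ^ 4)) := by
    intro j
    rw [h4, pd_mul j (by fun_prop) (by fun_prop), pd_const_mul j _ (by fun_prop),
      pd_add j (by fun_prop) (by fun_prop), pd_add j (by fun_prop) (by fun_prop),
      pd_sub j (by fun_prop) (by fun_prop), pd_const_mul j _ (h2 j),
      pd_mul j (by fun_prop) (h2 j), pd_mul j (by fun_prop) (h2 i), pd_const_mul j _ h1,
      pd_const_mul j _ (h2 i), pd_mul_const j _ (by fun_prop), pd_const_mul j _ h1,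
      pd_pow j 3 h3, pd_rho j hx, pd_radialPart j hx, pd_unitCoord j i hx, pd_unitCoord j j hx]
    norm_num
    ring
  simp only [h5, hb]
  simp only [Fin.sum_univ_three] at *
  have key : ∀ β ξ : ℝ, (A * (-20 * β + 12 * (B 0 * unitCoord 0 x + B 1 * unitCoord 1 x
      + B 2 * unitCoord 2 x) * ξ) * rho x ^ 4)
      * (unitCoord 0 x ^ 2 + unitCoord 1 x ^ 2 + unitCoord 2 x ^ 2 - 1) = 0 := by
    intro β ξ
    rw [hX, sub_self, mul_zero]
  fin_cases i <;> simp
  · linear_combination key (B 0) (unitCoord 0 x)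
  · linear_combination key (B 1) (unitCoord 1 x)
  · linear_combination key (B 2) (unitCoord 2 x)

theorem particularSolution_smul {c : ℝ} (hc : 0 < c) :
    particularSolution A B i (c • x) = (c ^ 2)⁻¹ * particularSolution A B i x := by
  simp only [particularSolution, radialPart_smul hc, unitCoord_smul _ hc, rho_smul hc]
  field_simp

end ParticularSolution

theorem traceReversed_deformation (Y : Fin 3 → E3 → ℝ) (i j : Fin 3) (x : E3) :
    traceReversed (deformation Y) i j x
      = pd j (Y i) x + pd i (Y j) x - if i = j then ∑ l, pd l (Y l) x else 0 := by
  simp only [traceReversed, deformation, Matrix.one_apply, Fin.sum_univ_three]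
  split_ifs <;> simp
  ring

namespace AsymptoticData

variable {R : ℝ} {g k : Tensor2} {u : E3 → ℝ} {Y : Fin 3 → E3 → ℝ} {A : ℝ}
  {B : Fin 3 → ℝ} {u₂ : S2 → ℝ} {Y₂ : Fin 3 → S2 → ℝ}
  (h : AsymptoticData R g k u Y A B u₂ Y₂)

include h

/-- The mixed term `∂_j ∂_i Y_j` cancels the gradient of the divergence, leaving the Laplacian; the
trace term in the form of `k` is chosen for this. -/
theorem sum_pd_traceReversed {x : E3} (hx : R < ‖x‖) (i : Fin 3) :
    ∑ j, pd j (traceReversed (deformation Y) i j) x = ∑ j, pd j (pd j (Y i)) x := by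
  have hd : ∀ i j, DifferentiableAt ℝ (pd i (Y j)) x :=
    fun i j => differentiableAt_pd i ((h.expandable_Y j).contDiffAt hx)
  have h1 : ∀ j, pd j (traceReversed (deformation Y) i j) x
      = pd j (pd j (Y i)) x + pd j (pd i (Y j)) x
        - if i = j then ∑ l, pd j (pd l (Y l)) x else 0 := by
    intro j
    have h2 : traceReversed (deformation Y) i j = fun y =>
        pd j (Y i) y + pd i (Y j) y - (∑ l, pd l (Y l) y) * if i = j then 1 else 0 := by
      funext y
      rw [traceReversed_deformation]
      simp
    rw [h2, pd_sub j (by fun_prop) (by fun_prop), pd_add j (hd _ _) (hd _ _),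
      pd_mul_const j _ (by fun_prop), pd_sum j _ fun l _ => hd l l]
    simp
  simp only [h1, Finset.sum_sub_distrib, Finset.sum_add_distrib, Finset.sum_ite_eq,
    Finset.mem_univ, if_true]
  have h3 : ∀ j, pd j (pd i (Y j)) x = pd i (pd j (Y j)) x :=
    fun j => pd_pd_comm j i ((h.expandable_Y j).contDiffAt hx)
  simp only [h3]
  ring

/-- The momentum constraint for conformally flat data. -/
theorem laplacian_add_eq_zero {x : E3} (hx : R < ‖x‖) (i : Fin 3)
    (hdiv : divergence g (fun y => k y - trace g k y • g y) i x = 0) :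
    ∑ j, pd j (pd j (Y i)) x + (u x)⁻¹ * (4 * ∑ j, pd j u x * (pd j (Y i) x + pd i (Y j) x)
      - 2 * pd i u x * ∑ j, pd j (Y j) x) = 0 := by
  have hu := (h.conformal.u_pos x hx).ne'
  rw [h.conformal.divergence_momentum_eq hx, h.sum_pd_traceReversed hx,
    mul_eq_zero_iff_left (inv_ne_zero (pow_ne_zero 2 hu))] at hdiv
  simp only [traceReversed_deformation] at hdiv
  rw [← hdiv]
  simp only [Fin.sum_univ_three]
  fin_cases i <;> simp <;> field_simp <;> ring

/-- These are the terms of order `r⁻⁴` of the momentum constraint; those of order `r⁻³` vanish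
because `1 / r` is harmonic. The difference `F` of the two sides is homogeneous of degree `-4` and
also `o(r⁻⁴)`, hence zero. -/
theorem laplacian_extension (hdiv : ∀ x, R < ‖x‖ →
    ∀ i, divergence g (fun y => k y - trace g k y • g y) i x = 0) (i : Fin 3) {x : E3}
    (hx : x ≠ 0) : ∑ j, pd j (pd j (extension (Y₂ i))) x
      = -(4 * A * B i + 2 * A * radialPart B x * unitCoord i x) * rho x ^ 4 := by
  obtain ⟨a, ha, hu⟩ := h.expandable_u.exists_pd_eq_bdd
  choose q hq hY using fun i => (h.expandable_Y i).exists_pd_eq_bdd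
  obtain ⟨o, ho, hYY⟩ := (h.expandable_Y i).exists_pd_pd_eq
  have hiu := h.bdd_inv_u
  set F : E3 → ℝ := fun x => ∑ j, pd j (pd j (extension (Y₂ i))) x
    + (4 * A * B i + 2 * A * radialPart B x * unitCoord i x) * rho x ^ 4 with hF
  have hhom : ∀ c : ℝ, 0 < c → F (c • x) = (c ^ 4)⁻¹ * F x := by
    intro c hc
    simp only [hF, (h.expandable_Y i).homogeneous.pd_pd_smul _ _ hc hx, radialPart_smul hc,
      unitCoord_smul _ hc, rho_smul hc, ← Finset.mul_sum]
    field_simp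
  set G : E3 → ℝ := fun x => 4 * A * B i + 2 * A * radialPart B x * unitCoord i x with hG
  have hGb : BddAtInfinity G := by
    simp only [hG, radialPart]
    fun_prop
  set Q : E3 → ℝ := fun x => 4 * ∑ j, (-A * unitCoord j x * (q i j x + q j i x)
      - a j x * (B i * unitCoord j x + B j * unitCoord i x)
      + rho x * a j x * (q i j x + q j i x))
    - 2 * (-A * unitCoord i x * ∑ j, q j j x - a i x * ∑ j, B j * unitCoord j x
      + rho x * a i x * ∑ j, q j j x) with hQ
  have hQb : BddAtInfinity Q := by fun_prop
  set V : E3 → ℝ := fun x => (1 - (u x)⁻¹) * G x + ((∑ j, o j j x) * (-1)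
    + rho x * (-(u x)⁻¹ * Q x)) with hV
  have hVv : VanishesAtInfinity V := by
    refine VanishesAtInfinity.add (VanishesAtInfinity.mul_bdd ?_ hGb)
      (VanishesAtInfinity.add ((VanishesAtInfinity.sum fun j => ho j j).mul_bdd
        (BddAtInfinity.const (-1)))
        (vanishesAtInfinity_rho.mul_bdd (by fun_prop)))
    simpa [VanishesAtInfinity] using tendsto_const_nhds.sub (h.tendsto_u.inv₀ one_ne_zero)
      (a := (1 : ℝ))
  have hFV : ∀ y, R < ‖y‖ → F y = rho y ^ 4 * V y := by
    intro y hy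
    have hy0 := h.ne_zero hy
    have h1 := h.laplacian_add_eq_zero hy i (hdiv y hy i)
    have hX := sum_sq_unitCoord hy0
    have h2 : ∑ j, pd j (pd j (Y i)) y = ∑ j, pd j (pd j (extension (Y₂ i))) y
        + rho y ^ 4 * ∑ j, o j j y := by
      simp only [hYY _ _ y hy,
        pd_pd_expansionModel _ _ (h.expandable_Y i).hasExpansion.contMDiff hy0, if_true]
      simp only [Fin.sum_univ_three] at hX ⊢
      linear_combination 3 * B i * rho y ^ 3 * hX
    have h3 : 4 * ∑ j, pd j u y * (pd j (Y i) y + pd i (Y j) y)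
        - 2 * pd i u y * ∑ j, pd j (Y j) y = rho y ^ 4 * G y + rho y ^ 5 * Q y := by
      simp only [hu _ y hy, hY _ _ y hy, hG, hQ, radialPart]
      simp only [Fin.sum_univ_three] at hX ⊢
      linear_combination 4 * A * B i * rho y ^ 4 * hX
    rw [h2, h3] at h1
    simp only [hF, hV]
    linear_combination h1
  have hlim : Tendsto (fun c : ℝ => V (c • x)) atTop (𝓝 0) := by
    refine hVv.comp ?_
    rw [← tendsto_norm_atTop_iff_cobounded]
    simp only [norm_smul, Real.norm_eq_abs]
    exact tendsto_abs_atTop_atTop.atTop_mul_const (norm_pos_iff.2 hx)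
  have hconst : ∀ᶠ c : ℝ in atTop, V (c • x) = F x / rho x ^ 4 := by
    filter_upwards [eventually_gt_atTop 0, eventually_gt_atTop (R / ‖x‖)] with c hc hcR
    have h1 : R < ‖c • x‖ := by
      rw [norm_smul, Real.norm_of_nonneg hc.le]
      exact (div_lt_iff₀ (norm_pos_iff.2 hx)).1 hcR
    have h2 := hFV _ h1
    rw [hhom c hc, rho_smul hc] at h2
    have hρ := (rho_pos hx).ne'
    field_simp at h2 ⊢
    linarith
  -- Along a ray `F / ρ⁴` is constant, while it tends to zero.
  have h1 := tendsto_nhds_unique (hlim.congr' hconst) tendsto_const_nhds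
  have h2 : F x = 0 := by
    rw [eq_comm, div_eq_zero_iff] at h1
    exact h1.resolve_right (pow_ne_zero 4 (rho_pos hx).ne')
  simp only [hF] at h2
  linarith

/-- The constraint determines the terms of order `-2` of `Y` up to linear functions. -/
theorem exists_linear_part (hdiv : ∀ x, R < ‖x‖ →
    ∀ i, divergence g (fun y => k y - trace g k y • g y) i x = 0) :
    ∃ d : Fin 3 → Fin 3 → ℝ, ∀ i (θ : S2), Y₂ i θ = ∑ j, d i j * (θ : E3) j
      + A * (-(5 / 2) * B i + (1 / 2) * (∑ j, B j * (θ : E3) j) * (θ : E3) i) := by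
  have key : ∀ i, ∃ c : Fin 3 → ℝ, ∀ θ : E3, ‖θ‖ = 1 →
      extension (Y₂ i) θ - particularSolution A B i θ = ∑ j, c j * θ j := by
    intro i
    have hZ := (h.expandable_Y i).homogeneous
    have hW : IsHomogeneousNegTwo fun x => extension (Y₂ i) x - particularSolution A B i x :=
      ⟨fun x hx => (hZ.contDiffAt x hx).sub (contDiffAt_particularSolution i hx),
        fun c hc x hx => by
          rw [hZ.smul c hc x hx, particularSolution_smul i hc]
          ring⟩
    refine hW.exists_linear_of_harmonic fun x hx => ?_
    have h1 : ∀ j, pd j (pd j fun x => extension (Y₂ i) x - particularSolution A B i x) x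
        = pd j (pd j (extension (Y₂ i))) x - pd j (pd j (particularSolution A B i)) x := by
      intro j
      have h2 : (pd j fun x => extension (Y₂ i) x - particularSolution A B i x) =ᶠ[𝓝 x]
          fun y => pd j (extension (Y₂ i)) y - pd j (particularSolution A B i) y := by
        filter_upwards [isOpen_ne.mem_nhds hx] with y hy
        exact pd_sub j (hZ.differentiableAt hy)
          ((contDiffAt_particularSolution i hy).differentiableAt (by norm_num))
      rw [pd_congr j h2, pd_sub j (differentiableAt_pd j (hZ.contDiffAt x hx))
        (differentiableAt_pd j (contDiffAt_particularSolution i hx))]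
    simp only [h1, Finset.sum_sub_distrib, h.laplacian_extension hdiv i hx,
      laplacian_particularSolution i hx, sub_self]
  choose d hd using key
  refine ⟨d, fun i θ => ?_⟩
  have hθ : ‖(θ : E3)‖ = 1 := by simp
  have h1 := hd i θ hθ
  have h2 : extension (Y₂ i) θ = Y₂ i θ := by
    rw [extension, direction_coe, hθ]
    norm_num
  rw [h2] at h1
  rw [← h1]
  simp only [particularSolution, radialPart, unitCoord, rho, hθ]
  norm_num
  ring

end AsymptoticData

/-! ### The connection one-form -/

/-- The partial derivatives of `B / r` plus the terms of order `-2` of `Y` in vacuum. -/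
def vacuumGradient (A : ℝ) (B : Fin 3 → ℝ) (d : Fin 3 → Fin 3 → ℝ) (i j : Fin 3) (x : E3) : ℝ :=
  -B i * unitCoord j x * rho x ^ 2
    + (d i j - 3 * radialPart (d i) x * unitCoord j x
      + A * (5 * B i * unitCoord j x - 2 * radialPart B x * unitCoord i x * unitCoord j x
        + (1 / 2) * B j * unitCoord i x + (1 / 2) * radialPart B x * if i = j then 1 else 0))
      * rho x ^ 3

/-- The trace part of `vacuumGradient` over the spheres which enters the mean curvature. -/
def vacuumTrace (A : ℝ) (B : Fin 3 → ℝ) (d : Fin 3 → Fin 3 → ℝ) (x : E3) : ℝ :=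
  radialPart B x * rho x ^ 2
    + (∑ l, d l l + ∑ a, radialPart (d a) x * unitCoord a x - 3 * A * radialPart B x) * rho x ^ 3

section Vacuum

variable {A : ℝ} {B : Fin 3 → ℝ} {d : Fin 3 → Fin 3 → ℝ} {x : E3}

@[fun_prop]
theorem bddAtInfinity_radialPart (B : Fin 3 → ℝ) : BddAtInfinity (radialPart B) := by
  unfold radialPart
  fun_prop

theorem vacuumTrace_eq (hx : x ≠ 0) : ∑ l, vacuumGradient A B d l l x
    - 2 * ∑ a, ∑ b, vacuumGradient A B d a b x * unitCoord a x * unitCoord b x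
      = vacuumTrace A B d x := by
  have hX := sum_sq_unitCoord hx
  have h1 : ∑ j, B j * unitCoord j x = radialPart B x := rfl
  have h2 : ∀ a, ∑ j, d a j * unitCoord j x = radialPart (d a) x := fun _ => rfl
  simp only [vacuumGradient, vacuumTrace]
  simp only [Fin.sum_univ_three] at *
  simp
  linear_combination (2 * (B 0 * unitCoord 0 x + B 1 * unitCoord 1 x + B 2 * unitCoord 2 x)
      * rho x ^ 2 + rho x ^ 3 * (6 * (radialPart (d 0) x * unitCoord 0 x
        + radialPart (d 1) x * unitCoord 1 x + radialPart (d 2) x * unitCoord 2 x)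
      + A * (-11 * (B 0 * unitCoord 0 x + B 1 * unitCoord 1 x + B 2 * unitCoord 2 x)
        + radialPart B x * (4 * (unitCoord 0 x ^ 2 + unitCoord 1 x ^ 2 + unitCoord 2 x ^ 2) + 1))))
      * hX + (rho x ^ 2 - (11 / 2) * A * rho x ^ 3) * h1
    - 2 * rho x ^ 3 * (unitCoord 0 x * h2 0 + unitCoord 1 x * h2 1 + unitCoord 2 x * h2 2)

/-- The terms proportional to `unitCoord i` are collected separately because they vanish against
tangent vectors. The same grouping is used in `sum_vacuumGradient_mul` and `exists_pd_etaFun_eq`. -/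
theorem pd_vacuumTrace (hx : x ≠ 0) (i : Fin 3) : pd i (vacuumTrace A B d) x =
    rho x ^ 3 * (B i + rho x * (∑ a, d a i * unitCoord a x + radialPart (d i) x - 3 * A * B i))
      + unitCoord i x * (rho x ^ 3 * (-3 * radialPart B x) + rho x ^ 4 *
        (-2 * (∑ a, radialPart (d a) x * unitCoord a x) + 3 * A * radialPart B x
          - 3 * (∑ l, d l l + ∑ a, radialPart (d a) x * unitCoord a x
            - 3 * A * radialPart B x))) := by
  have h1 := fun B => differentiableAt_radialPart (B := B) hx
  have h2 := fun i => differentiableAt_unitCoord i hx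
  have h3 := differentiableAt_rho hx
  have h4 : ∀ a, pd i (fun y => radialPart (d a) y * unitCoord a y) x
      = radialPart (d a) x * (((if a = i then 1 else 0) - unitCoord a x * unitCoord i x) * rho x)
        + unitCoord a x * ((d a i - radialPart (d a) x * unitCoord i x) * rho x) := by
    intro a
    rw [pd_mul i (h1 _) (h2 _), pd_radialPart i hx, pd_unitCoord i a hx]
  unfold vacuumTrace
  rw [pd_add i (by fun_prop) (by fun_prop), pd_mul i (by fun_prop) (by fun_prop),
    pd_mul i (by fun_prop) (by fun_prop), pd_sub i (by fun_prop) (by fun_prop),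
    pd_add i (by fun_prop) (by fun_prop), pd_const, pd_const_mul i _ (h1 B),
    pd_sum i _ (by fun_prop), pd_pow i 2 h3, pd_pow i 3 h3, pd_rho i hx, pd_radialPart i hx]
  simp only [h4, Fin.sum_univ_three]
  fin_cases i <;> simp <;> ring

theorem sum_vacuumGradient_mul (hx : x ≠ 0) (i : Fin 3) :
    ∑ j, (vacuumGradient A B d i j x + vacuumGradient A B d j i x) * unitCoord j x
      = -rho x ^ 2 * B i + rho x ^ 3 * (-2 * radialPart (d i) x
        + ∑ j, d j i * unitCoord j x + (11 / 2) * A * B i)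
      + unitCoord i x * (-radialPart B x * rho x ^ 2 + rho x ^ 3 *
        (-3 * (∑ a, radialPart (d a) x * unitCoord a x) + (5 / 2) * A * radialPart B x)) := by
  have hX := sum_sq_unitCoord hx
  have h1 : ∑ j, B j * unitCoord j x = radialPart B x := rfl
  have h2 : ∀ i, ∑ j, d i j * unitCoord j x = radialPart (d i) x := fun _ => rfl
  simp only [vacuumGradient]
  simp only [Fin.sum_univ_three] at *
  have key : ∀ i, (-B i * rho x ^ 2 + rho x ^ 3 * (-3 * radialPart (d i) x
      + (11 / 2) * A * B i - 4 * A * radialPart B x * unitCoord i x))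
        * (unitCoord 0 x ^ 2 + unitCoord 1 x ^ 2 + unitCoord 2 x ^ 2 - 1)
      + ((11 / 2) * A * unitCoord i x * rho x ^ 3 - unitCoord i x * rho x ^ 2)
        * (B 0 * unitCoord 0 x + B 1 * unitCoord 1 x + B 2 * unitCoord 2 x - radialPart B x)
      + rho x ^ 3 * (d i 0 * unitCoord 0 x + d i 1 * unitCoord 1 x + d i 2 * unitCoord 2 x
        - radialPart (d i) x) = 0 := by
    intro i
    rw [hX, h1, h2]
    ring
  fin_cases i <;> simp
  · linear_combination key 0
  · linear_combination key 1
  · linear_combination key 2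

end Vacuum

namespace AsymptoticData

variable {R : ℝ} {g k : Tensor2} {u : E3 → ℝ} {Y : Fin 3 → E3 → ℝ} {A : ℝ}
  {B : Fin 3 → ℝ} {u₂ : S2 → ℝ} {Y₂ : Fin 3 → S2 → ℝ}
  (h : AsymptoticData R g k u Y A B u₂ Y₂)

include h

theorem pd_expansionModel_eq {d : Fin 3 → Fin 3 → ℝ} (hd : ∀ i (θ : S2), Y₂ i θ =
      ∑ j, d i j * (θ : E3) j
        + A * (-(5 / 2) * B i + (1 / 2) * (∑ j, B j * (θ : E3) j) * (θ : E3) i))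
    (i j : Fin 3) {x : E3} (hx : x ≠ 0) :
    pd j (expansionModel 0 (B i) (Y₂ i)) x = vacuumGradient A B d i j x := by
  have h1 : ∀ y ≠ 0, extension (Y₂ i) y
      = radialPart (d i) y * rho y ^ 2 + particularSolution A B i y := by
    intro y hy
    rw [extension_eq, hd]
    simp only [coe_direction hy, radialPart, particularSolution, unitCoord, rho]
    simp only [PiLp.smul_apply, smul_eq_mul, mul_comm _ (‖y‖⁻¹)]
    simp only [Fin.sum_univ_three]
    ring
  have h2 : extension (Y₂ i) =ᶠ[𝓝 x]
      fun y => radialPart (d i) y * rho y ^ 2 + particularSolution A B i y := by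
    filter_upwards [isOpen_ne.mem_nhds hx] with y hy using h1 y hy
  have hd1 := differentiableAt_radialPart (B := d i) hx
  have hd2 := differentiableAt_rho hx
  rw [pd_expansionModel j (h.expandable_Y i).hasExpansion.contMDiff hx, pd_congr j h2,
    pd_add j (by fun_prop)
      ((contDiffAt_particularSolution i hx).differentiableAt (by norm_num)),
    pd_mul j hd1 (by fun_prop), pd_pow j 2 hd2, pd_rho j hx, pd_radialPart j hx,
    pd_particularSolution i j hx, vacuumGradient]
  norm_num
  ring

theorem exists_pd_piFun_eq {d : Fin 3 → Fin 3 → ℝ} (hd : ∀ i (θ : S2), Y₂ i θ =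
      ∑ j, d i j * (θ : E3) j
        + A * (-(5 / 2) * B i + (1 / 2) * (∑ j, B j * (θ : E3) j) * (θ : E3) i)) :
    ∃ o : Fin 3 → E3 → ℝ, (∀ i, VanishesAtInfinity (o i)) ∧ ∀ i x, R < ‖x‖ →
      pd i (piFun (deformation Y)) x = pd i (vacuumTrace A B d) x + rho x ^ 4 * o i x := by
  choose o ho hY using fun i => (h.expandable_Y i).exists_pd_eq
  choose p hp hYY using fun i => (h.expandable_Y i).exists_pd_pd_eq
  have hob : ∀ i j, BddAtInfinity (o i j) := fun i j => (ho i j).bdd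
  refine ⟨fun i x => ∑ l, p l l i x + (∑ a, ∑ b, (p a b i x * (unitCoord a x * unitCoord b x)
    + o a b x * (((if a = i then 1 else 0) - unitCoord a x * unitCoord i x) * unitCoord b x
      + unitCoord a x * ((if b = i then 1 else 0) - unitCoord b x * unitCoord i x)))) * (-2),
    fun i => ?_, fun i x hx => ?_⟩
  · refine (VanishesAtInfinity.sum fun l => hp l l i).add (VanishesAtInfinity.mul_bdd
      (VanishesAtInfinity.sum fun a => VanishesAtInfinity.sum fun b => ?_)
      (BddAtInfinity.const _))
    exact ((hp a b i).mul_bdd (by fun_prop)).add ((ho a b).mul_bdd (by fun_prop))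
  have hx0 := h.ne_zero hx
  have hX := fun a => differentiableAt_unitCoord a hx0
  -- `E` is the error in the first derivatives of `Y`. Since `ϖ` already contains first derivatives,
  -- its gradient uses the bounds on the second derivatives of the remainder.
  set E : Fin 3 → Fin 3 → E3 → ℝ := fun a b y =>
    pd b (Y a) y - pd b (expansionModel 0 (B a) (Y₂ a)) y with hE
  have hEd : ∀ a b, DifferentiableAt ℝ (E a b) x := fun a b =>
    (differentiableAt_pd b ((h.expandable_Y a).contDiffAt hx)).sub (differentiableAt_pd b
      (contDiffAt_expansionModel (h.expandable_Y a).hasExpansion.contMDiff hx0))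
  have hE0 : ∀ a b, E a b x = rho x ^ 3 * o a b x := by
    intro a b
    simp only [hE, hY a b x hx]
    ring
  have hE1 : ∀ a b, pd i (E a b) x = rho x ^ 4 * p a b i x := by
    intro a b
    simp only [hE]
    rw [pd_sub i (differentiableAt_pd b ((h.expandable_Y a).contDiffAt hx)) (differentiableAt_pd b
      (contDiffAt_expansionModel (h.expandable_Y a).hasExpansion.contMDiff hx0)),
      hYY a b i x hx]
    ring
  have h1 : piFun (deformation Y) =ᶠ[𝓝 x] fun y => vacuumTrace A B d y + (∑ l, E l l y
      - 2 * ∑ a, ∑ b, E a b y * (unitCoord a y * unitCoord b y)) := by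
    filter_upwards [(isOpen_norm_gt R).mem_nhds hx] with y hy
    have hy0 := h.ne_zero hy
    rw [piFun_deformation Y hy0, ← vacuumTrace_eq hy0]
    simp only [hE, h.pd_expansionModel_eq hd _ _ hy0]
    simp only [Fin.sum_univ_three]
    ring
  have hTd : DifferentiableAt ℝ (vacuumTrace A B d) x := by
    have h1 := fun B => differentiableAt_radialPart (B := B) hx0
    have h3 := differentiableAt_rho hx0
    unfold vacuumTrace
    fun_prop
  have h2 : ∀ a b, pd i (fun y => E a b y * (unitCoord a y * unitCoord b y)) x
      = rho x ^ 4 * (p a b i x * (unitCoord a x * unitCoord b x)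
    + o a b x * (((if a = i then 1 else 0) - unitCoord a x * unitCoord i x) * unitCoord b x
      + unitCoord a x * ((if b = i then 1 else 0) - unitCoord b x * unitCoord i x))) := by
    intro a b
    rw [pd_mul i (hEd a b) (by fun_prop), pd_mul i (hX a) (hX b), hE0, hE1, pd_unitCoord i a hx0,
      pd_unitCoord i b hx0]
    ring
  have h3 : ∀ a, pd i (fun y => ∑ b, E a b y * (unitCoord a y * unitCoord b y)) x
      = ∑ b, pd i (fun y => E a b y * (unitCoord a y * unitCoord b y)) x :=
    fun a => pd_sum i _ (by fun_prop)
  rw [pd_congr i h1, pd_add i hTd (by fun_prop), pd_sub i (by fun_prop) (by fun_prop),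
    pd_const_mul i _ (by fun_prop), pd_sum i _ fun l _ => hEd l l,
    pd_sum i _ (by fun_prop)]
  simp only [h3, h2, hE1, ← Finset.mul_sum]
  ring

/-- The tangential derivatives of `etaFun` are of fourth order. -/
theorem exists_pd_etaFun_eq : ∃ e : Fin 3 → E3 → ℝ, ∃ lam : E3 → ℝ, (∀ i, BddAtInfinity (e i)) ∧
    ∀ i x, R < ‖x‖ → pd i (etaFun u) x = rho x ^ 4 * e i x + unitCoord i x * lam x := by
  obtain ⟨a, ha, hu⟩ := h.expandable_u.exists_pd_eq_bdd
  obtain ⟨s, hs, huu⟩ := h.expandable_u.exists_pd_pd_eq_bdd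
  have hiu := h.bdd_inv_u
  set W : E3 → ℝ := fun x => ∑ j, pd j u x * unitCoord j x with hW
  set w : E3 → ℝ := fun x => -A + rho x * ∑ j, a j x * unitCoord j x with hw
  have hWw : ∀ x, R < ‖x‖ → W x = rho x ^ 2 * w x := by
    intro x hx
    have hX := sum_sq_unitCoord (h.ne_zero hx)
    simp only [hW, hw, hu _ x hx]
    simp only [Fin.sum_univ_three] at *
    linear_combination -A * rho x ^ 2 * hX
  -- The gradient of `ρ` and the leading parts of the gradients of `u` and `∂_r u` are radial, and
  -- all of them go into `lam`; what is left carries a factor `ρ⁴`.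
  refine ⟨fun i x => 4 * ((∑ j, s j i x * unitCoord j x + a i x) * (u x)⁻¹
      - rho x * w x * a i x * (u x)⁻¹ ^ 2),
    fun x => -2 * rho x ^ 2 + 4 * ((A * rho x ^ 3 - rho x * W x) * (u x)⁻¹
      + W x * A * rho x ^ 2 * (u x)⁻¹ ^ 2), fun i => by fun_prop, fun i x hx => ?_⟩
  have hx0 := h.ne_zero hx
  have hX := sum_sq_unitCoord hx0
  have hXd := fun a => differentiableAt_unitCoord a hx0
  have hρd := differentiableAt_rho hx0
  have hux := (h.conformal.u_pos x hx).ne'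
  have hud := h.conformal.differentiableAt_u hx
  have huud : ∀ j, DifferentiableAt ℝ (pd j u) x :=
    fun j => differentiableAt_pd j (h.expandable_u.contDiffAt hx)
  have hWd : DifferentiableAt ℝ W x := by fun_prop
  have h1 : etaFun u = fun y => 2 * rho y + 4 * W y / u y := rfl
  have h2 : pd i W x = rho x ^ 4 * (∑ j, s j i x * unitCoord j x + a i x)
      + unitCoord i x * (A * rho x ^ 3 - rho x * W x) := by
    have h3 : ∀ j, pd i (fun y => pd j u y * unitCoord j y) x
        = pd j u x * (((if j = i then 1 else 0) - unitCoord j x * unitCoord i x) * rho x)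
          + unitCoord j x * (A * (3 * unitCoord j x * unitCoord i x - if j = i then 1 else 0)
            * rho x ^ 3 + rho x ^ 4 * s j i x) := by
      intro j
      rw [pd_mul i (huud j) (hXd j), huu j i x hx, pd_unitCoord i j hx0]
    have h4 : pd i W x = ∑ j, pd i (fun y => pd j u y * unitCoord j y) x :=
      pd_sum i _ (by fun_prop)
    have h5 : ∑ j, pd j u x * (((if j = i then 1 else 0) - unitCoord j x * unitCoord i x) * rho x)
        = rho x * pd i u x - rho x * unitCoord i x * W x := by
      simp only [hW, Fin.sum_univ_three]
      fin_cases i <;> simp <;> ring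
    have h6 : ∑ j, unitCoord j x * (A * (3 * unitCoord j x * unitCoord i x
          - if j = i then 1 else 0) * rho x ^ 3 + rho x ^ 4 * s j i x)
        = 2 * A * unitCoord i x * rho x ^ 3 + rho x ^ 4 * ∑ j, s j i x * unitCoord j x := by
      simp only [Fin.sum_univ_three] at hX ⊢
      fin_cases i <;> simp
      · linear_combination 3 * A * unitCoord 0 x * rho x ^ 3 * hX
      · linear_combination 3 * A * unitCoord 1 x * rho x ^ 3 * hX
      · linear_combination 3 * A * unitCoord 2 x * rho x ^ 3 * hX
    rw [h4]
    simp only [h3, Finset.sum_add_distrib]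
    rw [h5, h6, hu i x hx]
    ring
  have hq : DifferentiableAt ℝ (fun y => 4 * W y / u y) x := by
    simp only [div_eq_mul_inv]
    exact (hWd.const_mul 4).fun_mul (hud.fun_inv hux)
  rw [h1, pd_add i (by fun_prop) hq, pd_const_mul i _ hρd,
    pd_div i (by fun_prop) hud hux, pd_const_mul i _ hWd, h2, pd_rho i hx0, hu i x hx]
  have h3 := hWw x hx
  field_simp
  linear_combination (-4 * rho x ^ 3 * a i x) * h3

end AsymptoticData

theorem sum_mul_unitCoord_eq_zero {x v : E3} (hv : inner ℝ x v = 0) :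
    ∑ i, v i * unitCoord i x = 0 := by
  have h1 : ∑ i, v i * x i = 0 := by
    simpa [PiLp.inner_apply] using hv
  simp only [unitCoord, ← mul_assoc, ← Finset.sum_mul, h1, zero_mul]

/-- The deformation tensor in a tangential and the radial direction. -/
theorem sum_deformation_eq {Y : Fin 3 → E3 → ℝ} {x v : E3} (hv : inner ℝ x v = 0) :
    ∑ i, ∑ j, deformation Y i j x * v i * unitCoord j x
      = ∑ i, v i * ∑ j, (pd j (Y i) x + pd i (Y j) x) * unitCoord j x := by
  have h1 := sum_mul_unitCoord_eq_zero hv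
  simp only [deformation, Matrix.one_apply, Fin.sum_univ_three] at *
  simp
  linear_combination -(pd 0 (Y 0) x + pd 1 (Y 1) x + pd 2 (Y 2) x) / 2 * h1

namespace AsymptoticData

variable {R : ℝ} {g k : Tensor2} {u : E3 → ℝ} {Y : Fin 3 → E3 → ℝ} {A : ℝ}
  {B : Fin 3 → ℝ} {u₂ : S2 → ℝ} {Y₂ : Fin 3 → S2 → ℝ}
  (h : AsymptoticData R g k u Y A B u₂ Y₂)

include h

theorem exists_etaFun_eq : ∃ m : E3 → ℝ, VanishesAtInfinity (fun x => m x + A) ∧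
    ∀ x, R < ‖x‖ → etaFun u x = 2 * rho x * (1 + 2 * rho x * m x) := by
  obtain ⟨o, ho, hr⟩ := h.expandable_u.exists_radial_eq
  have hz := h.expandable_u.bdd_coefficient
  have hob := ho.bdd
  have hiu := h.bdd_inv_u
  refine ⟨fun x => (-A + rho x * (-2 * u₂ (direction x) + o x)) * (u x)⁻¹, ?_, fun x hx => ?_⟩
  · have h1 : VanishesAtInfinity fun x => (1 - (u x)⁻¹) * A
        + rho x * ((-2 * u₂ (direction x) + o x) * (u x)⁻¹) := by
      refine VanishesAtInfinity.add (VanishesAtInfinity.mul_bdd ?_ (BddAtInfinity.const A))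
        (vanishesAtInfinity_rho.mul_bdd ((((BddAtInfinity.const _).mul hz).add hob).mul hiu))
      simpa [VanishesAtInfinity] using tendsto_const_nhds.sub (h.tendsto_u.inv₀ one_ne_zero)
        (a := (1 : ℝ))
    refine h1.congr' (Eventually.of_forall fun x => ?_)
    ring
  · have := (h.conformal.u_pos x hx).ne'
    rw [etaFun, hr x hx]
    field_simp
    ring

/-- The expansion of the connection one-form. -/
theorem exists_alphaH_eq {d : Fin 3 → Fin 3 → ℝ} (hd : ∀ i (θ : S2), Y₂ i θ =
      ∑ j, d i j * (θ : E3) j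
        + A * (-(5 / 2) * B i + (1 / 2) * (∑ j, B j * (θ : E3) j) * (θ : E3) i)) :
    ∃ c : Fin 3 → E3 → ℝ, (∀ i, VanishesAtInfinity (c i)) ∧
      ∀ᶠ x in cobounded E3, ∀ v : E3, inner ℝ x v = 0 → alphaH g k x v =
        ∑ i, v i * ((3 / 2) * B i * rho x ^ 2 - rho x ^ 3 * (6 * A * B i
          - (5 / 2) * radialPart (d i) x + (1 / 2) * ∑ j, d j i * unitCoord j x)
          + rho x ^ 3 * c i x) := by
  obtain ⟨p', hp', hdpi⟩ := h.exists_pd_piFun_eq hd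
  obtain ⟨e, lam, he, hdeta⟩ := h.exists_pd_etaFun_eq
  obtain ⟨q, hq, hpi⟩ := h.exists_piFun_eq
  obtain ⟨m, hm, heta⟩ := h.exists_etaFun_eq
  choose o ho hY using fun i => (h.expandable_Y i).exists_pd_eq
  have hpb : ∀ i, BddAtInfinity (p' i) := fun i => (hp' i).bdd
  have hmb : BddAtInfinity m := by
    have h1 := hm.bdd.sub (BddAtInfinity.const A)
    simpa using h1
  set p : E3 → ℝ := fun x => radialPart B x + rho x * q x with hp
  have hpbd : BddAtInfinity p := by fun_prop
  -- This is `(η² - ϖ²) / ρ²`. Its limit `4` shows that `H` is spacelike far out and keeps the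
  -- denominator bounded below.
  set D : E3 → ℝ := fun x => 4 * (1 + 2 * rho x * m x) ^ 2 - rho x ^ 2 * p x ^ 2 with hD
  have hDlim : Tendsto D (cobounded E3) (𝓝 4) := by
    have h1 : VanishesAtInfinity fun x =>
        rho x * (16 * m x + 16 * rho x * m x ^ 2 - rho x * p x ^ 2) :=
      vanishesAtInfinity_rho.mul_bdd (by fun_prop)
    have h2 := Tendsto.const_add 4 h1
    rw [add_zero] at h2
    refine h2.congr fun x => ?_
    simp only [hD]
    ring
  have hK : BddAtInfinity fun x => (D x)⁻¹ :=
    (hDlim.inv₀ (by norm_num)).isBigO_one ℝ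
  set S : Fin 3 → E3 → ℝ := fun i x => ∑ j, d j i * unitCoord j x + radialPart (d i) x with hS
  have hSb : ∀ i, BddAtInfinity (S i) := fun i => by fun_prop
  set N : Fin 3 → E3 → ℝ := fun i x => S i x - 3 * A * B i + p' i x with hN
  have hNb : ∀ i, BddAtInfinity (N i) := fun i => by fun_prop
  -- The quotient in `alphaH_eq` is `ρ² (B_i + ρ F_i) / 2` up to `o(ρ³)`: the `-3 A B_i` in `N` is
  -- changed to `-A B_i` by the factor `1 + 2 A ρ` of `1 / η`.
  set F : Fin 3 → E3 → ℝ := fun i x => S i x - A * B i with hF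
  have hFb : ∀ i, BddAtInfinity (F i) := fun i => by fun_prop
  refine ⟨fun i x => ((m x + A) * (-4 * B i * (D x)⁻¹) + p' i x * (2 * (D x)⁻¹))
    + (rho x * ((D x)⁻¹ * (4 * m x * N i x - 8 * m x * F i x
        - 8 * m x ^ 2 * (B i + rho x * F i x) - p x * e i x
        + (1 / 2) * p x ^ 2 * (B i + rho x * F i x)))
      + (∑ j, (o i j x * unitCoord j x + o j i x * unitCoord j x)) * (-1)), fun i => ?_, ?_⟩
  · refine ((hm.mul_bdd (by fun_prop)).add ((hp' i).mul_bdd (by fun_prop))).add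
      ((vanishesAtInfinity_rho.mul_bdd (by fun_prop)).add (VanishesAtInfinity.mul_bdd
        (VanishesAtInfinity.sum fun j => ?_) (BddAtInfinity.const _)))
    exact ((ho i j).mul_bdd (by fun_prop)).add ((ho j i).mul_bdd (by fun_prop))
  filter_upwards [eventually_norm_gt R, hDlim.eventually_const_lt (by norm_num : (0 : ℝ) < 4)]
    with x hx hDx v hv
  have hx0 := h.ne_zero hx
  have hρ := rho_pos hx0
  have hvX := sum_mul_unitCoord_eq_zero hv
  have hpix : piFun (deformation Y) x = rho x ^ 2 * p x := hpi x hx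
  have hden : etaFun u x ^ 2 - piFun (deformation Y) x ^ 2 = rho x ^ 2 * D x := by
    rw [heta x hx, hpix]
    simp only [hD]
    ring
  have hdπ : fderiv ℝ (piFun (deformation Y)) x v
      = rho x ^ 3 * ∑ i, v i * (B i + rho x * N i x) := by
    rw [fderiv_eq_sum_pd]
    simp only [hdpi _ x hx, pd_vacuumTrace hx0]
    have h1 : ∀ (a b : Fin 3 → ℝ) (s : ℝ), ∑ i, v i * (a i + unitCoord i x * s + b i)
        = ∑ i, v i * (a i + b i) := by
      intro a b s
      simp only [Fin.sum_univ_three] at hvX ⊢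
      linear_combination s * hvX
    rw [h1, Finset.mul_sum]
    refine Finset.sum_congr rfl fun i _ => ?_
    simp only [hN, hS]
    ring
  have hdη : fderiv ℝ (etaFun u) x v = rho x ^ 4 * ∑ i, v i * e i x := by
    rw [fderiv_eq_sum_pd]
    simp only [hdeta _ x hx]
    simp only [Fin.sum_univ_three] at hvX ⊢
    linear_combination lam x * hvX
  have hL : ∑ i, ∑ j, deformation Y i j x * v i * unitCoord j x
      = ∑ i, v i * (-rho x ^ 2 * B i + rho x ^ 3 * (-2 * radialPart (d i) x
        + ∑ j, d j i * unitCoord j x + (11 / 2) * A * B i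
        + ∑ j, (o i j x * unitCoord j x + o j i x * unitCoord j x))) := by
    rw [sum_deformation_eq hv]
    simp only [hY _ _ x hx, h.pd_expansionModel_eq hd _ _ hx0]
    have h1 : ∀ i, ∑ j, (vacuumGradient A B d i j x + rho x ^ 3 * o i j x
          + (vacuumGradient A B d j i x + rho x ^ 3 * o j i x)) * unitCoord j x
        = ∑ j, (vacuumGradient A B d i j x + vacuumGradient A B d j i x) * unitCoord j x
          + rho x ^ 3 * ∑ j, (o i j x * unitCoord j x + o j i x * unitCoord j x) := by
      intro i
      rw [Finset.mul_sum, ← Finset.sum_add_distrib]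
      exact Finset.sum_congr rfl fun j _ => by ring
    simp only [h1, sum_vacuumGradient_mul hx0]
    have h2 : ∀ (a b : Fin 3 → ℝ) (s : ℝ), ∑ i, v i * (a i + unitCoord i x * s + b i)
        = ∑ i, v i * (a i + b i) := by
      intro a b s
      simp only [Fin.sum_univ_three] at hvX ⊢
      linear_combination s * hvX
    rw [h2]
    refine Finset.sum_congr rfl fun i _ => ?_
    ring
  rw [h.conformal.alphaH_eq hx (by rw [hden]; positivity), hden, hdπ, hdη, hL, hpix, heta x hx]
  have hsplit : (2 * rho x * (1 + 2 * rho x * m x)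
        * (rho x ^ 3 * ∑ i, v i * (B i + rho x * N i x))
      - rho x ^ 2 * p x * (rho x ^ 4 * ∑ i, v i * e i x)) / (rho x ^ 2 * D x)
      = ∑ i, v i * (rho x ^ 2 * (D x)⁻¹ * (2 * (1 + 2 * rho x * m x) * (B i + rho x * N i x)
        - rho x ^ 2 * p x * e i x)) := by
    have := hρ.ne'
    have := hDx.ne'
    simp only [Fin.sum_univ_three]
    field_simp
    ring
  rw [hsplit, ← Finset.sum_sub_distrib]
  refine Finset.sum_congr rfl fun i _ => ?_
  have hKD : (D x)⁻¹ * (4 * (1 + 2 * rho x * m x) ^ 2 - rho x ^ 2 * p x ^ 2) = 1 :=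
    inv_mul_cancel₀ hDx.ne'
  simp only [hN, hF, hS]
  generalize (D x)⁻¹ = κ at *
  generalize ∑ j, (o i j x * unitCoord j x + o j i x * unitCoord j x) = O at *
  -- Multiplying the predicted leading part by `κ D = 1` puts it over the denominator of the exact
  -- quotient; the difference is then the chosen remainder.
  linear_combination v i * rho x ^ 2 * (1 / 2) * (B i + rho x * (∑ j, d j i * unitCoord j x
    + radialPart (d i) x - A * B i)) * hKD

end AsymptoticData

/-! ### Passage to the unit sphere -/

section Sphere

variable {r : ℝ} (hr : 0 < r) (θ : S2)

theorem coe_sphere_ne_zero : (θ : E3) ≠ 0 := ne_zero_of_mem_unit_sphere θ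

include hr

theorem norm_smul_sphere : ‖r • (θ : E3)‖ = r := by
  rw [norm_smul, Real.norm_of_nonneg hr.le]
  simp

theorem rho_smul_sphere : rho (r • (θ : E3)) = r⁻¹ := by
  rw [rho, norm_smul_sphere hr]

theorem unitCoord_smul_sphere (i : Fin 3) : unitCoord i (r • (θ : E3)) = (θ : E3) i := by
  rw [unitCoord_smul i hr]
  simp [unitCoord]

theorem direction_smul_sphere : direction (r • (θ : E3)) = θ := by
  rw [direction_smul hr (coe_sphere_ne_zero θ), direction_coe]

end Sphere

theorem exists_radius_of_eventually {p : E3 → Prop} (h : ∀ᶠ x in cobounded E3, p x) :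
    ∃ r₀ : ℝ, 0 < r₀ ∧ ∀ r ≥ r₀, ∀ θ : S2, p (r • (θ : E3)) := by
  obtain ⟨R, hR⟩ := exists_norm_gt_of_eventually h
  refine ⟨max R 0 + 1, by positivity, fun r hr θ => hR _ ?_⟩
  have h0 : 0 < r := lt_of_lt_of_le (by positivity) hr
  rw [norm_smul_sphere h0]
  linarith [le_max_left R 0]

theorem VanishesAtInfinity.eventually_abs_le {f : E3 → ℝ} (hf : VanishesAtInfinity f) {ε : ℝ}
    (hε : 0 < ε) : ∀ᶠ x in cobounded E3, |f x| ≤ ε := by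
  filter_upwards [(tendsto_zero_iff_abs_tendsto_zero f).1 hf |>.eventually_lt_const hε]
    with x hx using hx.le

namespace AsymptoticData

variable {R : ℝ} {g k : Tensor2} {u : E3 → ℝ} {Y : Fin 3 → E3 → ℝ} {A : ℝ}
  {B : Fin 3 → ℝ} {u₂ : S2 → ℝ} {Y₂ : Fin 3 → S2 → ℝ}
  (h : AsymptoticData R g k u Y A B u₂ Y₂)

include h

theorem sigmaOn_asymptotics {ε : ℝ} (hε : 0 < ε) : ∃ r₀ : ℝ, ∀ r ≥ r₀, ∀ (θ : S2) (v w : E3),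
    inner ℝ (θ : E3) v = 0 → inner ℝ (θ : E3) w = 0 →
    |sigmaOn g r θ v w - (r ^ 2 + 4 * A * r + (4 * u₂ θ + 6 * A ^ 2)) * inner ℝ v w|
      ≤ ε * ‖v‖ * ‖w‖ := by
  obtain ⟨o, ho, hu⟩ := h.exists_metric_eq
  obtain ⟨r₀, hr₀, hr⟩ := exists_radius_of_eventually
    ((ho.eventually_abs_le hε).and (eventually_norm_gt R))
  refine ⟨r₀, fun r hrr θ v w _ _ => ?_⟩
  have hpos : 0 < r := hr₀.trans_le hrr
  obtain ⟨h1, h2⟩ := hr r hrr θ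
  have h3 : sigmaOn g r θ v w = r ^ 2 * u (r • (θ : E3)) ^ 4 * inner ℝ v w := by
    simp only [sigmaOn, h.conformal.g_eq _ h2, Matrix.one_apply, PiLp.inner_apply,
      Fin.sum_univ_three]
    simp
    ring
  have h4 := hu _ h2
  rw [rho_smul_sphere hpos, direction_smul_sphere hpos] at h4
  have h5 : sigmaOn g r θ v w - (r ^ 2 + 4 * A * r + (4 * u₂ θ + 6 * A ^ 2)) * inner ℝ v w
      = o (r • (θ : E3)) * inner ℝ v w := by
    rw [h3, h4]
    field_simp
    ring
  rw [h5, abs_mul, mul_assoc]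
  exact mul_le_mul h1 (abs_real_inner_le_norm v w) (abs_nonneg _) hε.le

theorem normHOn_asymptotics {ε : ℝ} (hε : 0 < ε) : ∃ r₀ : ℝ, 0 < r₀ ∧ ∀ r ≥ r₀, ∀ θ : S2,
    |normHOn g k r θ - (2 / r - 8 * A / r ^ 2 + (-12 * u₂ θ + 18 * A ^ 2
      - (1 / 4) * (∑ i, B i * (θ : E3) i) ^ 2) / r ^ 3)| ≤ ε / r ^ 3 := by
  obtain ⟨o, ho, hN⟩ := h.exists_normH_eq
  obtain ⟨r₀, hr₀, hr⟩ := exists_radius_of_eventually ((ho.eventually_abs_le hε).and hN)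
  refine ⟨r₀, hr₀, fun r hrr θ => ?_⟩
  have hpos : 0 < r := hr₀.trans_le hrr
  obtain ⟨h1, h2⟩ := hr r hrr θ
  simp only [rho_smul_sphere hpos, direction_smul_sphere hpos, unitCoord_smul_sphere hpos] at h2
  have h3 : normHOn g k r θ - (2 / r - 8 * A / r ^ 2 + (-12 * u₂ θ + 18 * A ^ 2
      - (1 / 4) * (∑ i, B i * (θ : E3) i) ^ 2) / r ^ 3) = o (r • (θ : E3)) / r ^ 3 := by
    rw [normHOn, h2]
    field_simp
    ring
  rw [h3, abs_div, abs_of_pos (pow_pos hpos 3)]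
  gcongr

theorem alphaHOn_asymptotics {d : Fin 3 → Fin 3 → ℝ} (hd : ∀ i (θ : S2), Y₂ i θ =
      ∑ j, d i j * (θ : E3) j
        + A * (-(5 / 2) * B i + (1 / 2) * (∑ j, B j * (θ : E3) j) * (θ : E3) i))
    {ε : ℝ} (hε : 0 < ε) : ∃ r₀ : ℝ, 0 < r₀ ∧ ∀ r ≥ r₀, ∀ (θ : S2) (v : E3),
      inner ℝ (θ : E3) v = 0 →
      |alphaHOn g k r θ v - ((3 / 2) * (∑ i, B i * v i) / r
        - (6 * A * (∑ i, B i * v i) - (5 / 2) * (∑ i, ∑ j, d i j * v i * (θ : E3) j)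
          + (1 / 2) * (∑ i, ∑ j, d i j * (θ : E3) i * v j)) / r ^ 2)| ≤ ε / r ^ 2 * ‖v‖ := by
  obtain ⟨c, hc, hα⟩ := h.exists_alphaH_eq hd
  obtain ⟨r₀, hr₀, hr⟩ := exists_radius_of_eventually
    ((eventually_all.2 fun i => (hc i).eventually_abs_le (by positivity : 0 < ε / 3)).and hα)
  refine ⟨r₀, hr₀, fun r hrr θ v hv => ?_⟩
  have hpos : 0 < r := hr₀.trans_le hrr
  obtain ⟨h1, h2⟩ := hr r hrr θ
  -- The pullback evaluates the form on `r v`, which lowers each power of `1 / r` by one.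
  have h3 := h2 (r • v) (by rw [inner_smul_left, inner_smul_right, hv]; simp)
  simp only [rho_smul_sphere hpos, unitCoord_smul_sphere hpos, radialPart] at h3
  have h4 : alphaHOn g k r θ v - ((3 / 2) * (∑ i, B i * v i) / r
        - (6 * A * (∑ i, B i * v i) - (5 / 2) * (∑ i, ∑ j, d i j * v i * (θ : E3) j)
          + (1 / 2) * (∑ i, ∑ j, d i j * (θ : E3) i * v j)) / r ^ 2)
      = (∑ i, v i * c i (r • (θ : E3))) / r ^ 2 := by
    rw [alphaHOn, h3]
    simp only [Fin.sum_univ_three, PiLp.smul_apply, smul_eq_mul]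
    field_simp
    ring
  have h5 : |∑ i, v i * c i (r • (θ : E3))| ≤ ε * ‖v‖ := by
    calc |∑ i, v i * c i (r • (θ : E3))| ≤ ∑ i, |v i * c i (r • (θ : E3))| :=
          Finset.abs_sum_le_sum_abs _ _
      _ ≤ ∑ _i : Fin 3, ‖v‖ * (ε / 3) := by
          refine Finset.sum_le_sum fun i _ => ?_
          rw [abs_mul]
          exact mul_le_mul (PiLp.norm_apply_le v i) (h1 i) (abs_nonneg _) (norm_nonneg v)
      _ = ε * ‖v‖ := by
          simp
          ring
  rw [h4, abs_div, abs_of_pos (pow_pos hpos 2), div_mul_eq_mul_div]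
  gcongr

end AsymptoticData

end HarmonicAsymptotics

end

theorem mainTheorem5 {M : Type*} [TopologicalSpace M]
    [ChartedSpace HarmonicAsymptotics.E3 M] [IsManifold (𝓡 3) ∞ M]
    (D : HarmonicAsymptotics.InitialDataSet M)
    (a : HarmonicAsymptotics.AsymptoticallyFlat D) (e : Fin a.numEnds)
    (u : HarmonicAsymptotics.E3 → ℝ) (Y : Fin 3 → HarmonicAsymptotics.E3 → ℝ)
    (hharm : a.IsHarmonic e u Y)
    (A : ℝ) (B : Fin 3 → ℝ)
    (u₂ : HarmonicAsymptotics.S2 → ℝ) (Y₂ : Fin 3 → HarmonicAsymptotics.S2 → ℝ)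
    (hu : HarmonicAsymptotics.HasExpansion u 1 A u₂)
    (hY : ∀ i, HarmonicAsymptotics.HasExpansion (Y i) 0 (B i) (Y₂ i)) :
    -- the induced metric
    (∀ ε : ℝ, 0 < ε → ∃ r₀ : ℝ, ∀ r ≥ r₀, ∀ (θ : HarmonicAsymptotics.S2) (v w : HarmonicAsymptotics.E3),
      inner ℝ (θ : HarmonicAsymptotics.E3) v = 0 → inner ℝ (θ : HarmonicAsymptotics.E3) w = 0 →
      |HarmonicAsymptotics.sigmaOn (a.gEnd e) r θ v w
          - (r ^ 2 + 4 * A * r + (4 * u₂ θ + 6 * A ^ 2)) * inner ℝ v w| ≤ ε * ‖v‖ * ‖w‖) ∧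
    -- the norm of the mean curvature vector
    (∀ ε : ℝ, 0 < ε → ∃ r₀ : ℝ, 0 < r₀ ∧ ∀ r ≥ r₀, ∀ θ : HarmonicAsymptotics.S2,
      |HarmonicAsymptotics.normHOn (a.gEnd e) (a.kEnd e) r θ
          - (2 / r - 8 * A / r ^ 2
            + (-12 * u₂ θ + 18 * A ^ 2
                - (1 / 4) * (∑ i, B i * (θ : HarmonicAsymptotics.E3) i) ^ 2) / r ^ 3)|
        ≤ ε / r ^ 3) ∧
    -- the connection one-form, under the vacuum constraint equations, which determine `Y₂` up to
    -- the constants `d`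
    (HarmonicAsymptotics.VacuumConstraintOn (a.gEnd e) (a.kEnd e) (a.region e) →
      ∃ d : Fin 3 → Fin 3 → ℝ,
        (∀ i (θ : HarmonicAsymptotics.S2), Y₂ i θ =
          ∑ j, d i j * (θ : HarmonicAsymptotics.E3) j
            + A * (-(5 / 2) * B i
              + (1 / 2) * (∑ j, B j * (θ : HarmonicAsymptotics.E3) j)
                  * (θ : HarmonicAsymptotics.E3) i)) ∧
        (∀ ε : ℝ, 0 < ε → ∃ r₀ : ℝ, 0 < r₀ ∧ ∀ r ≥ r₀,
          ∀ (θ : HarmonicAsymptotics.S2) (v : HarmonicAsymptotics.E3),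
          inner ℝ (θ : HarmonicAsymptotics.E3) v = 0 →
          |HarmonicAsymptotics.alphaHOn (a.gEnd e) (a.kEnd e) r θ v
              - ((3 / 2) * (∑ i, B i * v i) / r
                - (6 * A * (∑ i, B i * v i)
                    - (5 / 2) * (∑ i, ∑ j, d i j * v i * (θ : HarmonicAsymptotics.E3) j)
                    + (1 / 2) * (∑ i, ∑ j, d i j * (θ : HarmonicAsymptotics.E3) i * v j))
                  / r ^ 2)|
            ≤ ε / r ^ 2 * ‖v‖)) := by
  obtain ⟨R, hR, h⟩ := HarmonicAsymptotics.exists_asymptoticData hharm hu hY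
  refine ⟨fun ε hε => h.sigmaOn_asymptotics hε, fun ε hε => h.normHOn_asymptotics hε,
    fun hvac => ?_⟩
  obtain ⟨d, hd⟩ := h.exists_linear_part fun x hx => (hvac x (lt_of_le_of_lt hR hx)).2
  exact ⟨d, hd, fun ε hε => h.alphaHOn_asymptotics hd hε⟩
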